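/- Let $n\ge 1$ be an integer and let $G=-\Delta_x-|x|^2\partial_t^2$ be the Grushin operator on $\mathbb{R}^{n+1}=\mathbb{R}^n_x\times\mathbb{R}_t$. For $f\in L^2(\mathbb{R}^{n+1})$ (complex valued), the solution of $$i\,\partial_s u-Gu=0\quad (s\in\mathbb{R}),\qquad u(\cdot,0)=f,$$ means a continuous map $u:\mathbb{R}\to L^2(\mathbb{R}^{n+1})$ with $u(0)=f$ such that, for every Schwartz function $\varphi$ on $\mathbb{R}^{n+1}$ and every $s\in\mathbb{R}$, $$\frac{d}{ds}\int_{\mathbb{R}^{n+1}}u(s)\,\varphi\,dx\,dt=-i\int_{\mathbb{R}^{n+1}}u(s)\,G\varphi\,dx\,dt .$$ Let $B(w,r)$ denote the open Euclidean ball in $\mathbb{R}^{n+1}$ with center $w$ and radius $r$ (empty if $r\le 0$). **Theorem.** Let $k<n$ be a real number, put $C_k=\frac{2}{n-k}$, and let $p,q\in[2,\infty]$ satisfy $\frac1p+\frac1q=\frac12$ (with $\frac1\infty=0$). There is a finite constant $C(q,k)$, depending only on $n$, $q$ and $k$, such that for every $w_0\in\mathbb{R}^{n+1}$, every $R_0>0$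 and every $f\in L^2(\mathbb{R}^{n+1})$ that vanishes almost everywhere outside $B(w_0,R_0)$, the solution $u$ with initial data $f$ satisfies $$\Big\|\,s\mapsto\|u(s)\|_{L^p(B(w_0,\frac12 k|s|))}\Big\|_{L^q\left((-\infty,-C_kR_0]\,\cup\,[C_kR_0,\infty)\right)}\le C(q,k)\,\|f\|_{L^2(\mathbb{R}^{n+1})}.$$ -/

import Mathlib

open MeasureTheory
open scoped ENNReal NNReal SchwartzMap

namespace Grushin

/-- The space `ℝⁿ⁺¹ = ℝⁿ × ℝ` of points `(x, t)`, with Lebesgue measure as its volume.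
Its Mathlib norm is the maximum norm, so Euclidean balls are defined separately below. -/
abbrev Space (n : ℕ) : Type := EuclideanSpace ℝ (Fin n) × ℝ

/-- The open Euclidean ball `B(w₀, r)` in `ℝⁿ⁺¹` (empty if `r ≤ 0`). -/
def ball {n : ℕ} (w₀ : Space n) (r : ℝ) : Set (Space n) :=
  {w | Real.sqrt (‖w.1 - w₀.1‖ ^ 2 + (w.2 - w₀.2) ^ 2) < r}

/-- The Grushin operator `G φ (x, t) = - Δₓ φ (x, t) - |x|² ∂ₜ² φ (x, t)`, for smooth `φ`. -/
noncomputable def G {n : ℕ} (φ : Space n → ℂ) (w : Space n) : ℂ :=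
  - Laplacian.laplacian (fun x : EuclideanSpace ℝ (Fin n) => φ (x, w.2)) w.1
    - ((‖w.1‖ ^ 2 : ℝ) : ℂ) * iteratedDeriv 2 (fun t : ℝ => φ (w.1, t)) w.2

/-- `u` is a solution of `i ∂ₛ u - G u = 0` on `ℝⁿ⁺¹ × ℝ` with `u (·, 0) = f ∈ L²`: it is a
continuous curve in `L²(ℝⁿ⁺¹)`, starts at `f`, and satisfies the equation in the sense of tempered
distributions, that is `d/ds ⟨u(s), φ⟩ = - i ⟨u(s), G φ⟩` for all Schwartz functions `φ`, where
`⟨v, φ⟩ = ∫ v φ` (`G` is symmetric with real coefficients). -/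
structure IsSolution {n : ℕ} (f : Lp ℂ 2 (volume : Measure (Space n)))
    (u : ℝ → Lp ℂ 2 (volume : Measure (Space n))) : Prop where
  continuous : Continuous u
  initial : u 0 = f
  equation : ∀ (φ : 𝓢(Space n, ℂ)) (s : ℝ),
    HasDerivAt (fun σ : ℝ => ∫ w, u σ w * φ w)
      (-Complex.I * ∫ w, u s w * G φ w) s

end Grushin

namespace Grushin

/-! A Fourier transform in `t` turns `G` at frequency `r` into the Hermite operator `-Δ + ω² |x|²`
with `ω = 2π|r|`, whose semigroup `exp (-z(-Δ + ω² |x|²))` has the explicit Mehler kernel for `Re z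
> 0`. The Schrödinger flow is the boundary value at `z = ε + i s`, `ε → 0⁺`, and every bound has to
be uniform in `ε`.

Dispersion. Inverting the Fourier transform gives the kernel `grushinKernel z τ y x`, an oscillatory
integral over `r`. For `z = 1/a` with `a > 0` the substitution `r = a μ / (2π)` makes `ω z = |μ|`
independent of `a`, so that `a` enters only through explicit powers and exponentials. The resulting
formula is holomorphic in `ζ = 1/z` as long as the growth `exp (|μ| |τ Im ζ|)` of the character is
beaten by the decay of the Mehler normalising factor, and the identity theorem carries it to `ζ =
1/(ε + i s)` (`grushinKernel_inv_eq`). This yields the bound `|s|^(-1 - n/2)` in the region `|τ| ≤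
n|s|/2` (`norm_grushinKernel_le`). The ground state energy `n ω` of the Hermite operator is thus
what creates a region of dispersion.

Linking to arbitrary weak solutions. No spectral theory is used. The solution is tested against the
Mehler kernel run backwards in time, times a character and a Gaussian cutoff `exp (-h t²)`, which is
a Schwartz function. The derivative of this pairing is a pure cutoff error of size `h^(1/4)`
(`IsSolution.exists_norm_pairing_sub_le`). Letting `h → 0` and then `ε → 0`, where the Mehler
operators form an approximate identity, transfers any bound on the regularised pairing to `u s` by
duality (`IsSolution.norm_integral_conj_mul_le`). The `L²` contraction of the Mehler operators,
proved by `T T*` and Schur's test, gives `‖u s‖ ≤ ‖f‖`; the kernel bound gives the `L¹`–`L^∞`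
estimate on `B(w₀, k|s|/2)`.

Conclusion. If `|s| ≥ 2R₀/(n-k)`, points of `B(w₀, k|s|/2)` and `B(w₀, R₀)` have `t`-coordinates at
most `n|s|/2` apart. Cauchy–Schwarz on the support bounds `‖f‖₁` by a multiple of `R₀^((n+1)/2)
‖f‖₂`, interpolation gives `L^p`, and the `q`-th power of the time profile is a multiple of
`R₀^(n+1) |s|^(-(n+2))`, whose integral over `|s| ≥ 2R₀/(n-k)` does not depend on `R₀`. -/

/-- `exp (-2 ω z)`. -/
noncomputable def nome (ω : ℝ) (z : ℂ) : ℂ := Complex.exp (-(2 * ω * z))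

/-- `tanh (ω z)`, written through `exp (-2 ω z)`. -/
noncomputable def mehlerTanh (ω : ℝ) (z : ℂ) : ℂ := (1 - nome ω z) / (1 + nome ω z)

/-- The `n`-th root of the normalising factor of the Mehler kernel. -/
noncomputable def mehlerRoot (ω : ℝ) (z : ℂ) : ℂ :=
  (√(ω / Real.pi) : ℝ) * Complex.exp (-(ω * z)) * (1 - nome ω z ^ 2) ^ (-(1 / 2) : ℂ)

/-- The exponent of the Mehler kernel. -/
noncomputable def mehlerExp {n : ℕ} (ω : ℝ) (z : ℂ) (y x : EuclideanSpace ℝ (Fin n)) : ℂ :=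
  -(ω / 4) * (mehlerTanh ω z * (‖x + y‖ ^ 2 : ℝ) + (mehlerTanh ω z)⁻¹ * (‖x - y‖ ^ 2 : ℝ))

/-- The Mehler kernel of `exp (- z (-Δ + ω² |x|²))`, for `Re z > 0`. -/
noncomputable def mehler {n : ℕ} (ω : ℝ) (z : ℂ) (y x : EuclideanSpace ℝ (Fin n)) : ℂ :=
  mehlerRoot ω z ^ n * Complex.exp (mehlerExp ω z y x)

/-! ### Size of the Mehler kernel in the right half plane -/

section Bounds

variable {ω : ℝ} {z : ℂ}

lemma norm_nome (ω : ℝ) (z : ℂ) : ‖nome ω z‖ = Real.exp (-(2 * ω * z.re)) := by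
  simp [nome, Complex.norm_exp]

lemma norm_nome_lt_one (hω : 0 < ω) (hz : 0 < z.re) : ‖nome ω z‖ < 1 := by
  rw [norm_nome, Real.exp_lt_one_iff]; nlinarith [mul_pos hω hz]

lemma one_sub_nome_ne_zero (hω : 0 < ω) (hz : 0 < z.re) : 1 - nome ω z ≠ 0 := by
  intro h
  have := norm_nome_lt_one hω hz
  rw [← sub_eq_zero.1 h] at this
  simp at this

lemma one_add_nome_ne_zero (hω : 0 < ω) (hz : 0 < z.re) : 1 + nome ω z ≠ 0 := by
  intro h
  have := norm_nome_lt_one hω hz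
  rw [eq_neg_of_add_eq_zero_right h] at this
  simp at this

lemma mehlerTanh_ne_zero (hω : 0 < ω) (hz : 0 < z.re) : mehlerTanh ω z ≠ 0 :=
  div_ne_zero (one_sub_nome_ne_zero hω hz) (one_add_nome_ne_zero hω hz)

/-- The Cayley transform maps the unit disc to the right half plane. With `w = nome` this handles
`tanh`, with `w = -nome` it handles `coth`. -/
lemma re_one_sub_div_one_add (w : ℂ) :
    ((1 - w) / (1 + w)).re = (1 - ‖w‖ ^ 2) / ‖1 + w‖ ^ 2 := by
  rw [Complex.div_re, ← add_div, Complex.normSq_eq_norm_sq, Complex.sq_norm w, Complex.normSq_apply]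
  congr 1
  simp; ring

lemma re_mehlerTanh_nonneg (hω : 0 < ω) (hz : 0 < z.re) : 0 ≤ (mehlerTanh ω z).re := by
  rw [mehlerTanh, re_one_sub_div_one_add]
  have := norm_nome_lt_one hω hz
  have h0 := norm_nonneg (nome ω z)
  apply div_nonneg _ (by positivity)
  nlinarith

lemma inv_mehlerTanh : (mehlerTanh ω z)⁻¹ = (1 - -nome ω z) / (1 + -nome ω z) := by
  rw [mehlerTanh, inv_div]; ring

lemma re_mehlerTanh_inv_nonneg (hω : 0 < ω) (hz : 0 < z.re) : 0 ≤ (mehlerTanh ω z)⁻¹.re := by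
  rw [inv_mehlerTanh, re_one_sub_div_one_add, norm_neg]
  have := norm_nome_lt_one hω hz
  have h0 := norm_nonneg (nome ω z)
  apply div_nonneg _ (by positivity)
  nlinarith

/-- The square on the left is `(1 - e)² + 2e(1 - cos q)` with `e = exp (-p)`, and `1 - cos q ≤
q²/2`. -/
lemma norm_sq_one_sub_exp_neg_le (p q : ℝ) :
    ‖1 - Complex.exp (-(p + q * Complex.I))‖ ^ 2 ≤
      (1 - Real.exp (-p)) ^ 2 + Real.exp (-p) * q ^ 2 := by
  have h : -(p + q * Complex.I) = ((-p : ℝ) : ℂ) + ((-q : ℝ) : ℂ) * Complex.I := by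
    push_cast; ring
  rw [h, Complex.exp_add_mul_I, ← Complex.ofReal_cos, ← Complex.ofReal_sin, ← Complex.ofReal_exp,
    Complex.sq_norm, Complex.normSq_apply]
  simp only [Complex.sub_re, Complex.one_re, Complex.mul_re, Complex.ofReal_re, Complex.add_re,
    Complex.ofReal_im, Complex.I_re, Complex.I_im, Complex.sub_im, Complex.one_im, Complex.mul_im,
    Complex.add_im]
  have hc := Real.one_sub_sq_div_two_le_cos (x := -q)
  have hs := Real.sin_sq_add_cos_sq (-q)
  have he := Real.exp_pos (-p)
  nlinarith [mul_le_mul_of_nonneg_left hc he.le]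

/-- Source of the Gaussian decay in `x - y`: up to a factor 2, `ω Re coth (ω z)` dominates `Re
(1/z)`, its limit as `ω → 0`, so the decay rate is uniform in `ω`. -/
lemma le_re_mehlerTanh_inv (hω : 0 < ω) (hz : 0 < z.re) :
    z.re / (2 * ‖z‖ ^ 2) ≤ ω * (mehlerTanh ω z)⁻¹.re := by
  have hz0 : z ≠ 0 := by rintro rfl; simp at hz
  rw [inv_mehlerTanh, re_one_sub_div_one_add, norm_neg, norm_nome, ← sub_eq_add_neg]
  set p := 2 * ω * z.re with hp
  set q := 2 * ω * z.im with hq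
  have hp0 : 0 < p := by positivity
  have h1 := norm_sq_one_sub_exp_neg_le p q
  have h2 : nome ω z = Complex.exp (-(p + q * Complex.I)) := by
    rw [nome, hp, hq]
    congr 2
    apply Complex.ext <;> simp
  rw [← h2] at h1
  have h3 : 0 < ‖1 - nome ω z‖ ^ 2 := by
    have := norm_pos_iff.2 (one_sub_nome_ne_zero hω hz); positivity
  have h4 : ‖z‖ ^ 2 = (p ^ 2 + q ^ 2) / (4 * ω ^ 2) := by
    rw [Complex.sq_norm, Complex.normSq_apply, hp, hq]; field_simp; ring
  have h5 : z.re = p / (2 * ω) := by rw [hp]; field_simp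
  have h6 : z.re / (2 * ‖z‖ ^ 2) = p * ω / (p ^ 2 + q ^ 2) := by
    rw [h4, h5]; field_simp; ring
  rw [h6, mul_div_assoc', div_le_div_iff₀ (by positivity) h3]
  set e := Real.exp (-p) with he
  have he0 : 0 < e := Real.exp_pos _
  have he1 : 1 - p ≤ e := by have := Real.add_one_le_exp (-p); linarith
  have he2 : e < 1 := by rw [he, Real.exp_lt_one_iff]; linarith
  have h7 : p * e ≤ 1 - e ^ 2 := by
    have h8 : p + 1 ≤ Real.exp p := Real.add_one_le_exp p
    have h9 : Real.exp p * e = 1 := by rw [he, ← Real.exp_add]; simp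
    nlinarith
  have h10 : p * (1 - e) ^ 2 ≤ (1 - e ^ 2) * p ^ 2 := by
    have : (1 - e) ≤ p * (1 + e) := by nlinarith
    have h11 : 0 ≤ p * (1 - e) := by nlinarith
    nlinarith
  have h12 : p * ((1 - e) ^ 2 + e * q ^ 2) ≤ (1 - e ^ 2) * (p ^ 2 + q ^ 2) := by
    nlinarith [sq_nonneg q]
  have h13 : p * ‖1 - nome ω z‖ ^ 2 ≤ (1 - e ^ 2) * (p ^ 2 + q ^ 2) :=
    (mul_le_mul_of_nonneg_left h1 hp0.le).trans h12
  nlinarith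

lemma norm_mehlerTanh_le (hω : 0 < ω) (hz : 0 < z.re) :
    ‖mehlerTanh ω z‖ ≤ (1 + ‖nome ω z‖) / (1 - ‖nome ω z‖) := by
  have := norm_nome_lt_one hω hz
  rw [mehlerTanh, norm_div]
  have h1 := norm_sub_le (1 : ℂ) (nome ω z)
  have h2 := norm_sub_norm_le (1 : ℂ) (-nome ω z)
  rw [norm_neg, sub_neg_eq_add] at h2
  rw [norm_one] at h1 h2
  exact div_le_div₀ (by positivity) h1 (by linarith) h2

lemma norm_mehlerTanh_inv_le (hω : 0 < ω) (hz : 0 < z.re) :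
    ‖(mehlerTanh ω z)⁻¹‖ ≤ (1 + ‖nome ω z‖) / (1 - ‖nome ω z‖) := by
  have := norm_nome_lt_one hω hz
  rw [mehlerTanh, inv_div, norm_div]
  have h1 := norm_add_le (1 : ℂ) (nome ω z)
  have h2 := norm_sub_norm_le (1 : ℂ) (nome ω z)
  rw [norm_one] at h1 h2
  exact div_le_div₀ (by positivity) h1 (by linarith) h2

lemma norm_mehlerRoot_sq (hω : 0 < ω) (hz : 0 < z.re) :
    ‖mehlerRoot ω z‖ ^ 2 = ω / Real.pi * ‖nome ω z‖ / ‖1 - nome ω z ^ 2‖ := by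
  have h0 : 1 - nome ω z ^ 2 ≠ 0 := by
    have := mul_ne_zero (one_sub_nome_ne_zero hω hz) (one_add_nome_ne_zero hω hz)
    convert! this using 1; ring
  have h1 : ‖(1 - nome ω z ^ 2) ^ (-(1 / 2) : ℂ)‖ ^ 2 = ‖1 - nome ω z ^ 2‖⁻¹ := by
    have : (-(1 / 2) : ℂ) = ((-(1 / 2) : ℝ) : ℂ) := by push_cast; ring
    rw [this, Complex.norm_cpow_real, ← Real.rpow_natCast, ← Real.rpow_mul (norm_nonneg _),
      ← Real.rpow_neg_one]
    norm_num
  rw [mehlerRoot, norm_mul, norm_mul, mul_pow, mul_pow, h1, Complex.norm_real, Real.norm_eq_abs,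
    sq_abs, Real.sq_sqrt (by positivity), Complex.norm_exp, norm_nome, ← Real.exp_nat_mul]
  simp only [Complex.neg_re, Complex.mul_re, Complex.ofReal_re, Complex.ofReal_im]
  rw [div_eq_mul_inv (_ * _)]
  congr 3
  push_cast; ring

/-- The natural rate is `exp (-2ωε)`. The bound `1 - exp (-a) ≥ a/(1+a)` costs the factor `1 + 4ωδ`,
which is absorbed by giving up `exp (ωδ/4)`. The remaining rate, `7/8` per root, must stay above the
`3/4` used in the contour rotation. -/
lemma norm_mehlerRoot_sq_le {ε : ℝ} (hε : 0 < ε) (hω : 0 < ω) (hz : ε ≤ z.re) :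
    ‖mehlerRoot ω z‖ ^ 2 ≤ 4 / (Real.pi * ε) * Real.exp (-(7 / 4 * ω * ε)) := by
  have hz' : 0 < z.re := hε.trans_le hz
  set δ := z.re
  rw [norm_mehlerRoot_sq hω hz']
  have h0 : 0 < 4 * ω * δ := by positivity
  have h1 : 4 * ω * δ / (1 + 4 * ω * δ) ≤ ‖1 - nome ω z ^ 2‖ := by
    have h2 : 1 - ‖nome ω z‖ ^ 2 ≤ ‖1 - nome ω z ^ 2‖ := by
      have := norm_sub_norm_le (1 : ℂ) (nome ω z ^ 2)
      rwa [norm_one, norm_pow] at this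
    refine le_trans ?_ h2
    rw [norm_nome, ← Real.exp_nat_mul]
    have h3 : (↑(2 : ℕ) * -(2 * ω * δ)) = -(4 * ω * δ) := by push_cast; ring
    rw [h3, Real.exp_neg, div_le_iff₀ (by positivity)]
    have h4 := Real.add_one_le_exp (4 * ω * δ)
    have h5 : (Real.exp (4 * ω * δ))⁻¹ ≤ (4 * ω * δ + 1)⁻¹ := by gcongr
    have h6 : (4 * ω * δ + 1)⁻¹ * (1 + 4 * ω * δ) = 1 := by field_simp; ring
    nlinarith
  have h7 : 1 + 4 * ω * δ ≤ 16 * Real.exp (ω * δ / 4) := by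
    have := Real.add_one_le_exp (ω * δ / 4)
    nlinarith [mul_pos hω hz']
  calc ω / Real.pi * ‖nome ω z‖ / ‖1 - nome ω z ^ 2‖
      ≤ ω / Real.pi * ‖nome ω z‖ / (4 * ω * δ / (1 + 4 * ω * δ)) := by gcongr
    _ = 1 / (4 * Real.pi * δ) * (‖nome ω z‖ * (1 + 4 * ω * δ)) := by field_simp
    _ ≤ 1 / (4 * Real.pi * δ) * (Real.exp (-(2 * ω * δ)) * (16 * Real.exp (ω * δ / 4))) := by
        rw [norm_nome]; gcongr
    _ = 4 / (Real.pi * δ) * Real.exp (-(7 / 4 * ω * δ)) := by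
        rw [mul_left_comm (Real.exp _), ← Real.exp_add,
          show -(2 * ω * δ) + ω * δ / 4 = -(7 / 4 * ω * δ) by ring]
        field_simp; ring
    _ ≤ _ := by gcongr

lemma norm_mehlerRoot_le {ε : ℝ} (hε : 0 < ε) (hω : 0 ≤ ω) (hz : ε ≤ z.re) :
    ‖mehlerRoot ω z‖ ≤ √(4 / (Real.pi * ε)) * Real.exp (-(7 / 8 * ω * ε)) := by
  rcases hω.eq_or_lt with rfl | hω
  -- At `ω = 0` the factor `√(ω / π)` makes the kernel vanish instead of giving the heat kernel.
  -- This is harmless: frequency zero is a null set.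
  · simp [mehlerRoot]; positivity
  refine (sq_le_sq₀ (norm_nonneg _) (by positivity)).1 ((norm_mehlerRoot_sq_le hε hω hz).trans_eq ?_)
  rw [mul_pow, Real.sq_sqrt (by positivity), ← Real.exp_nat_mul]
  congr 2; push_cast; ring

lemma re_mehlerExp {n : ℕ} (y x : EuclideanSpace ℝ (Fin n)) :
    (mehlerExp ω z y x).re = -(ω / 4 * ((mehlerTanh ω z).re * ‖x + y‖ ^ 2 +
      (mehlerTanh ω z)⁻¹.re * ‖x - y‖ ^ 2)) := by
  have : (-(ω / 4) : ℂ) = ((-(ω / 4) : ℝ) : ℂ) := by push_cast; ring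
  rw [mehlerExp, this, Complex.re_ofReal_mul, Complex.add_re, Complex.re_mul_ofReal,
    Complex.re_mul_ofReal]
  ring

lemma re_mehlerExp_le {n : ℕ} (hω : 0 < ω) (hz : 0 < z.re) (y x : EuclideanSpace ℝ (Fin n)) :
    (mehlerExp ω z y x).re ≤ -(z.re / (8 * ‖z‖ ^ 2) * ‖x - y‖ ^ 2) := by
  rw [re_mehlerExp]
  have h1 := mul_nonneg (mul_nonneg hω.le (re_mehlerTanh_nonneg hω hz)) (sq_nonneg ‖x + y‖)
  have h2 := mul_le_mul_of_nonneg_right (le_re_mehlerTanh_inv hω hz) (sq_nonneg ‖x - y‖)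
  have h3 : z.re / (8 * ‖z‖ ^ 2) = z.re / (2 * ‖z‖ ^ 2) / 4 := by rw [div_div]; ring
  rw [h3]
  linarith

lemma norm_mehler_le {n : ℕ} (hn : n ≠ 0) {ε S : ℝ} (hε : 0 < ε) (hω : 0 ≤ ω) (hz : z.re = ε)
    (hS : ‖z‖ ≤ S) (y x : EuclideanSpace ℝ (Fin n)) :
    ‖mehler ω z y x‖ ≤ (√(4 / (Real.pi * ε)) * Real.exp (-(7 / 8 * ω * ε))) ^ n *
      Real.exp (-(ε / (8 * S ^ 2) * ‖x - y‖ ^ 2)) := by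
  rcases hω.eq_or_lt with rfl | hω
  · simp [mehler, mehlerRoot, hn]; positivity
  have hz0 : 0 < z.re := hz ▸ hε
  have hzn : 0 < ‖z‖ := norm_pos_iff.2 (by rintro rfl; simp at hz0)
  rw [mehler, norm_mul, norm_pow, Complex.norm_exp]
  gcongr
  · exact norm_mehlerRoot_le hε hω.le hz.ge
  · refine (re_mehlerExp_le hω hz0 y x).trans ?_
    rw [hz]
    gcongr

lemma norm_mehler_le' {n : ℕ} (hn : n ≠ 0) {ε : ℝ} (hε : 0 < ε) (hω : 0 ≤ ω) (hz : ε ≤ z.re)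
    (y x : EuclideanSpace ℝ (Fin n)) :
    ‖mehler ω z y x‖ ≤ (√(4 / (Real.pi * ε)) * Real.exp (-(7 / 8 * ω * ε))) ^ n := by
  rcases hω.eq_or_lt with rfl | hω
  · simp [mehler, mehlerRoot, hn]; positivity
  have hz0 : 0 < z.re := hε.trans_le hz
  rw [mehler, norm_mul, norm_pow, Complex.norm_exp, ← mul_one ((√_ * _) ^ n)]
  gcongr
  · exact norm_mehlerRoot_le hε hω.le hz
  · rw [Real.exp_le_one_iff]
    refine (re_mehlerExp_le hω hz0 y x).trans ?_
    rw [Left.neg_nonpos_iff]; positivity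

end Bounds

/-! ### The derivative of the Mehler kernel in complex time -/

section Deriv

variable {ω : ℝ} {z : ℂ}

lemma hasDerivAt_nome (ω : ℝ) (z : ℂ) : HasDerivAt (nome ω) (-(2 * ω) * nome ω z) z := by
  have h : HasDerivAt (fun z : ℂ => -(2 * (ω : ℂ) * z)) (-(2 * ω)) z := by
    simpa using! ((hasDerivAt_id z).const_mul (2 * (ω : ℂ))).neg
  convert! h.cexp using 1
  rw [nome]; ring

lemma hasDerivAt_mehlerTanh (hω : 0 < ω) (hz : 0 < z.re) :
    HasDerivAt (mehlerTanh ω) (ω * (1 - mehlerTanh ω z ^ 2)) z := by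
  have h := ((hasDerivAt_nome ω z).const_sub 1).div ((hasDerivAt_nome ω z).const_add 1)
    (one_add_nome_ne_zero hω hz)
  convert! h using 1
  rw [mehlerTanh]
  have := one_add_nome_ne_zero hω hz
  field_simp
  ring

/-- The real part is positive because `|nome| < 1`, so the principal branch of the inverse square
root in `mehlerRoot` is holomorphic on `Re z > 0`. -/
lemma one_sub_nome_sq_mem_slitPlane (hω : 0 < ω) (hz : 0 < z.re) :
    1 - nome ω z ^ 2 ∈ Complex.slitPlane := by
  left
  have h := norm_nome_lt_one hω hz
  have h1 : (nome ω z ^ 2).re ≤ ‖nome ω z‖ ^ 2 := by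
    rw [← norm_pow]; exact Complex.re_le_norm _
  have h2 : ‖nome ω z‖ ^ 2 < 1 := by nlinarith [norm_nonneg (nome ω z)]
  simp only [Complex.sub_re, Complex.one_re]
  linarith

lemma hasDerivAt_mehlerRoot (hω : 0 < ω) (hz : 0 < z.re) :
    HasDerivAt (mehlerRoot ω)
      (mehlerRoot ω z * (-(ω / 2) * (mehlerTanh ω z + (mehlerTanh ω z)⁻¹))) z := by
  have hs := one_sub_nome_sq_mem_slitPlane hω hz
  have h1 : HasDerivAt (fun z : ℂ => -((ω : ℂ) * z)) (-ω) z := by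
    simpa using! ((hasDerivAt_id z).const_mul (ω : ℂ)).neg
  have h2 := (((hasDerivAt_nome ω z).pow 2).const_sub 1).cpow_const (c := (-(1 / 2) : ℂ)) hs
  have h := ((h1.cexp).const_mul ((√(ω / Real.pi) : ℝ) : ℂ)).mul h2
  convert! h using 1
  have e0 : 1 - nome ω z ^ 2 ≠ 0 := Complex.slitPlane_ne_zero hs
  have e1 := one_add_nome_ne_zero hω hz
  have e2 := one_sub_nome_ne_zero hω hz
  simp only [Pi.pow_apply]
  rw [Complex.cpow_sub _ _ e0, Complex.cpow_one]
  simp only [mehlerRoot, mehlerTanh, inv_div]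
  have e3 : 1 - nome ω z ^ 2 = (1 - nome ω z) * (1 + nome ω z) := by ring
  generalize (1 - nome ω z ^ 2) ^ (-(1 / 2) : ℂ) = D
  rw [e3]
  field_simp
  ring

/-- The logarithmic derivative in `z` of the Mehler kernel. -/
noncomputable def mehlerLogDeriv {n : ℕ} (ω : ℝ) (z : ℂ) (y x : EuclideanSpace ℝ (Fin n)) : ℂ :=
  -(n * ω / 2) * (mehlerTanh ω z + (mehlerTanh ω z)⁻¹)
    - ω ^ 2 / 4 * ((1 - mehlerTanh ω z ^ 2) * (‖x + y‖ ^ 2 : ℝ)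
      + (1 - (mehlerTanh ω z)⁻¹ ^ 2) * (‖x - y‖ ^ 2 : ℝ))

lemma hasDerivAt_mehler {n : ℕ} (hω : 0 < ω) (hz : 0 < z.re) (y x : EuclideanSpace ℝ (Fin n)) :
    HasDerivAt (fun z => mehler ω z y x) (mehler ω z y x * mehlerLogDeriv ω z y x) z := by
  have hT := hasDerivAt_mehlerTanh hω hz
  have hT0 := mehlerTanh_ne_zero hω hz
  have hE : HasDerivAt (fun z => mehlerExp ω z y x) _ z :=
    (((hT.mul_const ((‖x + y‖ ^ 2 : ℝ) : ℂ)).add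
      ((hT.fun_inv hT0).mul_const ((‖x - y‖ ^ 2 : ℝ) : ℂ))).const_mul (-(ω / 4) : ℂ))
  have h := ((hasDerivAt_mehlerRoot hω hz).pow n).mul hE.cexp
  convert! h using 1
  simp only [mehler, mehlerLogDeriv, Pi.pow_apply]
  rcases n with _ | n
  · simp
    field_simp
    ring
  · simp only [Nat.add_sub_cancel, pow_succ (mehlerRoot ω z) n]
    field_simp
    push_cast
    ring

end Deriv

/-! ### Exponentials of functions of temperate growth -/

section Schwartz

variable {V : Type*} [NormedAddCommGroup V] [NormedSpace ℝ V]

/-- Translate the functional equation `exp (w + v) = exp w · exp v` to derivatives at `v = 0`. -/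
lemma norm_iteratedFDeriv_cexp (i : ℕ) (w : ℂ) :
    ‖iteratedFDeriv ℝ i Complex.exp w‖ = ‖Complex.exp w‖ * ‖iteratedFDeriv ℝ i Complex.exp 0‖ := by
  have h : (fun v : ℂ => Complex.exp (w + v)) = fun v => Complex.exp w • Complex.exp v := by
    ext v; rw [Complex.exp_add, smul_eq_mul]
  have h1 := iteratedFDeriv_comp_add_left (𝕜 := ℝ) (f := Complex.exp) i w 0
  rw [h, iteratedFDeriv_const_smul_apply' (by fun_prop), add_zero] at h1
  rw [← h1, norm_smul]

/-- The composition bound for iterated derivatives produces `exp (q v)` times a power of `1 + ‖v‖`;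
linear decay of `Re q` already beats every power. -/
lemma exists_schwartzMap_cexp {q : V → ℂ} (hq : q.HasTemperateGrowth) {c C : ℝ} (hc : 0 < c)
    (h : ∀ v, (q v).re ≤ C - c * ‖v‖) : ∃ φ : 𝓢(V, ℂ), ∀ v, φ v = Complex.exp (q v) := by
  refine ⟨⟨fun v => Complex.exp (q v), Complex.contDiff_exp.comp hq.1, fun k m => ?_⟩, fun v => rfl⟩
  obtain ⟨l, D, hD0, hD⟩ := hq.norm_iteratedFDeriv_le_uniform m
  set A := ∑ i ∈ Finset.range (m + 1), ‖iteratedFDeriv ℝ i Complex.exp 0‖ with hA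
  have hA0 : 0 ≤ A := Finset.sum_nonneg fun _ _ => norm_nonneg _
  set N := k + l * m with hN
  refine ⟨m.factorial * A * (1 + D) ^ m * (N.factorial / c ^ N * Real.exp (C + c)), fun v => ?_⟩
  have h1 : ‖iteratedFDeriv ℝ m (fun v => Complex.exp (q v)) v‖ ≤
      m.factorial * (‖Complex.exp (q v)‖ * A) * ((1 + D) * (1 + ‖v‖) ^ l) ^ m := by
    refine norm_iteratedFDeriv_comp_le (N := m) (g := Complex.exp) (by fun_prop)
      (hq.1.of_le (by exact_mod_cast le_top)) le_rfl v ?_ ?_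
    · intro i hi
      rw [norm_iteratedFDeriv_cexp]
      gcongr
      exact Finset.single_le_sum (f := fun i => ‖iteratedFDeriv ℝ i Complex.exp 0‖)
        (fun _ _ => norm_nonneg _) (Finset.mem_range.2 (by omega))
    · intro i hi1 hi2
      have h2 : 1 ≤ (1 + D) * (1 + ‖v‖) ^ l := by
        have : 1 ≤ (1 + ‖v‖) ^ l := one_le_pow₀ (by linarith [norm_nonneg v])
        nlinarith
      calc _ ≤ D * (1 + ‖v‖) ^ l := hD i hi2 v
        _ ≤ (1 + D) * (1 + ‖v‖) ^ l := by gcongr; linarith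
        _ ≤ _ := le_self_pow₀ h2 (by omega)
  have h3 : (1 + ‖v‖) ^ N ≤ N.factorial / c ^ N * Real.exp (c * (1 + ‖v‖)) := by
    have := Real.pow_div_factorial_le_exp (c * (1 + ‖v‖)) (by positivity) N
    rw [mul_pow, div_le_iff₀ (by positivity)] at this
    rw [div_mul_eq_mul_div, le_div_iff₀ (by positivity)]
    linarith
  have h4 : ‖Complex.exp (q v)‖ ≤ Real.exp (C - c * ‖v‖) := by
    rw [Complex.norm_exp]; exact Real.exp_le_exp.2 (h v)
  calc ‖v‖ ^ k * ‖iteratedFDeriv ℝ m (fun v => Complex.exp (q v)) v‖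
      ≤ (1 + ‖v‖) ^ k * (m.factorial * (Real.exp (C - c * ‖v‖) * A) *
        ((1 + D) * (1 + ‖v‖) ^ l) ^ m) := by
        gcongr
        · linarith
        · exact h1.trans (by gcongr)
    _ = m.factorial * A * (1 + D) ^ m * ((1 + ‖v‖) ^ N * Real.exp (C - c * ‖v‖)) := by
        rw [hN, pow_add, pow_mul, mul_pow]; ring
    _ ≤ m.factorial * A * (1 + D) ^ m * ((N.factorial / c ^ N * Real.exp (c * (1 + ‖v‖))) *
          Real.exp (C - c * ‖v‖)) := by gcongr
    _ = _ := by
        rw [mul_assoc (_ / _), ← Real.exp_add]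
        congr 3; ring_nf

end Schwartz

/-! ### The Mehler kernel solves the Hermite heat equation -/

section Laplacian

variable {n : ℕ}

lemma hasFDerivAt_normSq_add (y x v : EuclideanSpace ℝ (Fin n)) :
    HasDerivAt (fun s : ℝ => ‖x + s • v + y‖ ^ 2) (2 * inner ℝ (x + y) v) 0 := by
  have h : HasDerivAt (fun s : ℝ => x + s • v + y) v 0 := by
    simpa using! (((hasDerivAt_id (0 : ℝ)).smul_const v).const_add x).add_const y
  simpa using! h.norm_sq

/-- Along a line in direction `v` the exponent `q` is quadratic with slope `ℓ v x`, so the second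
derivative of `exp q` is `exp q · (ℓ² + ℓ')`. Summing over an orthonormal basis gives the formula by
Parseval, the cross term being `⟪x + y, x - y⟫`. -/
lemma laplacian_gaussian (a b : ℂ) (y x : EuclideanSpace ℝ (Fin n)) :
    Laplacian.laplacian (fun x : EuclideanSpace ℝ (Fin n) =>
      Complex.exp (-(a * (‖x + y‖ ^ 2 : ℝ) + b * (‖x - y‖ ^ 2 : ℝ)))) x =
    Complex.exp (-(a * (‖x + y‖ ^ 2 : ℝ) + b * (‖x - y‖ ^ 2 : ℝ))) *
      (4 * (a ^ 2 * (‖x + y‖ ^ 2 : ℝ) + b ^ 2 * (‖x - y‖ ^ 2 : ℝ)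
        + 2 * a * b * (‖x‖ ^ 2 - ‖y‖ ^ 2 : ℝ)) - 2 * n * (a + b)) := by
  set q : EuclideanSpace ℝ (Fin n) → ℂ := fun x =>
    -(a * (‖x + y‖ ^ 2 : ℝ) + b * (‖x - y‖ ^ 2 : ℝ)) with hq
  set ℓ : EuclideanSpace ℝ (Fin n) → EuclideanSpace ℝ (Fin n) → ℂ := fun v x =>
    -(a * (2 * inner ℝ (x + y) v : ℝ) + b * (2 * inner ℝ (x - y) v : ℝ)) with hℓ
  have hN : ∀ w : EuclideanSpace ℝ (Fin n), ContDiff ℝ 2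
      (fun x : EuclideanSpace ℝ (Fin n) => ((‖x + w‖ ^ 2 : ℝ) : ℂ)) := fun w =>
    Complex.ofRealCLM.contDiff.comp ((contDiff_id.add contDiff_const).norm_sq ℝ)
  have hqC : ContDiff ℝ 2 q := by
    have h1 := hN y
    have h2 := hN (-y)
    simp only [← sub_eq_add_neg] at h2
    exact ((contDiff_const.mul h1).add (contDiff_const.mul h2)).neg
  have hfC : ContDiff ℝ 2 (fun x => Complex.exp (q x)) := hqC.cexp
  have hline : ∀ x v : EuclideanSpace ℝ (Fin n),
      HasDerivAt (fun s : ℝ => q (x + s • v)) (ℓ v x) 0 := by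
    intro x v
    have h1 := (hasFDerivAt_normSq_add y x v).ofReal_comp.const_mul a
    have h2 := (hasFDerivAt_normSq_add (-y) x v).ofReal_comp.const_mul b
    simp only [← sub_eq_add_neg] at h2
    exact (h1.add h2).neg
  have hline' : ∀ x v : EuclideanSpace ℝ (Fin n),
      HasDerivAt (fun s : ℝ => ℓ v (x + s • v)) (-(a * (2 * ‖v‖ ^ 2 : ℝ) + b * (2 * ‖v‖ ^ 2 : ℝ))) 0 := by
    intro x v
    have h0 : ∀ w : EuclideanSpace ℝ (Fin n), HasDerivAt
        (fun s : ℝ => (2 * inner ℝ (x + s • v + w) v : ℝ)) (2 * ‖v‖ ^ 2) 0 := by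
      intro w
      have h : HasDerivAt (fun s : ℝ => x + s • v + w) v 0 := by
        simpa using! (((hasDerivAt_id (0 : ℝ)).smul_const v).const_add x).add_const w
      simpa [real_inner_self_eq_norm_sq] using! (h.inner ℝ (hasDerivAt_const (0 : ℝ) v)).const_mul 2
    have h1 := (h0 y).ofReal_comp.const_mul a
    have h2 := (h0 (-y)).ofReal_comp.const_mul b
    simp only [← sub_eq_add_neg] at h2
    exact (h1.add h2).neg
  have hd1 : ∀ v x, fderiv ℝ (fun x => Complex.exp (q x)) x v = Complex.exp (q x) * ℓ v x := by
    intro v x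
    have h1 : HasDerivAt (fun s : ℝ => x + s • v) v 0 := by
      simpa using! (((hasDerivAt_id (0 : ℝ)).smul_const v).const_add x)
    have h2 := ((hfC.differentiable (by norm_num)) (x + (0 : ℝ) • v)).hasFDerivAt.comp_hasDerivAt
      (0 : ℝ) h1
    have h3 := (hline x v).cexp
    simp only [zero_smul, add_zero] at h2 h3
    exact h2.unique h3
  have hd2 : ∀ v, fderiv ℝ (fderiv ℝ (fun x => Complex.exp (q x))) x v v =
      Complex.exp (q x) * (ℓ v x ^ 2 - (a * (2 * ‖v‖ ^ 2 : ℝ) + b * (2 * ‖v‖ ^ 2 : ℝ))) := by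
    intro v
    have hD : Differentiable ℝ (fderiv ℝ (fun x => Complex.exp (q x))) :=
      (hfC.fderiv_right (m := 1) (by norm_num)).differentiable (by norm_num)
    have h1 : HasDerivAt (fun s : ℝ => x + s • v) v 0 := by
      simpa using! (((hasDerivAt_id (0 : ℝ)).smul_const v).const_add x)
    have h2 := (hD (x + (0 : ℝ) • v)).hasFDerivAt.comp_hasDerivAt (0 : ℝ) h1
    have h3 := h2.clm_apply (hasDerivAt_const (0 : ℝ) v)
    have h4 := (hline x v).cexp.mul (hline' x v)
    have hℓ0 : ℓ 0 x = 0 := by simp [hℓ]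
    simp only [Function.comp_def, hd1, zero_smul, add_zero, hℓ0, mul_zero] at h3 h4
    have h5 := h3.unique h4
    rw [h5]; ring
  change Laplacian.laplacian (fun x => Complex.exp (q x)) x = Complex.exp (q x) * _
  rw [InnerProductSpace.laplacian_eq_iteratedFDeriv_orthonormalBasis _
    (EuclideanSpace.basisFun (Fin n) ℝ)]
  have hS : ∀ u w : EuclideanSpace ℝ (Fin n), ∑ i, (inner ℝ u (EuclideanSpace.basisFun (Fin n) ℝ i) : ℝ)
      * inner ℝ w (EuclideanSpace.basisFun (Fin n) ℝ i) = inner ℝ u w := by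
    intro u w
    rw [← (EuclideanSpace.basisFun (Fin n) ℝ).sum_inner_mul_inner u w]
    exact Finset.sum_congr rfl fun i _ => by rw [real_inner_comm w]
  simp only [iteratedFDeriv_two_apply, Matrix.cons_val_zero, Matrix.cons_val_one, hd2,
    Matrix.cons_val_fin_one]
  rw [← Finset.mul_sum]
  congr 1
  have hu : ∀ i, ‖EuclideanSpace.basisFun (Fin n) ℝ i‖ = 1 := fun i => by simp
  simp only [hu]
  rw [Finset.sum_sub_distrib]
  congr 1
  · have e1 : ∀ i, ℓ (EuclideanSpace.basisFun (Fin n) ℝ i) x ^ 2 =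
        4 * a ^ 2 * ((inner ℝ (x + y) (EuclideanSpace.basisFun (Fin n) ℝ i) *
          inner ℝ (x + y) (EuclideanSpace.basisFun (Fin n) ℝ i) : ℝ) : ℂ) +
        4 * b ^ 2 * ((inner ℝ (x - y) (EuclideanSpace.basisFun (Fin n) ℝ i) *
          inner ℝ (x - y) (EuclideanSpace.basisFun (Fin n) ℝ i) : ℝ) : ℂ) +
        8 * a * b * ((inner ℝ (x + y) (EuclideanSpace.basisFun (Fin n) ℝ i) *
          inner ℝ (x - y) (EuclideanSpace.basisFun (Fin n) ℝ i) : ℝ) : ℂ) := by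
      intro i
      simp only [hℓ]
      push_cast
      ring
    simp only [e1, Finset.sum_add_distrib, ← Finset.mul_sum, ← Complex.ofReal_sum, hS,
      real_inner_self_eq_norm_sq]
    have e2 : inner ℝ (x + y) (x - y) = ‖x‖ ^ 2 - ‖y‖ ^ 2 := by
      rw [inner_add_left, inner_sub_right, inner_sub_right, real_inner_self_eq_norm_sq,
        real_inner_self_eq_norm_sq, real_inner_comm]
      ring
    rw [e2]
    ring
  · simp
    ring

/-- With `hasDerivAt_mehler` this says `∂_z M = Δ M - ω² |x|² M`. The term in `‖y‖²` from
`laplacian_gaussian` is removed by the parallelogram law. -/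
lemma laplacian_mehler {ω : ℝ} {z : ℂ} (hω : 0 < ω) (hz : 0 < z.re)
    (y x : EuclideanSpace ℝ (Fin n)) :
    Laplacian.laplacian (fun x => mehler ω z y x) x =
      mehler ω z y x * (mehlerLogDeriv ω z y x + ω ^ 2 * (‖x‖ ^ 2 : ℝ)) := by
  have hE : ∀ x, mehlerExp ω z y x = -(ω / 4 * mehlerTanh ω z * (‖x + y‖ ^ 2 : ℝ) +
      ω / 4 * (mehlerTanh ω z)⁻¹ * (‖x - y‖ ^ 2 : ℝ)) := by
    intro x; rw [mehlerExp]; ring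
  have h0 : (fun x => mehler ω z y x) = mehlerRoot ω z ^ n • fun x =>
      Complex.exp (-(ω / 4 * mehlerTanh ω z * (‖x + y‖ ^ 2 : ℝ) +
      ω / 4 * (mehlerTanh ω z)⁻¹ * (‖x - y‖ ^ 2 : ℝ))) := by
    ext x; rw [mehler, hE]; rfl
  have hN : ∀ w : EuclideanSpace ℝ (Fin n), ContDiff ℝ 2
      (fun x : EuclideanSpace ℝ (Fin n) => ((‖x + w‖ ^ 2 : ℝ) : ℂ)) := fun w =>
    Complex.ofRealCLM.contDiff.comp ((contDiff_id.add contDiff_const).norm_sq ℝ)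
  have h1 := hN y
  have h2 := hN (-y)
  simp only [← sub_eq_add_neg] at h2
  rw [h0, InnerProductSpace.laplacian_smul _
    ((contDiff_const.mul h1).add (contDiff_const.mul h2)).neg.cexp.contDiffAt, laplacian_gaussian,
    mehler, ← hE, mehlerLogDeriv, smul_eq_mul, ← mul_assoc]
  congr 1
  have hT := mehlerTanh_ne_zero hω hz
  have hp : ((‖x‖ ^ 2 + ‖y‖ ^ 2 : ℝ) : ℂ) = ((‖x + y‖ ^ 2 + ‖x - y‖ ^ 2 : ℝ) : ℂ) / 2 := by
    have := parallelogram_law_with_norm ℝ x y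
    rw [show ‖x + y‖ ^ 2 + ‖x - y‖ ^ 2 = 2 * (‖x‖ ^ 2 + ‖y‖ ^ 2) by nlinarith]
    push_cast; ring
  have hy : ((‖y‖ ^ 2 : ℝ) : ℂ) = ((‖x + y‖ ^ 2 : ℝ) + (‖x - y‖ ^ 2 : ℝ)) / 2 - (‖x‖ ^ 2 : ℝ) := by
    push_cast at hp ⊢
    linear_combination hp
  rw [Complex.ofReal_sub, hy]
  field_simp
  ring

end Laplacian

instance (n : ℕ) : (volume : Measure (Space n)).IsAddHaarMeasure :=
  inferInstanceAs ((volume : Measure (EuclideanSpace ℝ (Fin n))).prod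
    (volume : Measure ℝ)).IsAddHaarMeasure

/-! ### Cauchy–Schwarz for pairings -/

section CauchySchwarz

variable {α : Type*} [MeasurableSpace α] {μ : Measure α}

lemma norm_integral_mul_le {f g : α → ℂ} (hf : MemLp f 2 μ) (hg : MemLp g 2 μ) :
    ‖∫ a, f a * g a ∂μ‖ ≤ √(∫ a, ‖f a‖ ^ 2 ∂μ) * √(∫ a, ‖g a‖ ^ 2 ∂μ) := by
  have h := integral_mul_le_Lp_mul_Lq_of_nonneg (μ := μ) (p := 2) (q := 2)
    (f := fun a => ‖f a‖) (g := fun a => ‖g a‖) (by constructor <;> norm_num)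
    (.of_forall fun _ => norm_nonneg _) (.of_forall fun _ => norm_nonneg _)
    (by simpa using hf.norm) (by simpa using hg.norm)
  calc _ ≤ ∫ a, ‖f a‖ * ‖g a‖ ∂μ := by
        simpa only [norm_mul] using norm_integral_le_integral_norm (fun a => f a * g a) (μ := μ)
    _ ≤ _ := by simpa [Real.sqrt_eq_rpow] using h

lemma integrable_mul_of_memLp {f g : α → ℂ} (hf : MemLp f 2 μ) (hg : MemLp g 2 μ) :
    Integrable (fun a => f a * g a) μ := hf.integrable_mul hg

lemma norm_Lp_eq_sqrt (v : Lp ℂ 2 μ) : ‖v‖ = √(∫ a, ‖v a‖ ^ 2 ∂μ) := by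
  rw [@norm_eq_sqrt_re_inner ℂ, L2.inner_def]
  congr 1
  rw [← integral_re (L2.integrable_inner v v)]
  refine integral_congr_ae (.of_forall fun a => ?_)
  simp [← Complex.ofReal_pow]

lemma norm_integral_Lp_mul_le (v : Lp ℂ 2 μ) {g : α → ℂ} (hg : MemLp g 2 μ) :
    ‖∫ a, v a * g a ∂μ‖ ≤ ‖v‖ * √(∫ a, ‖g a‖ ^ 2 ∂μ) := by
  rw [norm_Lp_eq_sqrt]; exact norm_integral_mul_le (Lp.memLp v) hg

lemma norm_integral_Lp_mul_le_of_le (v : Lp ℂ 2 μ) {g : α → ℂ} {b : α → ℝ}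
    (hg : AEStronglyMeasurable g μ) (hb : MemLp b 2 μ) (h : ∀ a, ‖g a‖ ≤ b a) :
    ‖∫ a, v a * g a ∂μ‖ ≤ ‖v‖ * √(∫ a, b a ^ 2 ∂μ) := by
  have hg2 : MemLp g 2 μ := hb.mono' hg (.of_forall h)
  refine (norm_integral_Lp_mul_le v hg2).trans ?_
  gcongr ?_ * √?_
  exact integral_mono (hg2.integrable_norm_pow two_ne_zero) hb.integrable_sq
    fun a => by simpa using pow_le_pow_left₀ (norm_nonneg _) (h a) 2

end CauchySchwarz

/-! ### Differentiating a solution against a moving test function -/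

section Pairing

variable {n : ℕ} {f : Lp ℂ 2 (volume : Measure (Space n))}
  {u : ℝ → Lp ℂ 2 (volume : Measure (Space n))}

/-- Product rule for the pairing of a solution with a differentiable family of test functions. -/
lemma IsSolution.hasDerivAt_integral_mul (hu : IsSolution f u) {φ : ℝ → 𝓢(Space n, ℂ)}
    {φ' : ℝ → Space n → ℂ} {σ δ : ℝ} (hδ : 0 < δ) {b : Space n → ℝ} (hb : MemLp b 2 volume)
    (hφ'm : AEStronglyMeasurable (φ' σ) volume)
    (hφ : ∀ w, ∀ τ ∈ Metric.ball σ δ, HasDerivAt (fun τ => φ τ w) (φ' τ w) τ)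
    (hφ' : ∀ w, ∀ τ ∈ Metric.ball σ δ, ‖φ' τ w‖ ≤ b w) :
    HasDerivAt (fun τ => ∫ w, u τ w * φ τ w)
      (-Complex.I * (∫ w, u σ w * G (φ σ) w) + ∫ w, u σ w * φ' σ w) σ := by
  have hmem : ∀ τ, MemLp (φ τ) 2 volume := fun τ => (φ τ).memLp 2 volume
  have hint : ∀ τ τ', Integrable (fun w => u τ w * φ τ' w) := fun τ τ' =>
    integrable_mul_of_memLp (Lp.memLp _) (hmem _)
  have h1 := hu.equation (φ σ) σ
  have h2 : HasDerivAt (fun τ => ∫ w, u σ w * φ τ w) (∫ w, u σ w * φ' σ w) σ := by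
    refine (hasDerivAt_integral_of_dominated_loc_of_deriv_le (bound := fun w => ‖u σ w‖ * b w)
      (F' := fun τ w => u σ w * φ' τ w) (Metric.ball_mem_nhds σ hδ)
      (.of_forall fun τ => (hint σ τ).1) (hint σ σ) ((Lp.memLp _).1.mul hφ'm) ?_ ?_ ?_).2
    · refine .of_forall fun w τ hτ => ?_
      rw [norm_mul]
      gcongr
      exact hφ' w τ hτ
    · exact (Lp.memLp (u σ)).norm.integrable_mul hb
    · exact .of_forall fun w τ hτ => (hφ w τ hτ).const_mul _
  -- The curve `u` is only continuous in `L²`. The mixed difference is still negligible: it is at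
  -- most `‖u τ - u σ‖ = o(1)` times the `L²` distance of the test functions, which is `O(|τ - σ|)`.
  have h3 : HasDerivAt (fun τ => ∫ w, (u τ - u σ) w * (φ τ w - φ σ w)) 0 σ := by
    rw [hasDerivAt_iff_isLittleO]
    have hz : ∫ w, (u σ - u σ) w * (φ σ w - φ σ w) = 0 := by simp
    simp only [hz, sub_zero, smul_zero]
    have hbound : ∀ τ ∈ Metric.ball σ δ, ‖∫ w, (u τ - u σ) w * (φ τ w - φ σ w)‖ ≤
        ‖u τ - u σ‖ * (√(∫ w, b w ^ 2) * ‖τ - σ‖) := by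
      intro τ hτ
      have hle : ∀ w, ‖φ τ w - φ σ w‖ ≤ ‖τ - σ‖ * b w := by
        intro w
        rw [mul_comm]
        exact (convex_ball σ δ).norm_image_sub_le_of_norm_hasDerivWithin_le
          (fun x hx => (hφ w x hx).hasDerivWithinAt) (fun x hx => hφ' w x hx)
          (Metric.mem_ball_self hδ) hτ
      have := norm_integral_Lp_mul_le_of_le (u τ - u σ)
        ((hmem τ).1.sub (hmem σ).1) (hb.const_mul ‖τ - σ‖) hle
      simp only [mul_pow, integral_const_mul] at this
      rw [Real.sqrt_mul (by positivity), Real.sqrt_sq (norm_nonneg _)] at this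
      calc _ ≤ _ := this
        _ = _ := by ring
    have ho : (fun τ => ‖u τ - u σ‖ * (√(∫ w, b w ^ 2) * ‖τ - σ‖)) =o[nhds σ]
        fun τ => (1 : ℝ) * (√(∫ w, b w ^ 2) * ‖τ - σ‖) := by
      refine Asymptotics.IsLittleO.mul_isBigO ?_ (Asymptotics.isBigO_refl _ _)
      rw [Asymptotics.isLittleO_one_iff]
      have := (hu.continuous.sub (continuous_const (y := u σ))).norm.tendsto σ
      simpa using! this
    have ho2 : (fun τ => (1 : ℝ) * (√(∫ w, b w ^ 2) * ‖τ - σ‖)) =O[nhds σ] fun τ => τ - σ := by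
      simp only [one_mul]
      exact (Asymptotics.isBigO_refl (fun τ => τ - σ) _).norm_left.const_mul_left _
    refine Asymptotics.IsBigO.trans_isLittleO ?_ (ho.trans_isBigO ho2)
    refine Asymptotics.IsBigO.of_bound 1 ?_
    filter_upwards [Metric.ball_mem_nhds σ hδ] with τ hτ
    rw [one_mul]
    exact (hbound τ hτ).trans (le_abs_self _)
  have h4 := (h1.add h2).add h3
  have h5 : (fun τ => ∫ w, u τ w * φ τ w) = fun τ => (((∫ w, u τ w * φ σ w) + ∫ w, u σ w * φ τ w) +
      ∫ w, (u τ - u σ) w * (φ τ w - φ σ w)) - ∫ w, u σ w * φ σ w := by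
    ext τ
    have : ∫ w, (u τ - u σ) w * (φ τ w - φ σ w) = ((∫ w, u τ w * φ τ w) - ∫ w, u τ w * φ σ w) -
        ((∫ w, u σ w * φ τ w) - ∫ w, u σ w * φ σ w) := by
      rw [← integral_sub (hint _ _) (hint _ _), ← integral_sub (hint _ _) (hint _ _),
        ← integral_sub (by exact (hint _ _).sub (hint _ _)) (by exact (hint _ _).sub (hint _ _))]
      refine integral_congr_ae ?_
      filter_upwards [Lp.coeFn_sub (u τ) (u σ)] with w hw
      rw [hw, Pi.sub_apply]; ring
    rw [this]; ring
  rw [h5]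
  convert! h4.sub_const (∫ w, u σ w * φ σ w) using 1
  ring

end Pairing

/-! ### Mehler kernels as Schwartz test functions -/

section TestFunction

variable {n : ℕ}

/-- A Mehler kernel in `x` times a character and a Gaussian cutoff in `t`. -/
noncomputable def mehlerTest (κ h : ℝ) (z : ℂ) (y : EuclideanSpace ℝ (Fin n)) (w : Space n) : ℂ :=
  mehler |κ| z y w.1 * Complex.exp (κ * Complex.I * w.2 - h * w.2 ^ 2)

/-- The exponent has quadratic decay, from `re_mehlerExp_le` in `x` and from the cutoff in `t`; the
bounds `2ρ - 1 ≤ ρ²` reduce it to the linear decay asked for by `exists_schwartzMap_cexp`. -/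
lemma exists_schwartzMap_mehlerTest {κ h : ℝ} (hκ : κ ≠ 0) (hh : 0 < h) {z : ℂ} (hz : 0 < z.re)
    (y : EuclideanSpace ℝ (Fin n)) : ∃ φ : 𝓢(Space n, ℂ), ∀ w, φ w = mehlerTest κ h z y w := by
  have hω : 0 < |κ| := abs_pos.2 hκ
  set q : Space n → ℂ := fun w => mehlerExp |κ| z y w.1 + (κ * Complex.I * w.2 - h * w.2 ^ 2) with hq
  have hf : Function.HasTemperateGrowth (Prod.fst : Space n → EuclideanSpace ℝ (Fin n)) :=
    (ContinuousLinearMap.fst ℝ (EuclideanSpace ℝ (Fin n)) ℝ).hasTemperateGrowth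
  have hs : Function.HasTemperateGrowth (Prod.snd : Space n → ℝ) :=
    (ContinuousLinearMap.snd ℝ (EuclideanSpace ℝ (Fin n)) ℝ).hasTemperateGrowth
  have hs' : Function.HasTemperateGrowth (fun w : Space n => (w.2 : ℂ)) :=
    Function.HasTemperateGrowth.comp Function.Complex.hasTemperateGrowth_ofReal hs
  have hN : ∀ v : EuclideanSpace ℝ (Fin n), Function.HasTemperateGrowth
      (fun w : Space n => ((‖w.1 + v‖ ^ 2 : ℝ) : ℂ)) := fun v =>
    Function.HasTemperateGrowth.comp Function.Complex.hasTemperateGrowth_ofReal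
      ((Function.hasTemperateGrowth_norm_sq (H := EuclideanSpace ℝ (Fin n))).comp
        (hf.add (Function.HasTemperateGrowth.const v)))
  have hqT : q.HasTemperateGrowth := by
    have h1 := hN y
    have h2 := hN (-y)
    simp only [← sub_eq_add_neg] at h2
    simp only [hq, mehlerExp]
    fun_prop
  set a := z.re / (8 * ‖z‖ ^ 2) with ha
  have hz0 : z ≠ 0 := by rintro rfl; simp at hz
  have ha0 : 0 < a := by
    have := norm_pos_iff.2 hz0
    positivity
  have hre : ∀ w, (q w).re ≤ (a * (2 * ‖y‖ + 1) + h) - 2 * min a h * ‖w‖ := by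
    intro w
    have h1 := re_mehlerExp_le hω hz y w.1
    have h2 : (κ * Complex.I * w.2 - h * w.2 ^ 2 : ℂ).re = -(h * w.2 ^ 2) := by
      rw [← Complex.ofReal_pow, Complex.sub_re, Complex.re_ofReal_mul, Complex.ofReal_re]; simp
    have h3 : (q w).re ≤ -(a * ‖w.1 - y‖ ^ 2) - h * w.2 ^ 2 := by
      simp only [hq, Complex.add_re, h2]; linarith
    have h4 : ‖w.1‖ - ‖y‖ ≤ ‖w.1 - y‖ := norm_sub_norm_le _ _
    have h5 : ‖w‖ ≤ ‖w.1‖ + |w.2| := by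
      rw [Prod.norm_def]
      exact max_le (by linarith [abs_nonneg w.2]) (by rw [Real.norm_eq_abs]; linarith [norm_nonneg w.1])
    have h6 : min a h * ‖w‖ ≤ a * ‖w.1‖ + h * |w.2| := by
      have hm : 0 ≤ min a h := le_min ha0.le hh.le
      calc _ ≤ min a h * (‖w.1‖ + |w.2|) := by gcongr
        _ = min a h * ‖w.1‖ + min a h * |w.2| := by ring
        _ ≤ _ := by gcongr <;> simp
    have h7 : 2 * (‖w.1‖ - ‖y‖) - 1 ≤ ‖w.1 - y‖ ^ 2 := by nlinarith [sq_nonneg (‖w.1 - y‖ - 1)]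
    have h8 : 2 * |w.2| - 1 ≤ w.2 ^ 2 := by
      rw [← sq_abs]; nlinarith [sq_nonneg (|w.2| - 1)]
    nlinarith [mul_le_mul_of_nonneg_left h7 ha0.le, mul_le_mul_of_nonneg_left h8 hh.le]
  obtain ⟨φ, hφ⟩ := exists_schwartzMap_cexp hqT (c := 2 * min a h) (by positivity) hre
  refine ⟨mehlerRoot |κ| z ^ n • φ, fun w => ?_⟩
  rw [smul_apply, hφ, hq, mehlerTest, mehler, smul_eq_mul, Complex.exp_add]
  ring

/-- The character contributes `κ² ‖x‖²`, which cancels the potential in `laplacian_mehler`. What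
remains besides the heat equation are the derivatives that fall on the cutoff, all carrying a factor
`h`. -/
lemma G_mehlerTest {κ h : ℝ} (hκ : κ ≠ 0) {z : ℂ} (hz : 0 < z.re)
    (y : EuclideanSpace ℝ (Fin n)) (w : Space n) :
    G (mehlerTest κ h z y) w = mehlerTest κ h z y w * (-mehlerLogDeriv |κ| z y w.1
      - (‖w.1‖ ^ 2 : ℝ) * (-4 * κ * Complex.I * h * w.2 + 4 * h ^ 2 * w.2 ^ 2 - 2 * h)) := by
  have hω : 0 < |κ| := abs_pos.2 hκ
  have hNx : ∀ v : EuclideanSpace ℝ (Fin n), ContDiff ℝ 2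
      (fun x : EuclideanSpace ℝ (Fin n) => ((‖x + v‖ ^ 2 : ℝ) : ℂ)) := fun w =>
    Complex.ofRealCLM.contDiff.comp ((contDiff_id.add contDiff_const).norm_sq ℝ)
  have hC : ContDiff ℝ 2 (fun x => mehler |κ| z y x) := by
    have h1 := hNx y
    have h2 := hNx (-y)
    simp only [← sub_eq_add_neg] at h2
    simp only [mehler, mehlerExp]
    fun_prop
  have h1 : Laplacian.laplacian (fun x : EuclideanSpace ℝ (Fin n) => mehlerTest κ h z y (x, w.2)) w.1 =
      Complex.exp (κ * Complex.I * w.2 - h * w.2 ^ 2) * (mehler |κ| z y w.1 *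
        (mehlerLogDeriv |κ| z y w.1 + |κ| ^ 2 * (‖w.1‖ ^ 2 : ℝ))) := by
    rw [← laplacian_mehler hω hz, ← smul_eq_mul, ← InnerProductSpace.laplacian_smul _ hC.contDiffAt]
    refine congrArg (fun F : EuclideanSpace ℝ (Fin n) → ℂ =>
      (Laplacian.laplacian F : EuclideanSpace ℝ (Fin n) → ℂ) w.1) ?_
    funext x
    simp only [mehlerTest, Pi.smul_apply, smul_eq_mul]
    ring
  have hd : ∀ t : ℝ, HasDerivAt (fun t : ℝ => (κ * Complex.I * t - h * t ^ 2 : ℂ))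
      (κ * Complex.I - 2 * h * t) t := by
    intro t
    have h2 : HasDerivAt (fun t : ℝ => (t : ℂ)) 1 t := Complex.ofRealCLM.hasDerivAt
    convert! (h2.const_mul (κ * Complex.I : ℂ)).sub ((h2.pow 2).const_mul (h : ℂ)) using 1
    simp; ring
  have hd1 : ∀ t : ℝ, HasDerivAt (fun t : ℝ => mehlerTest κ h z y (w.1, t))
      (mehlerTest κ h z y (w.1, t) * (κ * Complex.I - 2 * h * t)) t := by
    intro t
    convert! ((hd t).cexp).const_mul (mehler |κ| z y w.1) using 1
    simp only [mehlerTest]; ring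
  have hd2 : ∀ t : ℝ, HasDerivAt
      (fun t : ℝ => mehlerTest κ h z y (w.1, t) * (κ * Complex.I - 2 * h * t))
      (mehlerTest κ h z y (w.1, t) * ((κ * Complex.I - 2 * h * t) ^ 2 - 2 * h)) t := by
    intro t
    have h2 : HasDerivAt (fun t : ℝ => (κ * Complex.I - 2 * h * t : ℂ)) (-(2 * h)) t := by
      have h3 : HasDerivAt (fun t : ℝ => (t : ℂ)) 1 t := Complex.ofRealCLM.hasDerivAt
      simpa using! (h3.const_mul (2 * h : ℂ)).const_sub (κ * Complex.I : ℂ)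
    convert! (hd1 t).mul h2 using 1
    ring
  have h2 : iteratedDeriv 2 (fun t : ℝ => mehlerTest κ h z y (w.1, t)) w.2 =
      mehlerTest κ h z y w * ((κ * Complex.I - 2 * h * w.2) ^ 2 - 2 * h) := by
    rw [iteratedDeriv_succ, iteratedDeriv_one, (funext fun t => (hd1 t).deriv :
      deriv (fun t : ℝ => mehlerTest κ h z y (w.1, t)) = _)]
    exact (hd2 w.2).deriv
  rw [G, h1, h2]
  have h3 : ((|κ| : ℝ) : ℂ) ^ 2 = (κ : ℂ) ^ 2 := by
    rw [← Complex.ofReal_pow, sq_abs, Complex.ofReal_pow]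
  rw [h3]
  simp only [mehlerTest]
  ring_nf
  rw [Complex.I_sq]
  ring

lemma continuous_mehlerTest (κ h : ℝ) (z : ℂ) (y : EuclideanSpace ℝ (Fin n)) :
    Continuous (mehlerTest κ h z y) := by
  unfold mehlerTest mehler mehlerExp; fun_prop

lemma continuous_mehlerLogDeriv (ω : ℝ) (z : ℂ) (y : EuclideanSpace ℝ (Fin n)) :
    Continuous (mehlerLogDeriv ω z y) := by
  unfold mehlerLogDeriv; fun_prop

end TestFunction

/-! ### Gaussian majorants -/

section Majorant

variable {n : ℕ}

/-- An anisotropic Gaussian centred at `(y, 0)`. -/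
noncomputable def gaussMaj (a h : ℝ) (y : EuclideanSpace ℝ (Fin n)) (w : Space n) : ℝ :=
  Real.exp (-(a * ‖w.1 - y‖ ^ 2)) * Real.exp (-(h * w.2 ^ 2))

lemma continuous_gaussMaj (a h : ℝ) (y : EuclideanSpace ℝ (Fin n)) :
    Continuous (gaussMaj a h y) := by
  unfold gaussMaj; fun_prop

lemma gaussMaj_nonneg (a h : ℝ) (y : EuclideanSpace ℝ (Fin n)) (w : Space n) :
    0 ≤ gaussMaj a h y w := by unfold gaussMaj; positivity

lemma gaussMaj_sq (a h : ℝ) (y : EuclideanSpace ℝ (Fin n)) (w : Space n) :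
    gaussMaj a h y w ^ 2 =
      Real.exp (-(2 * a) * ‖w.1 - y‖ ^ 2) * Real.exp (-(2 * h) * w.2 ^ 2) := by
  rw [gaussMaj, mul_pow, ← Real.exp_nat_mul, ← Real.exp_nat_mul]
  congr 2 <;> · push_cast; ring

lemma integrable_exp_neg_mul_norm_sub_sq {a : ℝ} (ha : 0 < a) (y : EuclideanSpace ℝ (Fin n)) :
    Integrable (fun x => Real.exp (-a * ‖x - y‖ ^ 2)) := by
  have h := (GaussianFourier.integrable_cexp_neg_mul_sq_norm_add (V := EuclideanSpace ℝ (Fin n))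
    (b := a) (by simpa using ha) 0 0).norm
  have h1 : Integrable (fun x : EuclideanSpace ℝ (Fin n) => Real.exp (-a * ‖x‖ ^ 2)) := by
    refine h.congr (.of_forall fun x => ?_)
    simp [Complex.norm_exp, ← Complex.ofReal_pow]
  exact h1.comp_sub_right y

lemma integral_exp_neg_mul_norm_sub_sq {a : ℝ} (ha : 0 < a) (y : EuclideanSpace ℝ (Fin n)) :
    ∫ x, Real.exp (-a * ‖x - y‖ ^ 2) = (Real.pi / a) ^ (n / 2 : ℝ) := by
  rw [integral_sub_right_eq_self (fun x => Real.exp (-a * ‖x‖ ^ 2)) y,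
    GaussianFourier.integral_rexp_neg_mul_sq_norm ha]
  simp

lemma memLp_gaussMaj {a h : ℝ} (ha : 0 < a) (hh : 0 < h) (y : EuclideanSpace ℝ (Fin n)) :
    MemLp (gaussMaj a h y) 2 volume := by
  rw [memLp_two_iff_integrable_sq (continuous_gaussMaj a h y).aestronglyMeasurable]
  simp only [gaussMaj_sq]
  exact (integrable_exp_neg_mul_norm_sub_sq (by positivity) y).mul_prod
    (integrable_exp_neg_mul_sq (by positivity))

lemma integral_gaussMaj_sq {a h : ℝ} (ha : 0 < a) (y : EuclideanSpace ℝ (Fin n)) :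
    ∫ w, gaussMaj a h y w ^ 2 =
      (Real.pi / (2 * a)) ^ (n / 2 : ℝ) * √(Real.pi / (2 * h)) := by
  simp only [gaussMaj_sq]
  rw [← integral_exp_neg_mul_norm_sub_sq (by positivity) y, ← integral_gaussian]
  exact integral_prod_mul (fun x : EuclideanSpace ℝ (Fin n) => Real.exp (-(2 * a) * ‖x - y‖ ^ 2))
    (fun t : ℝ => Real.exp (-(2 * h) * t ^ 2))

lemma norm_mehlerTest (κ h : ℝ) (z : ℂ) (y : EuclideanSpace ℝ (Fin n)) (w : Space n) :
    ‖mehlerTest κ h z y w‖ = ‖mehler |κ| z y w.1‖ * Real.exp (-(h * w.2 ^ 2)) := by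
  rw [mehlerTest, norm_mul, Complex.norm_exp]
  congr 2
  rw [← Complex.ofReal_pow, Complex.sub_re, Complex.re_ofReal_mul, Complex.ofReal_re]; simp

lemma norm_mehlerTest_le (hn : n ≠ 0) {ε S : ℝ} (hε : 0 < ε) {z : ℂ} (hz : z.re = ε)
    (hS : ‖z‖ ≤ S) (κ h : ℝ) (y : EuclideanSpace ℝ (Fin n)) (w : Space n) :
    ‖mehlerTest κ h z y w‖ ≤ (√(4 / (Real.pi * ε)) * Real.exp (-(7 / 8 * |κ| * ε))) ^ n *
      gaussMaj (ε / (8 * S ^ 2)) h y w := by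
  rw [norm_mehlerTest, gaussMaj, ← mul_assoc]
  gcongr
  exact norm_mehler_le hn hε (abs_nonneg κ) hz hS y w.1

/-- On the line `Re z = ε` the modulus of `nome` is constant and below 1, so `tanh` and `coth` are
bounded there uniformly in `Im z`. -/
lemma exists_norm_mehlerLogDeriv_le {ω ε : ℝ} (hω : 0 < ω) (hε : 0 < ε) (n : ℕ) :
    ∃ D, 0 ≤ D ∧ ∀ (z : ℂ) (y x : EuclideanSpace ℝ (Fin n)), z.re = ε →
      ‖mehlerLogDeriv ω z y x‖ ≤ D * (1 + ‖x + y‖ ^ 2 + ‖x - y‖ ^ 2) := by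
  set r := (1 + Real.exp (-(2 * ω * ε))) / (1 - Real.exp (-(2 * ω * ε))) with hr
  have h0 : Real.exp (-(2 * ω * ε)) < 1 := by
    rw [Real.exp_lt_one_iff]; nlinarith [mul_pos hω hε]
  have hr0 : 0 ≤ r := div_nonneg (by positivity) (by linarith)
  refine ⟨n * ω * r + ω ^ 2 / 4 * (1 + r ^ 2), by positivity, fun z y x hz => ?_⟩
  have hz0 : 0 < z.re := hz ▸ hε
  have h1 : ‖mehlerTanh ω z‖ ≤ r := by
    have := norm_mehlerTanh_le hω hz0; rwa [norm_nome, hz] at this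
  have h2 : ‖(mehlerTanh ω z)⁻¹‖ ≤ r := by
    have := norm_mehlerTanh_inv_le hω hz0; rwa [norm_nome, hz] at this
  have hsq : ∀ T : ℂ, ‖T‖ ≤ r → ‖1 - T ^ 2‖ ≤ 1 + r ^ 2 := fun T hT => by
    refine (norm_sub_le _ _).trans ?_
    rw [norm_one, norm_pow]
    gcongr
  have e1 : ‖(-(n * ω / 2) : ℂ)‖ = n * ω / 2 := by
    rw [norm_neg]; simp [abs_of_pos hω]
  have e2 : ‖(ω ^ 2 / 4 : ℂ)‖ = ω ^ 2 / 4 := by simp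
  calc ‖mehlerLogDeriv ω z y x‖
      ≤ n * ω / 2 * (r + r) + ω ^ 2 / 4 * ((1 + r ^ 2) * ‖x + y‖ ^ 2 + (1 + r ^ 2) * ‖x - y‖ ^ 2) := by
        rw [mehlerLogDeriv]
        refine (norm_sub_le _ _).trans ?_
        rw [norm_mul, norm_mul, e1, e2]
        have e3 : ∀ v : EuclideanSpace ℝ (Fin n), ‖((‖v‖ ^ 2 : ℝ) : ℂ)‖ = ‖v‖ ^ 2 := fun v => by simp
        gcongr
        · exact (norm_add_le _ _).trans (add_le_add h1 h2)
        · refine (norm_add_le _ _).trans ?_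
          rw [norm_mul, norm_mul, e3, e3]
          gcongr
          · exact hsq _ h1
          · exact hsq _ h2
    _ ≤ _ := by
        have : 0 ≤ n * ω * r * (‖x + y‖ ^ 2 + ‖x - y‖ ^ 2) := by positivity
        have : 0 ≤ ω ^ 2 / 4 * (1 + r ^ 2) := by positivity
        nlinarith

lemma norm_sq_le_of_sub (y x : EuclideanSpace ℝ (Fin n)) :
    ‖x‖ ^ 2 ≤ 2 * ‖x - y‖ ^ 2 + 2 * ‖y‖ ^ 2 := by
  have : ‖x‖ ≤ ‖x - y‖ + ‖y‖ := by simpa using norm_add_le (x - y) y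
  nlinarith [sq_nonneg (‖x - y‖ - ‖y‖), norm_nonneg x, norm_nonneg (x - y), norm_nonneg y]

lemma sq_mul_exp_le {a : ℝ} (ha : 0 < a) (r : ℝ) :
    r ^ 2 * Real.exp (-(a * r ^ 2)) ≤ 2 / a * Real.exp (-(a / 2 * r ^ 2)) := by
  have h1 : a / 2 * r ^ 2 ≤ Real.exp (a / 2 * r ^ 2) := by
    have := Real.add_one_le_exp (a / 2 * r ^ 2); linarith
  have h2 : Real.exp (-(a * r ^ 2)) = Real.exp (-(a / 2 * r ^ 2)) * Real.exp (-(a / 2 * r ^ 2)) := by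
    rw [← Real.exp_add]; ring_nf
  have h3 : Real.exp (a / 2 * r ^ 2) * Real.exp (-(a / 2 * r ^ 2)) = 1 := by
    rw [← Real.exp_add]; simp
  have h4 : r ^ 2 * Real.exp (-(a / 2 * r ^ 2)) ≤ 2 / a := by
    rw [le_div_iff₀ ha]
    nlinarith [Real.exp_pos (-(a / 2 * r ^ 2))]
  rw [h2, ← mul_assoc]
  gcongr

lemma exp_le_exp_half {a : ℝ} (ha : 0 < a) (r : ℝ) :
    Real.exp (-(a * r ^ 2)) ≤ Real.exp (-(a / 2 * r ^ 2)) := by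
  apply Real.exp_le_exp.2; nlinarith [mul_nonneg ha.le (sq_nonneg r)]

lemma norm_sq_mul_exp_le {a : ℝ} (ha : 0 < a) (y x : EuclideanSpace ℝ (Fin n)) :
    ‖x‖ ^ 2 * Real.exp (-(a * ‖x - y‖ ^ 2)) ≤
      (2 * ‖y‖ ^ 2 + 4 / a) * Real.exp (-(a / 2 * ‖x - y‖ ^ 2)) := by
  have h1 := sq_mul_exp_le ha ‖x - y‖
  have h2 := exp_le_exp_half ha ‖x - y‖
  calc _ ≤ (2 * ‖x - y‖ ^ 2 + 2 * ‖y‖ ^ 2) * Real.exp (-(a * ‖x - y‖ ^ 2)) := by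
        gcongr; exact norm_sq_le_of_sub y x
    _ = 2 * (‖x - y‖ ^ 2 * Real.exp (-(a * ‖x - y‖ ^ 2))) +
        2 * ‖y‖ ^ 2 * Real.exp (-(a * ‖x - y‖ ^ 2)) := by ring
    _ ≤ 2 * (2 / a * Real.exp (-(a / 2 * ‖x - y‖ ^ 2))) +
        2 * ‖y‖ ^ 2 * Real.exp (-(a / 2 * ‖x - y‖ ^ 2)) := by gcongr
    _ = _ := by ring

/-- The cutoff restricts `t` to size `h^(-1/2)`, so `h t` is of size `√h` and `h² t²` of size `h`.
Half of the Gaussian is spent on this and half is kept. -/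
lemma norm_cutoff_error_le {κ h t : ℝ} (hh : 0 < h) (hh1 : h ≤ 1) :
    ‖(-4 * κ * Complex.I * h * t + 4 * h ^ 2 * t ^ 2 - 2 * h : ℂ)‖ * Real.exp (-(h * t ^ 2)) ≤
      10 * (1 + |κ|) * √h * Real.exp (-(h / 2 * t ^ 2)) := by
  have hs : √h ^ 2 = h := Real.sq_sqrt hh.le
  have hs0 : 0 ≤ √h := Real.sqrt_nonneg h
  have hs1 : √h ≤ 1 := Real.sqrt_le_one.2 hh1
  have h1 : ‖(-4 * κ * Complex.I * h * t + 4 * h ^ 2 * t ^ 2 - 2 * h : ℂ)‖ ≤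
      4 * |κ| * h * |t| + 4 * h ^ 2 * t ^ 2 + 2 * h := by
    refine (norm_sub_le _ _).trans (add_le_add ((norm_add_le _ _).trans (add_le_add ?_ ?_)) ?_) <;>
      simp [abs_of_pos hh]
  have h2 := sq_mul_exp_le hh t
  have h3 := exp_le_exp_half hh t
  have h4 : √h * |t| * Real.exp (-(h * t ^ 2)) ≤ Real.exp (-(h / 2 * t ^ 2)) := by
    have e1 : Real.exp (-(h * t ^ 2)) = Real.exp (-(h / 2 * t ^ 2)) * Real.exp (-(h / 2 * t ^ 2)) := by
      rw [← Real.exp_add]; ring_nf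
    have e2 : √h * |t| ≤ Real.exp (h / 2 * t ^ 2) := by
      have := Real.add_one_le_exp (h / 2 * t ^ 2)
      nlinarith [sq_nonneg (√h * |t| - 1), sq_abs t]
    have e3 : Real.exp (h / 2 * t ^ 2) * Real.exp (-(h / 2 * t ^ 2)) = 1 := by
      rw [← Real.exp_add]; simp
    rw [e1, ← mul_assoc]
    have e4 := mul_le_mul_of_nonneg_right e2 (Real.exp_pos (-(h / 2 * t ^ 2))).le
    rw [e3] at e4
    nlinarith [Real.exp_pos (-(h / 2 * t ^ 2))]
  calc _ ≤ (4 * |κ| * h * |t| + 4 * h ^ 2 * t ^ 2 + 2 * h) * Real.exp (-(h * t ^ 2)) := by gcongr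
    _ = 4 * |κ| * √h * (√h * |t| * Real.exp (-(h * t ^ 2))) +
        4 * h ^ 2 * (t ^ 2 * Real.exp (-(h * t ^ 2))) + 2 * h * Real.exp (-(h * t ^ 2)) := by
        nth_rewrite 1 [← hs]; ring
    _ ≤ 4 * |κ| * √h * Real.exp (-(h / 2 * t ^ 2)) +
        4 * h ^ 2 * (2 / h * Real.exp (-(h / 2 * t ^ 2))) + 2 * h * Real.exp (-(h / 2 * t ^ 2)) := by
        gcongr
    _ = (4 * |κ| * √h + 10 * h) * Real.exp (-(h / 2 * t ^ 2)) := by field_simp; ring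
    _ ≤ _ := by
        gcongr
        have : h ≤ √h := by nlinarith
        nlinarith [abs_nonneg κ, mul_nonneg (abs_nonneg κ) hs0]

end Majorant

/-! ### Almost conservation of the regularised pairing -/

section Evolution

variable {n : ℕ} {f : Lp ℂ 2 (volume : Measure (Space n))}
  {u : ℝ → Lp ℂ 2 (volume : Measure (Space n))}

lemma continuous_cutoff_error (κ h : ℝ) (z : ℂ) (y : EuclideanSpace ℝ (Fin n)) :
    Continuous fun w : Space n => Complex.I * mehlerTest κ h z y w *
      ((‖w.1‖ ^ 2 : ℝ) * (-4 * κ * Complex.I * h * w.2 + 4 * h ^ 2 * w.2 ^ 2 - 2 * h)) := by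
  have := continuous_mehlerTest κ h z y
  fun_prop

lemma norm_mehlerTest_error_le (hn : n ≠ 0) {ε S : ℝ} (hε : 0 < ε) (hS0 : 0 < S) {z : ℂ}
    (hz : z.re = ε) (hS : ‖z‖ ≤ S) (κ : ℝ) {h : ℝ} (hh : 0 < h) (hh1 : h ≤ 1)
    (y : EuclideanSpace ℝ (Fin n)) (w : Space n) :
    ‖Complex.I * mehlerTest κ h z y w *
      ((‖w.1‖ ^ 2 : ℝ) * (-4 * κ * Complex.I * h * w.2 + 4 * h ^ 2 * w.2 ^ 2 - 2 * h))‖ ≤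
    (√(4 / (Real.pi * ε)) * Real.exp (-(7 / 8 * |κ| * ε))) ^ n * (10 * (1 + |κ|) * √h) *
      (2 * ‖y‖ ^ 2 + 4 / (ε / (8 * S ^ 2))) * gaussMaj (ε / (8 * S ^ 2) / 2) (h / 2) y w := by
  set a := ε / (8 * S ^ 2) with ha
  have ha0 : 0 < a := by positivity
  have h1 := norm_mehlerTest_le hn hε hz hS κ h y w
  rw [← ha] at h1
  set K := (√(4 / (Real.pi * ε)) * Real.exp (-(7 / 8 * |κ| * ε))) ^ n with hK
  have hK0 : 0 ≤ K := by positivity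
  have h2 := norm_sq_mul_exp_le ha0 y w.1
  have h3 := norm_cutoff_error_le (κ := κ) (t := w.2) hh hh1
  set r : ℂ := -4 * κ * Complex.I * h * w.2 + 4 * h ^ 2 * w.2 ^ 2 - 2 * h
  have e3 : ‖((‖w.1‖ ^ 2 : ℝ) : ℂ)‖ = ‖w.1‖ ^ 2 := by simp
  rw [norm_mul, norm_mul, norm_mul, Complex.norm_I, one_mul, e3]
  calc _ ≤ (K * gaussMaj a h y w) * (‖w.1‖ ^ 2 * ‖r‖) := by gcongr
    _ = K * ((‖w.1‖ ^ 2 * Real.exp (-(a * ‖w.1 - y‖ ^ 2))) * (‖r‖ * Real.exp (-(h * w.2 ^ 2)))) := by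
        rw [gaussMaj]; ring
    _ ≤ K * (((2 * ‖y‖ ^ 2 + 4 / a) * Real.exp (-(a / 2 * ‖w.1 - y‖ ^ 2))) *
        (10 * (1 + |κ|) * √h * Real.exp (-(h / 2 * w.2 ^ 2)))) := by gcongr
    _ = _ := by rw [gaussMaj]; ring

/-- The time argument `ε + i(s - σ)` makes the test function move by the adjoint flow: the two terms
containing `mehlerLogDeriv` cancel and only the cutoff error survives. -/
lemma IsSolution.hasDerivAt_mehlerTest (hu : IsSolution f u) (hn : n ≠ 0) {ε : ℝ} (hε : 0 < ε)
    {κ h : ℝ} (hκ : κ ≠ 0) (hh : 0 < h) (hh1 : h ≤ 1) (y : EuclideanSpace ℝ (Fin n)) (s σ : ℝ) :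
    HasDerivAt (fun σ : ℝ => ∫ w, u σ w * mehlerTest κ h (ε + (s - σ : ℝ) * Complex.I) y w)
      (∫ w, u σ w * (Complex.I * mehlerTest κ h (ε + (s - σ : ℝ) * Complex.I) y w *
        ((‖w.1‖ ^ 2 : ℝ) * (-4 * κ * Complex.I * h * w.2 + 4 * h ^ 2 * w.2 ^ 2 - 2 * h)))) σ := by
  have hω : 0 < |κ| := abs_pos.2 hκ
  set Z : ℝ → ℂ := fun σ => ε + (s - σ : ℝ) * Complex.I with hZ
  have hre : ∀ σ, (Z σ).re = ε := fun σ => by simp [hZ]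
  have hre0 : ∀ σ, 0 < (Z σ).re := fun σ => by rw [hre]; exact hε
  choose φ hφ using fun σ => exists_schwartzMap_mehlerTest hκ hh (hre0 σ) y
  have hφ' : ∀ σ, (φ σ : Space n → ℂ) = mehlerTest κ h (Z σ) y := fun σ => funext (hφ σ)
  obtain ⟨D, hD0, hD⟩ := exists_norm_mehlerLogDeriv_le hω hε n
  set S := ε + |s - σ| + 1 with hS
  have hS0 : 0 < S := by positivity
  set a := ε / (8 * S ^ 2) with ha
  have ha0 : 0 < a := by positivity
  set K := (√(4 / (Real.pi * ε)) * Real.exp (-(7 / 8 * |κ| * ε))) ^ n with hK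
  -- The coefficient comes from `‖x + y‖² ≤ 2‖x - y‖² + 8‖y‖²`, followed by absorbing `3‖x - y‖²`
  -- into half of the Gaussian, at the price `3 · 2/a`.
  set b : Space n → ℝ := fun w => D * K * (1 + 8 * ‖y‖ ^ 2 + 6 / a) * gaussMaj (a / 2) h y w with hb
  have hZd : ∀ τ, HasDerivAt Z (-Complex.I) τ := by
    intro τ
    have h1 : HasDerivAt (fun τ : ℝ => ((s - τ : ℝ) : ℂ)) (-1) τ := by
      simpa using! ((hasDerivAt_id τ).const_sub s).ofReal_comp
    simpa [hZ] using! (h1.mul_const Complex.I).const_add (ε : ℂ)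
  have hZS : ∀ τ ∈ Metric.ball σ 1, ‖Z τ‖ ≤ S := by
    intro τ hτ
    have h1 : |s - τ| ≤ |s - σ| + 1 := by
      rw [Metric.mem_ball, Real.dist_eq] at hτ
      have h3 := abs_sub_le s σ τ
      rw [abs_sub_comm σ τ] at h3
      linarith
    calc ‖Z τ‖ ≤ ‖(ε : ℂ)‖ + ‖((s - τ : ℝ) : ℂ) * Complex.I‖ := norm_add_le _ _
      _ = ε + |s - τ| := by
        rw [norm_mul, Complex.norm_real, Complex.norm_real, Complex.norm_I, mul_one,
          Real.norm_eq_abs, Real.norm_eq_abs, abs_of_pos hε]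
      _ ≤ S := by linarith
  have hdom : ∀ w, ∀ τ ∈ Metric.ball σ 1, ‖-Complex.I * (mehlerTest κ h (Z τ) y w *
      mehlerLogDeriv |κ| (Z τ) y w.1)‖ ≤ b w := by
    intro w τ hτ
    have hτS := hZS τ hτ
    have h1 := norm_mehlerTest_le hn hε (hre τ) hτS κ h y w
    have h2 := hD (Z τ) y w.1 (hre τ)
    have hg0 := gaussMaj_nonneg a h y w
    have hK0 : 0 ≤ K := by positivity
    have h3 : ‖w.1 + y‖ ^ 2 ≤ 2 * ‖w.1 - y‖ ^ 2 + 8 * ‖y‖ ^ 2 := by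
      have h4 : ‖w.1 + y‖ ≤ ‖w.1 - y‖ + 2 * ‖y‖ := by
        have := norm_add_le (w.1 - y) ((2 : ℝ) • y)
        rw [norm_smul, Real.norm_two] at this
        convert! this using 2
        rw [two_smul]; abel
      nlinarith [sq_nonneg (‖w.1 - y‖ - 2 * ‖y‖), norm_nonneg (w.1 + y)]
    rw [norm_mul, norm_neg, Complex.norm_I, one_mul, norm_mul]
    calc _ ≤ (K * gaussMaj a h y w) * (D * (1 + ‖w.1 + y‖ ^ 2 + ‖w.1 - y‖ ^ 2)) := by gcongr
      _ ≤ (K * gaussMaj a h y w) * (D * (1 + 8 * ‖y‖ ^ 2 + 3 * ‖w.1 - y‖ ^ 2)) := by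
          gcongr ?_ * (D * ?_)
          linarith
      _ = D * K * (((1 + 8 * ‖y‖ ^ 2) * Real.exp (-(a * ‖w.1 - y‖ ^ 2)) +
          3 * (‖w.1 - y‖ ^ 2 * Real.exp (-(a * ‖w.1 - y‖ ^ 2)))) * Real.exp (-(h * w.2 ^ 2))) := by
          rw [gaussMaj]; ring
      _ ≤ D * K * (((1 + 8 * ‖y‖ ^ 2) * Real.exp (-(a / 2 * ‖w.1 - y‖ ^ 2)) +
          3 * (2 / a * Real.exp (-(a / 2 * ‖w.1 - y‖ ^ 2)))) * Real.exp (-(h * w.2 ^ 2))) := by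
          gcongr D * K * ((_ * ?_ + 3 * ?_) * _)
          · exact exp_le_exp_half ha0 _
          · exact sq_mul_exp_le ha0 _
      _ = _ := by
          simp only [hb, gaussMaj]; ring
  have hcont : Continuous fun w : Space n => -Complex.I * (mehlerTest κ h (Z σ) y w *
      mehlerLogDeriv |κ| (Z σ) y w.1) := continuous_const.mul ((continuous_mehlerTest _ _ _ _).mul
        ((continuous_mehlerLogDeriv _ _ _).comp continuous_fst))
  have hder := hu.hasDerivAt_integral_mul (φ := φ) (σ := σ) (δ := 1) one_pos (b := b)
    (φ' := fun τ w => -Complex.I * (mehlerTest κ h (Z τ) y w * mehlerLogDeriv |κ| (Z τ) y w.1))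
    ((memLp_gaussMaj (by positivity) hh y).const_mul _)
    hcont.aestronglyMeasurable
    (by
      intro w τ _
      simp only [hφ]
      have h1 := (hasDerivAt_mehler hω (hre0 τ) y w.1).scomp τ (hZd τ)
      convert! h1.mul_const (Complex.exp (κ * Complex.I * w.2 - h * w.2 ^ 2)) using 1
      simp only [mehlerTest, smul_eq_mul]; ring)
    hdom
  have hI1 := integrable_mul_of_memLp (Lp.memLp (u σ)) (((memLp_gaussMaj (a := a / 2)
    (by positivity) hh y).const_mul (D * K * (1 + 8 * ‖y‖ ^ 2 + 6 / a))).mono'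
      hcont.aestronglyMeasurable (.of_forall fun w => hdom w σ (Metric.mem_ball_self one_pos)))
  have hI2 := integrable_mul_of_memLp (Lp.memLp (u σ)) ((((memLp_gaussMaj (a := ε / (8 * S ^ 2) / 2)
    (h := h / 2) (by positivity) (by positivity) y).const_mul _).mono'
      (continuous_cutoff_error κ h (Z σ) y).aestronglyMeasurable
      (.of_forall fun w => norm_mehlerTest_error_le hn hε hS0 (hre σ) (hZS σ
        (Metric.mem_ball_self one_pos)) κ hh hh1 y w)))
  simp only [hφ', G_mehlerTest hκ (hre0 σ)] at hder
  convert! hder using 1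
  rw [← integral_const_mul, ← integral_add]
  · congr 1; ext w; ring
  · refine (hI2.sub hI1).congr (.of_forall fun w => ?_)
    simp only [Pi.sub_apply]; ring
  · exact hI1

/-- Mean value inequality for `σ` between `0` and `s`. The error is `√h` times a function whose `L²`
norm in `t` is of size `h^(-1/4)`, hence `h^(1/4)` in total. The constant may depend on `ε` and `s`;
the dependence on `κ` and `y` is explicit because both are integrated later. -/
lemma IsSolution.exists_norm_pairing_sub_le (hu : IsSolution f u) (hn : n ≠ 0) {ε : ℝ}
    (hε : 0 < ε) (s : ℝ) : ∃ C, 0 ≤ C ∧ ∀ h : ℝ, 0 < h → h ≤ 1 → ∀ (κ : ℝ)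
      (y : EuclideanSpace ℝ (Fin n)),
      ‖(∫ w, u s w * mehlerTest κ h ε y w) -
        ∫ w, f w * mehlerTest κ h (ε + s * Complex.I) y w‖ ≤
      C * √(√h) * ((1 + |κ|) * Real.exp (-(7 / 8 * ε * |κ|)) * (1 + ‖y‖ ^ 2)) := by
  obtain ⟨U, hU⟩ := (isCompact_uIcc (a := (0 : ℝ)) (b := s)).exists_bound_of_continuousOn
    hu.continuous.continuousOn
  have hU0 : 0 ≤ U := (norm_nonneg _).trans (hU 0 Set.left_mem_uIcc)
  set S := ε + |s| with hS
  have hS0 : 0 < S := by positivity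
  set a := ε / (8 * S ^ 2) with ha
  have ha0 : 0 < a := by positivity
  refine ⟨U * √(4 / (Real.pi * ε)) ^ n * 10 * (2 + 4 / a) *
    √((Real.pi / (2 * (a / 2))) ^ (n / 2 : ℝ)) * √(√Real.pi) * |s|, by positivity, ?_⟩
  intro h hh hh1 κ y
  -- At `κ = 0` the kernel is zero, so both pairings vanish.
  rcases eq_or_ne κ 0 with rfl | hκ
  · simp [mehlerTest, mehler, mehlerRoot, hn]
    positivity
  set P : ℝ → ℂ := fun σ => ∫ w, u σ w * mehlerTest κ h (ε + (s - σ : ℝ) * Complex.I) y w with hP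
  have hder := hu.hasDerivAt_mehlerTest hn hε hκ hh hh1 y s
  have hbound : ∀ σ ∈ Set.uIcc 0 s,
      ‖∫ w, u σ w * (Complex.I * mehlerTest κ h (ε + (s - σ : ℝ) * Complex.I) y w *
        ((‖w.1‖ ^ 2 : ℝ) * (-4 * κ * Complex.I * h * w.2 + 4 * h ^ 2 * w.2 ^ 2 - 2 * h)))‖ ≤
      U * ((√(4 / (Real.pi * ε)) * Real.exp (-(7 / 8 * |κ| * ε))) ^ n * (10 * (1 + |κ|) * √h) *
      (2 * ‖y‖ ^ 2 + 4 / a) *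
      √((Real.pi / (2 * (a / 2))) ^ (n / 2 : ℝ) * √(Real.pi / (2 * (h / 2))))) := by
    intro σ hσ
    have hz : ‖(ε + (s - σ : ℝ) * Complex.I : ℂ)‖ ≤ S := by
      have h1 : |s - σ| ≤ |s| := by
        rcases Set.mem_uIcc.1 hσ with h2 | h2
        · rw [abs_of_nonneg (by linarith), abs_of_nonneg (by linarith)]; linarith
        · rw [abs_of_nonpos (by linarith), abs_of_nonpos (by linarith)]; linarith
      refine (norm_add_le _ _).trans ?_
      rw [norm_mul, Complex.norm_real, Complex.norm_real, Complex.norm_I, mul_one,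
        Real.norm_eq_abs, Real.norm_eq_abs, abs_of_pos hε]
      linarith
    have h1 := norm_integral_Lp_mul_le_of_le (u σ)
      (continuous_cutoff_error κ h (ε + (s - σ : ℝ) * Complex.I) y).aestronglyMeasurable
      ((memLp_gaussMaj (a := a / 2) (h := h / 2) (by positivity) (by positivity) y).const_mul _)
      (fun w => norm_mehlerTest_error_le hn hε hS0 (by simp) hz κ hh hh1 y w)
    simp only [mul_pow (_ * _ : ℝ), integral_const_mul] at h1
    rw [integral_gaussMaj_sq (by positivity), ← mul_pow, Real.sqrt_mul (by positivity),
      Real.sqrt_sq (by positivity)] at h1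
    exact h1.trans (by gcongr; exact hU σ hσ)
  have hmv := (convex_uIcc (0 : ℝ) s).norm_image_sub_le_of_norm_hasDerivWithin_le
    (fun σ _ => (hder σ).hasDerivWithinAt) hbound Set.left_mem_uIcc Set.right_mem_uIcc
  simp only [sub_self, sub_zero, hu.initial, Complex.ofReal_zero, zero_mul, add_zero,
    Real.norm_eq_abs] at hmv
  refine hmv.trans ?_
  have e1 : (√(4 / (Real.pi * ε)) * Real.exp (-(7 / 8 * |κ| * ε))) ^ n ≤
      √(4 / (Real.pi * ε)) ^ n * Real.exp (-(7 / 8 * ε * |κ|)) := by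
    rw [mul_pow]
    gcongr
    rw [show 7 / 8 * |κ| * ε = 7 / 8 * ε * |κ| by ring]
    exact pow_le_of_le_one (Real.exp_pos _).le (Real.exp_le_one_iff.2 (by
      rw [Left.neg_nonpos_iff]; positivity)) hn
  have e2 : 2 * ‖y‖ ^ 2 + 4 / a ≤ (2 + 4 / a) * (1 + ‖y‖ ^ 2) := by
    have : 0 ≤ 4 / a * ‖y‖ ^ 2 := by positivity
    nlinarith
  have e3 : √h * √(√(Real.pi / (2 * (h / 2)))) = √(√Real.pi) * √(√h) := by
    have : Real.pi / (2 * (h / 2)) = Real.pi / h := by ring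
    rw [this, Real.sqrt_div Real.pi_pos.le, Real.sqrt_div (Real.sqrt_nonneg _)]
    have h4 : 0 < √(√h) := Real.sqrt_pos.2 (Real.sqrt_pos.2 hh)
    have h5 : √(√h) * √(√h) = √h := Real.mul_self_sqrt (Real.sqrt_nonneg h)
    field_simp
    rw [sq, h5]
  rw [Real.sqrt_mul (by positivity)]
  calc _ ≤ U * ((√(4 / (Real.pi * ε)) ^ n * Real.exp (-(7 / 8 * ε * |κ|))) *
        (10 * (1 + |κ|) * √h) * ((2 + 4 / a) * (1 + ‖y‖ ^ 2)) *
        (√((Real.pi / (2 * (a / 2))) ^ (n / 2 : ℝ)) * √(√(Real.pi / (2 * (h / 2)))))) * |s| := by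
        gcongr
    _ = U * √(4 / (Real.pi * ε)) ^ n * Real.exp (-(7 / 8 * ε * |κ|)) * 10 * (1 + |κ|) *
        (2 + 4 / a) * (1 + ‖y‖ ^ 2) * √((Real.pi / (2 * (a / 2))) ^ (n / 2 : ℝ)) *
        (√h * √(√(Real.pi / (2 * (h / 2))))) * |s| := by ring
    _ = _ := by rw [e3]; ring

end Evolution

/-! ### The kernel of `M M*` -/

section Contraction

variable {n : ℕ} {ω : ℝ} {z : ℂ}

/-- The coefficient of `-(‖x‖² + ‖y‖²)` in the exponent of the Mehler kernel. -/
noncomputable def mehlerA (ω : ℝ) (z : ℂ) : ℂ := ω / 4 * (mehlerTanh ω z + (mehlerTanh ω z)⁻¹)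

/-- The coefficient of `⟪x, y⟫` in the exponent of the Mehler kernel. -/
noncomputable def mehlerB (ω : ℝ) (z : ℂ) : ℂ := ω / 2 * ((mehlerTanh ω z)⁻¹ - mehlerTanh ω z)

lemma mehlerExp_eq (ω : ℝ) (z : ℂ) (y x : EuclideanSpace ℝ (Fin n)) :
    mehlerExp ω z y x = -mehlerA ω z * (‖x‖ ^ 2 + ‖y‖ ^ 2 : ℝ) + mehlerB ω z * (inner ℝ x y : ℝ) := by
  rw [mehlerExp, mehlerA, mehlerB, norm_add_sq_real, norm_sub_sq_real]
  push_cast; ring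

lemma re_mehlerTanh_pos (hω : 0 < ω) (hz : 0 < z.re) : 0 < (mehlerTanh ω z).re := by
  rw [mehlerTanh, re_one_sub_div_one_add]
  have := norm_nome_lt_one hω hz
  have h0 := norm_nonneg (nome ω z)
  have := norm_pos_iff.2 (one_add_nome_ne_zero hω hz)
  apply div_pos _ (by positivity)
  nlinarith

lemma re_mehlerA (ω : ℝ) (z : ℂ) :
    (mehlerA ω z).re = ω / 4 * ((mehlerTanh ω z).re + (mehlerTanh ω z)⁻¹.re) := by
  have : (ω / 4 : ℂ) = ((ω / 4 : ℝ) : ℂ) := by push_cast; ring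
  rw [mehlerA, this, Complex.re_ofReal_mul, Complex.add_re]

lemma re_mehlerB (ω : ℝ) (z : ℂ) :
    (mehlerB ω z).re = ω / 2 * ((mehlerTanh ω z)⁻¹.re - (mehlerTanh ω z).re) := by
  have : (ω / 2 : ℂ) = ((ω / 2 : ℝ) : ℂ) := by push_cast; ring
  rw [mehlerB, this, Complex.re_ofReal_mul, Complex.sub_re]

lemma re_mehlerA_pos (hω : 0 < ω) (hz : 0 < z.re) : 0 < (mehlerA ω z).re := by
  rw [re_mehlerA]
  have h1 := re_mehlerTanh_pos hω hz
  have h2 := re_mehlerTanh_inv_nonneg hω hz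
  positivity

/-- The difference of the two sides is `ω² Re T · Re T⁻¹` with `T = tanh (ω z)`. This one inequality
is what makes the Mehler operators contractions. -/
lemma re_mehlerB_sq_le (hω : 0 < ω) (hz : 0 < z.re) :
    (mehlerB ω z).re ^ 2 ≤ 4 * (mehlerA ω z).re ^ 2 := by
  rw [re_mehlerA, re_mehlerB]
  have h1 := re_mehlerTanh_nonneg hω hz
  have h2 := re_mehlerTanh_inv_nonneg hω hz
  have h3 : 0 ≤ ω ^ 2 * ((mehlerTanh ω z).re * (mehlerTanh ω z)⁻¹.re) := by positivity
  nlinarith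

lemma norm_mehlerRoot_sq_eq (hω : 0 < ω) (hz : 0 < z.re) :
    ‖mehlerRoot ω z‖ ^ 2 = ‖mehlerB ω z‖ / (2 * Real.pi) := by
  have h1 := one_sub_nome_ne_zero hω hz
  have h2 := one_add_nome_ne_zero hω hz
  have h3 : 1 - nome ω z ^ 2 = (1 - nome ω z) * (1 + nome ω z) := by ring
  have h4 : mehlerB ω z = 2 * ω * nome ω z / (1 - nome ω z ^ 2) := by
    rw [mehlerB, mehlerTanh, h3]
    field_simp
    ring
  rw [norm_mehlerRoot_sq hω hz, h4, norm_div, norm_mul, norm_mul, Complex.norm_real,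
    Real.norm_eq_abs, abs_of_pos hω, RCLike.norm_ofNat]
  ring

/-- The linear term is `⟪x, y + y'⟫` with coefficient `Re B` plus `⟪x, y - y'⟫` with coefficient `i
Im B`: the first is removed by translation, the second is a Fourier transform of a Gaussian. -/
lemma integral_gaussian_pair (a : ℝ) (ha : 0 < a) (B : ℂ) (y y' : EuclideanSpace ℝ (Fin n)) :
    ‖∫ x : EuclideanSpace ℝ (Fin n), Complex.exp (-(2 * a) * ‖x‖ ^ 2 + B * (inner ℝ x y : ℝ)
        + starRingEnd ℂ B * (inner ℝ x y' : ℝ))‖ =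
      (Real.pi / (2 * a)) ^ (n / 2 : ℝ) * Real.exp (B.re ^ 2 / (8 * a) * ‖y + y'‖ ^ 2
        - B.im ^ 2 / (8 * a) * ‖y - y'‖ ^ 2) := by
  set c : EuclideanSpace ℝ (Fin n) := (B.re / (4 * a)) • (y + y') with hc
  have h1 : ∀ x : EuclideanSpace ℝ (Fin n), Complex.exp (-(2 * a) * ‖x + c‖ ^ 2
      + B * (inner ℝ (x + c) y : ℝ) + starRingEnd ℂ B * (inner ℝ (x + c) y' : ℝ)) =
      Complex.exp (((B.re ^ 2 / (8 * a) * ‖y + y'‖ ^ 2 : ℝ) : ℂ) +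
        (B.im * inner ℝ c (y - y') : ℝ) * Complex.I) *
      Complex.exp (-((2 * a : ℝ) : ℂ) * ‖x‖ ^ 2 + (B.im * Complex.I) * (inner ℝ (y - y') x : ℝ)) := by
    intro x
    rw [← Complex.exp_add]
    congr 1
    have hB : B = B.re + B.im * Complex.I := (Complex.re_add_im B).symm
    have hB' : starRingEnd ℂ B = B.re - B.im * Complex.I := by
      apply Complex.ext <;> simp
    have e1 : (‖x + c‖ : ℂ) ^ 2 = ((‖x‖ ^ 2 + 2 * (B.re / (4 * a) * inner ℝ x (y + y')) +
        (B.re / (4 * a)) ^ 2 * ‖y + y'‖ ^ 2 : ℝ) : ℂ) := by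
      rw [← Complex.ofReal_pow, norm_add_sq_real, hc, inner_smul_right, norm_smul, mul_pow,
        Real.norm_eq_abs, sq_abs]
    have e2 : inner ℝ c (y + y') = B.re / (4 * a) * ‖y + y'‖ ^ 2 := by
      rw [hc, inner_smul_left, real_inner_self_eq_norm_sq]; simp
    have e3 : ∀ v : EuclideanSpace ℝ (Fin n), inner ℝ (x + c) v = inner ℝ x v + inner ℝ c v :=
      fun v => inner_add_left _ _ _
    rw [inner_add_right] at e2
    have e2' : ((inner ℝ c y' : ℝ) : ℂ) =
        ((B.re / (4 * a) * ‖y + y'‖ ^ 2 : ℝ) : ℂ) - (inner ℝ c y : ℝ) := by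
      rw [← e2]; push_cast; ring
    rw [e1, hB', e3, e3, inner_add_right, inner_sub_right, inner_sub_left, real_inner_comm x y,
      real_inner_comm x y']
    generalize hR : B.re = r at *
    generalize hI : B.im = i at *
    rw [hB]
    push_cast at e2' ⊢
    rw [e2']
    have ha' : (a : ℂ) ≠ 0 := by exact_mod_cast ha.ne'
    field_simp
    ring
  rw [← integral_add_right_eq_self _ c]
  simp only [h1]
  rw [integral_const_mul, GaussianFourier.integral_cexp_neg_mul_sq_norm_add (by simpa using ha),
    norm_mul, norm_mul, Complex.norm_exp, Complex.norm_exp]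
  have e4 : (((Real.pi : ℂ) / ((2 * a : ℝ) : ℂ)) ^
      ((Module.finrank ℝ (EuclideanSpace ℝ (Fin n)) : ℂ) / 2)) =
      (((Real.pi / (2 * a)) ^ (n / 2 : ℝ) : ℝ) : ℂ) := by
    rw [Complex.ofReal_cpow (by positivity)]
    simp
  have e5 : ((B.im * Complex.I) ^ 2 * (‖y - y'‖ : ℂ) ^ 2 / (4 * ((2 * a : ℝ) : ℂ))) =
      ((-(B.im ^ 2 / (8 * a) * ‖y - y'‖ ^ 2) : ℝ) : ℂ) := by
    rw [mul_pow, Complex.I_sq]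
    push_cast
    ring
  rw [e4, e5, Complex.norm_real, Real.norm_of_nonneg (by positivity), Complex.ofReal_re,
    Complex.add_re, Complex.ofReal_re, Complex.re_ofReal_mul, Complex.I_re, mul_zero, add_zero,
    mul_left_comm, ← Real.exp_add, ← sub_eq_add_neg]

lemma continuous_mehler (ω : ℝ) (z : ℂ) :
    Continuous fun p : EuclideanSpace ℝ (Fin n) × EuclideanSpace ℝ (Fin n) => mehler ω z p.1 p.2 := by
  unfold mehler mehlerExp; fun_prop

/-- Schur majorant of the kernel of `M M*`. -/
lemma norm_integral_mehler_mul_conj_le (hω : 0 < ω) (hz : 0 < z.re)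
    (y y' : EuclideanSpace ℝ (Fin n)) :
    ‖∫ x, mehler ω z y x * starRingEnd ℂ (mehler ω z y' x)‖ ≤
      (‖mehlerB ω z‖ / (2 * Real.pi)) ^ n * (Real.pi / (2 * (mehlerA ω z).re)) ^ (n / 2 : ℝ) *
        Real.exp (-((4 * (mehlerA ω z).re ^ 2 + (mehlerB ω z).im ^ 2) / (8 * (mehlerA ω z).re)) *
          ‖y - y'‖ ^ 2) := by
  set A := mehlerA ω z with hA
  set B := mehlerB ω z with hB
  have ha : 0 < A.re := re_mehlerA_pos hω hz
  have hBA := re_mehlerB_sq_le hω hz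
  rw [← hA, ← hB] at hBA
  have h1 : ∀ x, mehler ω z y x * starRingEnd ℂ (mehler ω z y' x) =
      (mehlerRoot ω z ^ n * starRingEnd ℂ (mehlerRoot ω z ^ n) *
        Complex.exp (-A * (‖y‖ ^ 2 : ℝ) - starRingEnd ℂ A * (‖y'‖ ^ 2 : ℝ))) *
      Complex.exp (-(2 * A.re) * ‖x‖ ^ 2 + B * (inner ℝ x y : ℝ)
        + starRingEnd ℂ B * (inner ℝ x y' : ℝ)) := by
    intro x
    rw [mehler, mehler, map_mul, ← Complex.exp_conj, mehlerExp_eq, mehlerExp_eq, map_add, map_mul,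
      map_mul, map_neg, Complex.conj_ofReal, Complex.conj_ofReal, ← hA, ← hB, mul_mul_mul_comm,
      ← Complex.exp_add, mul_assoc (_ * _) (Complex.exp _) (Complex.exp _), ← Complex.exp_add]
    congr 2
    have h2 : (2 * A.re : ℂ) = A + starRingEnd ℂ A := by
      rw [Complex.add_conj]; push_cast; ring
    rw [h2]
    push_cast
    ring
  simp only [h1]
  rw [integral_const_mul, norm_mul, integral_gaussian_pair _ ha, norm_mul, norm_mul,
    RCLike.norm_conj, norm_pow, ← mul_pow, ← sq, norm_mehlerRoot_sq_eq hω hz, ← hB,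
    Complex.norm_exp]
  have h3 : (-A * (‖y‖ ^ 2 : ℝ) - starRingEnd ℂ A * (‖y'‖ ^ 2 : ℝ)).re =
      -(A.re * (‖y‖ ^ 2 + ‖y'‖ ^ 2)) := by
    rw [Complex.sub_re, Complex.re_mul_ofReal, Complex.re_mul_ofReal, Complex.conj_re,
      Complex.neg_re]; ring
  rw [h3]
  -- Since `(Re B)² ≤ 4 (Re A)²`, the `‖y + y'‖²` term is at most `Re A / 2` times `‖y + y'‖²`,
  -- which the parallelogram law absorbs. Only a function of `y - y'` is left, as Schur's test for
  -- convolutions requires.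
  have h4 : -(A.re * (‖y‖ ^ 2 + ‖y'‖ ^ 2)) + (B.re ^ 2 / (8 * A.re) * ‖y + y'‖ ^ 2 -
      B.im ^ 2 / (8 * A.re) * ‖y - y'‖ ^ 2) ≤
      -((4 * A.re ^ 2 + B.im ^ 2) / (8 * A.re)) * ‖y - y'‖ ^ 2 := by
    have h5 : B.re ^ 2 / (8 * A.re) ≤ A.re / 2 := by
      rw [div_le_iff₀ (by positivity)]; nlinarith
    have h6 := mul_le_mul_of_nonneg_right h5 (sq_nonneg ‖y + y'‖)
    have h7 := parallelogram_law_with_norm ℝ y y'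
    have h8 : (4 * A.re ^ 2 + B.im ^ 2) / (8 * A.re) = A.re / 2 + B.im ^ 2 / (8 * A.re) := by
      field_simp; ring
    rw [h8]
    nlinarith
  calc _ = (‖B‖ / (2 * Real.pi)) ^ n * (Real.pi / (2 * A.re)) ^ (n / 2 : ℝ) *
      (Real.exp (-(A.re * (‖y‖ ^ 2 + ‖y'‖ ^ 2))) * Real.exp (B.re ^ 2 / (8 * A.re) * ‖y + y'‖ ^ 2 -
      B.im ^ 2 / (8 * A.re) * ‖y - y'‖ ^ 2)) := by ring
    _ ≤ _ := by
      rw [← Real.exp_add]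
      gcongr

/-- The left side is the total mass of the convolution majorant. It equals the `n/2` power of `|B|²
/ (4 (Re A)² + (Im B)²)`, and `re_mehlerB_sq_le` bounds this by 1. -/
lemma schur_const_le_one (hω : 0 < ω) (hz : 0 < z.re) (n : ℕ) :
    (‖mehlerB ω z‖ / (2 * Real.pi)) ^ n * (Real.pi / (2 * (mehlerA ω z).re)) ^ (n / 2 : ℝ) *
      (Real.pi / ((4 * (mehlerA ω z).re ^ 2 + (mehlerB ω z).im ^ 2) / (8 * (mehlerA ω z).re)))
        ^ (n / 2 : ℝ) ≤ 1 := by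
  set A := mehlerA ω z with hA
  set B := mehlerB ω z with hB
  have ha : 0 < A.re := re_mehlerA_pos hω hz
  have hBA := re_mehlerB_sq_le hω hz
  rw [← hA, ← hB] at hBA
  have h1 : (‖B‖ / (2 * Real.pi)) ^ n = ((‖B‖ / (2 * Real.pi)) ^ 2) ^ (n / 2 : ℝ) := by
    rw [← Real.rpow_natCast, ← Real.rpow_natCast, ← Real.rpow_mul (by positivity)]
    congr 1; push_cast; ring
  have h2 : 0 < 4 * A.re ^ 2 + B.im ^ 2 := by positivity
  rw [h1, ← Real.mul_rpow (by positivity) (by positivity), ← Real.mul_rpow (by positivity)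
    (by positivity)]
  apply Real.rpow_le_one (by positivity) _ (by positivity)
  have h3 : (‖B‖ / (2 * Real.pi)) ^ 2 * (Real.pi / (2 * A.re)) *
      (Real.pi / ((4 * A.re ^ 2 + B.im ^ 2) / (8 * A.re))) = ‖B‖ ^ 2 / (4 * A.re ^ 2 + B.im ^ 2) := by
    have := Real.pi_pos
    field_simp; ring
  rw [h3, div_le_one h2, Complex.sq_norm, Complex.normSq_apply]
  nlinarith

end Contraction

/-! ### Schur's test -/

section Schur

variable {E : Type*} [NormedAddCommGroup E] [MeasurableSpace E] [BorelSpace E]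
  [SecondCountableTopology E] {μ : Measure E} [SFinite μ] [μ.IsAddLeftInvariant]
  [μ.IsNegInvariant]

/-- Schur's test for a nonnegative convolution kernel. -/
lemma integral_integral_mul_kernel_le {b : E → ℝ} (hb0 : ∀ y, 0 ≤ b y) (hb : MemLp b 2 μ)
    {ρ : E → ℝ} (hρ0 : ∀ y, 0 ≤ ρ y) (hρ : Integrable ρ μ) (hρ1 : ∫ y, ρ y ∂μ ≤ 1) :
    Integrable (fun p : E × E => b p.1 * b p.2 * ρ (p.1 - p.2)) (μ.prod μ) ∧
    ∫ p, b p.1 * b p.2 * ρ (p.1 - p.2) ∂(μ.prod μ) ≤ ∫ y, b y ^ 2 ∂μ := by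
  have hb2 : Integrable (fun y => b y ^ 2) μ := hb.integrable_sq
  have h2 : Integrable (fun p : E × E => b p.2 ^ 2 * ρ (p.1 - p.2)) (μ.prod μ) := by
    simpa using hb2.convolution_integrand (ContinuousLinearMap.mul ℝ ℝ) hρ
  have h1 : Integrable (fun p : E × E => b p.1 ^ 2 * ρ (p.1 - p.2)) (μ.prod μ) := by
    have := hb2.convolution_integrand (ContinuousLinearMap.mul ℝ ℝ) hρ.comp_neg
    simpa using! this.swap
  have hρm : AEStronglyMeasurable (fun p : E × E => ρ (p.1 - p.2)) (μ.prod μ) := by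
    refine hρ.1.comp_quasiMeasurePreserving ?_
    exact quasiMeasurePreserving_sub_of_right_invariant μ μ
  have hm : AEStronglyMeasurable (fun p : E × E => b p.1 * b p.2 * ρ (p.1 - p.2)) (μ.prod μ) :=
    (hb.1.comp_fst.mul hb.1.comp_snd).mul hρm
  -- The arithmetic–geometric mean inequality separates the two factors; each half then integrates
  -- to at most `½ ∫ b²` because `ρ` has mass at most 1.
  have hle : ∀ p : E × E, b p.1 * b p.2 * ρ (p.1 - p.2) ≤
      1 / 2 * (b p.1 ^ 2 * ρ (p.1 - p.2)) + 1 / 2 * (b p.2 ^ 2 * ρ (p.1 - p.2)) := by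
    intro p
    nlinarith [mul_nonneg (sq_nonneg (b p.1 - b p.2)) (hρ0 (p.1 - p.2))]
  have h12 : Integrable (fun p : E × E => 1 / 2 * (b p.1 ^ 2 * ρ (p.1 - p.2)) +
      1 / 2 * (b p.2 ^ 2 * ρ (p.1 - p.2))) (μ.prod μ) := (h1.const_mul _).add (h2.const_mul _)
  have hint : Integrable (fun p : E × E => b p.1 * b p.2 * ρ (p.1 - p.2)) (μ.prod μ) := by
    refine h12.mono' hm (.of_forall fun p => ?_)
    rw [Real.norm_of_nonneg (mul_nonneg (mul_nonneg (hb0 _) (hb0 _)) (hρ0 _))]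
    exact hle p
  refine ⟨hint, ?_⟩
  have e1 : ∫ p : E × E, b p.1 ^ 2 * ρ (p.1 - p.2) ∂(μ.prod μ) ≤ ∫ y, b y ^ 2 ∂μ := by
    rw [integral_prod _ h1]
    simp only [integral_const_mul, integral_sub_left_eq_self ρ μ]
    rw [integral_mul_const]
    have : 0 ≤ ∫ y, b y ^ 2 ∂μ := integral_nonneg fun _ => sq_nonneg _
    nlinarith
  have e2 : ∫ p : E × E, b p.2 ^ 2 * ρ (p.1 - p.2) ∂(μ.prod μ) ≤ ∫ y, b y ^ 2 ∂μ := by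
    rw [integral_prod_symm _ h2]
    simp only [integral_const_mul, integral_sub_right_eq_self ρ]
    rw [integral_mul_const]
    have : 0 ≤ ∫ y, b y ^ 2 ∂μ := integral_nonneg fun _ => sq_nonneg _
    nlinarith
  calc _ ≤ _ := integral_mono hint h12 hle
    _ = 1 / 2 * (∫ p : E × E, b p.1 ^ 2 * ρ (p.1 - p.2) ∂(μ.prod μ)) +
        1 / 2 * ∫ p : E × E, b p.2 ^ 2 * ρ (p.1 - p.2) ∂(μ.prod μ) := by
        rw [integral_add (h1.const_mul _) (h2.const_mul _), integral_const_mul, integral_const_mul]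
    _ ≤ _ := by linarith

end Schur

/-! ### Mehler operators contract `L²` -/

section Contraction

variable {n : ℕ}

section Kernel

variable {k : EuclideanSpace ℝ (Fin n) → EuclideanSpace ℝ (Fin n) → ℂ} {K κ : ℝ}
  {a : EuclideanSpace ℝ (Fin n) → ℂ}

lemma aestronglyMeasurable_kernel_pair (hk : Continuous (Function.uncurry k))
    (ha : AEStronglyMeasurable a volume) :
    AEStronglyMeasurable
      (fun q : EuclideanSpace ℝ (Fin n) × (EuclideanSpace ℝ (Fin n) × EuclideanSpace ℝ (Fin n)) =>
        (k q.2.1 q.1 * a q.2.1) * starRingEnd ℂ (k q.2.2 q.1 * a q.2.2))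
      (volume.prod (volume.prod volume)) := by
  have h1 : AEStronglyMeasurable
      (fun q : EuclideanSpace ℝ (Fin n) × (EuclideanSpace ℝ (Fin n) × EuclideanSpace ℝ (Fin n)) =>
        k q.2.1 q.1) (volume.prod (volume.prod volume)) :=
    (hk.comp (by fun_prop : Continuous fun q : EuclideanSpace ℝ (Fin n) ×
      (EuclideanSpace ℝ (Fin n) × EuclideanSpace ℝ (Fin n)) => (q.2.1, q.1))).aestronglyMeasurable
  have h2 : AEStronglyMeasurable
      (fun q : EuclideanSpace ℝ (Fin n) × (EuclideanSpace ℝ (Fin n) × EuclideanSpace ℝ (Fin n)) =>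
        k q.2.2 q.1) (volume.prod (volume.prod volume)) :=
    (hk.comp (by fun_prop : Continuous fun q : EuclideanSpace ℝ (Fin n) ×
      (EuclideanSpace ℝ (Fin n) × EuclideanSpace ℝ (Fin n)) => (q.2.2, q.1))).aestronglyMeasurable
  exact (h1.mul ha.comp_fst.comp_snd).mul
    (Complex.continuous_conj.comp_aestronglyMeasurable (h2.mul ha.comp_snd.comp_snd))

/-- Justifies Fubini in the `T T*` argument: the Gaussian decay of one kernel gives integrability in
`x`, and `a` integrable gives it in `(y, y')`. -/
lemma integrable_kernel_pair (hk : Continuous (Function.uncurry k)) (hκ : 0 < κ) (hK : 0 ≤ K)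
    (hb : ∀ y x, ‖k y x‖ ≤ K * Real.exp (-κ * ‖x - y‖ ^ 2)) (ha : Integrable a) :
    Integrable
      (fun q : EuclideanSpace ℝ (Fin n) × (EuclideanSpace ℝ (Fin n) × EuclideanSpace ℝ (Fin n)) =>
        (k q.2.1 q.1 * a q.2.1) * starRingEnd ℂ (k q.2.2 q.1 * a q.2.2))
      (volume.prod (volume.prod volume)) := by
  have hFm := aestronglyMeasurable_kernel_pair hk ha.1
  have hb' : ∀ y x, ‖k y x‖ ≤ K := fun y x => (hb y x).trans <| mul_le_of_le_one_right hK <|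
    Real.exp_le_one_iff.2 (by rw [neg_mul, Left.neg_nonpos_iff]; positivity)
  have hFb : ∀ (x : EuclideanSpace ℝ (Fin n))
      (p : EuclideanSpace ℝ (Fin n) × EuclideanSpace ℝ (Fin n)),
      ‖(k p.1 x * a p.1) * starRingEnd ℂ (k p.2 x * a p.2)‖ ≤
        K * K * (‖a p.1‖ * ‖a p.2‖) * Real.exp (-κ * ‖x - p.1‖ ^ 2) := by
    intro x p
    rw [norm_mul, RCLike.norm_conj, norm_mul, norm_mul]
    calc _ ≤ (K * Real.exp (-κ * ‖x - p.1‖ ^ 2) * ‖a p.1‖) * (K * ‖a p.2‖) := by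
          gcongr
          · exact hb _ _
          · exact hb' _ _
      _ = _ := by ring
  rw [integrable_prod_iff' hFm]
  constructor
  · refine .of_forall fun p => ?_
    have h1 : Continuous fun x => k p.1 x := hk.comp (by fun_prop : Continuous fun x => (p.1, x))
    have h2 : Continuous fun x => k p.2 x := hk.comp (by fun_prop : Continuous fun x => (p.2, x))
    have h3 : Continuous fun x => starRingEnd ℂ (k p.2 x * a p.2) :=
      Complex.continuous_conj.comp (h2.mul continuous_const)
    have h4 : Continuous fun x => (k p.1 x * a p.1) * starRingEnd ℂ (k p.2 x * a p.2) :=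
      (h1.mul continuous_const).mul h3
    change Integrable (fun x => (k p.1 x * a p.1) * starRingEnd ℂ (k p.2 x * a p.2)) volume
    exact ((integrable_exp_neg_mul_norm_sub_sq hκ p.1).const_mul
      (K * K * (‖a p.1‖ * ‖a p.2‖))).mono' h4.aestronglyMeasurable (.of_forall fun x => hFb x p)
  · refine Integrable.mono' (g := fun p => K * K * (‖a p.1‖ * ‖a p.2‖) *
      (Real.pi / κ) ^ (n / 2 : ℝ)) (((ha.norm.mul_prod ha.norm).const_mul _).mul_const _)
      hFm.norm.prod_swap.integral_prod_right' ?_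
    refine .of_forall fun p => ?_
    rw [Real.norm_of_nonneg (integral_nonneg fun _ => norm_nonneg _),
      ← integral_exp_neg_mul_norm_sub_sq hκ p.1, ← integral_const_mul]
    exact integral_mono_of_nonneg (.of_forall fun _ => norm_nonneg _)
      ((integrable_exp_neg_mul_norm_sub_sq hκ p.1).const_mul _) (.of_forall fun x => hFb x p)

lemma integral_kernel_pair (x : EuclideanSpace ℝ (Fin n)) :
    ∫ p : EuclideanSpace ℝ (Fin n) × EuclideanSpace ℝ (Fin n),
      (k p.1 x * a p.1) * starRingEnd ℂ (k p.2 x * a p.2) ∂(volume.prod volume) =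
      ((‖∫ y, k y x * a y‖ ^ 2 : ℝ) : ℂ) := by
  have h1 := integral_prod_mul (μ := (volume : Measure (EuclideanSpace ℝ (Fin n))))
    (ν := (volume : Measure (EuclideanSpace ℝ (Fin n)))) (fun y => k y x * a y)
    (fun y => starRingEnd ℂ (k y x * a y))
  rw [integral_conj] at h1
  rw [h1, Complex.mul_conj, Complex.normSq_eq_norm_sq]

/-- `T T*` argument for a rapidly decaying kernel. -/
lemma memLp_integral_kernel (hk : Continuous (Function.uncurry k)) (hκ : 0 < κ) (hK : 0 ≤ K)
    (hb : ∀ y x, ‖k y x‖ ≤ K * Real.exp (-κ * ‖x - y‖ ^ 2)) {ρ : EuclideanSpace ℝ (Fin n) → ℝ}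
    (hρ0 : ∀ v, 0 ≤ ρ v) (hρi : Integrable ρ) (hρ1 : ∫ v, ρ v ≤ 1)
    (hρ : ∀ y y', ‖∫ x, k y x * starRingEnd ℂ (k y' x)‖ ≤ ρ (y - y'))
    (ha : Integrable a) (ha2 : MemLp a 2 volume) :
    MemLp (fun x => ∫ y, k y x * a y) 2 volume ∧
      ∫ x, ‖∫ y, k y x * a y‖ ^ 2 ≤ ∫ x, ‖a x‖ ^ 2 := by
  have hFi := integrable_kernel_pair hk hκ hK hb ha
  have hsq : Integrable (fun x => ‖∫ y, k y x * a y‖ ^ 2) := by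
    refine hFi.integral_prod_left.re.congr (.of_forall fun x => ?_)
    simp only [integral_kernel_pair]
    exact Complex.ofReal_re _
  have hopm : AEStronglyMeasurable (fun x => ∫ y, k y x * a y) volume := by
    have : AEStronglyMeasurable (fun q : EuclideanSpace ℝ (Fin n) × EuclideanSpace ℝ (Fin n) =>
        k q.2 q.1 * a q.2) (volume.prod volume) :=
      (hk.comp continuous_swap).aestronglyMeasurable.mul ha.1.comp_snd
    exact this.integral_prod_right'
  refine ⟨(memLp_two_iff_integrable_sq_norm hopm).2 hsq, ?_⟩
  obtain ⟨hS1, hS2⟩ := integral_integral_mul_kernel_le (fun y => norm_nonneg (a y)) ha2.norm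
    hρ0 hρi hρ1
  refine le_trans ?_ hS2
  have h1 : ((∫ x, ‖∫ y, k y x * a y‖ ^ 2 : ℝ) : ℂ) =
      ∫ p : EuclideanSpace ℝ (Fin n) × EuclideanSpace ℝ (Fin n), (∫ x : EuclideanSpace ℝ (Fin n),
        (k p.1 x * a p.1) * starRingEnd ℂ (k p.2 x * a p.2)) ∂(volume.prod volume) := by
    rw [← integral_integral_swap hFi, ← integral_complex_ofReal]
    exact integral_congr_ae (.of_forall fun x => (integral_kernel_pair x).symm)
  have h2 : ∀ p : EuclideanSpace ℝ (Fin n) × EuclideanSpace ℝ (Fin n),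
      ‖∫ x, (k p.1 x * a p.1) * starRingEnd ℂ (k p.2 x * a p.2)‖ ≤
        ‖a p.1‖ * ‖a p.2‖ * ρ (p.1 - p.2) := by
    intro p
    have h3 : ∀ x, (k p.1 x * a p.1) * starRingEnd ℂ (k p.2 x * a p.2) =
        (a p.1 * starRingEnd ℂ (a p.2)) * (k p.1 x * starRingEnd ℂ (k p.2 x)) := fun x => by
      rw [map_mul]; ring
    simp only [h3]
    rw [integral_const_mul, norm_mul, norm_mul, RCLike.norm_conj]
    gcongr
    exact hρ _ _
  calc ∫ x, ‖∫ y, k y x * a y‖ ^ 2 = ‖((∫ x, ‖∫ y, k y x * a y‖ ^ 2 : ℝ) : ℂ)‖ := by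
        rw [Complex.norm_real, Real.norm_of_nonneg (integral_nonneg fun _ => by positivity)]
    _ ≤ _ := by
        rw [h1]
        exact norm_integral_le_of_norm_le hS1 (.of_forall h2)

end Kernel

variable {ω : ℝ} {z : ℂ}

/-- The operator `exp (- z (-Δ + ω² |x|²))` applied to `a`. -/
noncomputable def mehlerOp (ω : ℝ) (z : ℂ) (a : EuclideanSpace ℝ (Fin n) → ℂ)
    (x : EuclideanSpace ℝ (Fin n)) : ℂ := ∫ y, mehler ω z y x * a y

lemma mehlerOp_zero_left (hn : n ≠ 0) (z : ℂ) (a : EuclideanSpace ℝ (Fin n) → ℂ) :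
    mehlerOp 0 z a = 0 := by
  ext x; simp [mehlerOp, mehler, mehlerRoot, hn]

lemma memLp_mehlerOp (hn : n ≠ 0) (hω : 0 ≤ ω) (hz : 0 < z.re) {a : EuclideanSpace ℝ (Fin n) → ℂ}
    (ha : Integrable a) (ha2 : MemLp a 2 volume) :
    MemLp (mehlerOp ω z a) 2 volume ∧
      ∫ x, ‖mehlerOp ω z a x‖ ^ 2 ≤ ∫ x, ‖a x‖ ^ 2 := by
  rcases hω.eq_or_lt with rfl | hω
  · rw [mehlerOp_zero_left hn]
    refine ⟨MemLp.zero, ?_⟩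
    simpa using integral_nonneg fun _ => by positivity
  have hz0 : z ≠ 0 := by rintro rfl; simp at hz
  have hκ0 : 0 < z.re / (8 * ‖z‖ ^ 2) := by have := norm_pos_iff.2 hz0; positivity
  have hA := re_mehlerA_pos hω hz
  have hγ0 : 0 < (4 * (mehlerA ω z).re ^ 2 + (mehlerB ω z).im ^ 2) / (8 * (mehlerA ω z).re) := by
    positivity
  refine memLp_integral_kernel (k := mehler ω z) (continuous_mehler ω z) hκ0
    (K := (√(4 / (Real.pi * z.re)) * Real.exp (-(7 / 8 * ω * z.re))) ^ n) (by positivity)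
    (fun y x => by simpa only [neg_mul] using norm_mehler_le hn hz hω.le rfl le_rfl y x)
    (ρ := fun v => (‖mehlerB ω z‖ / (2 * Real.pi)) ^ n *
      (Real.pi / (2 * (mehlerA ω z).re)) ^ (n / 2 : ℝ) * Real.exp
        (-((4 * (mehlerA ω z).re ^ 2 + (mehlerB ω z).im ^ 2) / (8 * (mehlerA ω z).re)) * ‖v‖ ^ 2))
    (fun v => by positivity) ?_ ?_ (norm_integral_mehler_mul_conj_le hω hz) ha ha2
  · have := (integrable_exp_neg_mul_norm_sub_sq hγ0 (0 : EuclideanSpace ℝ (Fin n)))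
    simp only [sub_zero] at this
    exact this.const_mul _
  · have h1 := integral_exp_neg_mul_norm_sub_sq hγ0 (0 : EuclideanSpace ℝ (Fin n))
    simp only [sub_zero] at h1
    rw [integral_const_mul, h1]
    exact schur_const_le_one hω hz n

end Contraction

/-! ### Strong convergence of the Mehler operators at real time `ε → 0` -/

section ApproximateIdentity

open Filter Topology

variable {n : ℕ}

/-- Value of the Mehler kernel at real time. -/
lemma mehler_ofReal {ω ε : ℝ} (hω : 0 < ω) (hε : 0 < ε) (y x : EuclideanSpace ℝ (Fin n)) :
    mehler ω ε y x = (((√(ω / Real.pi) * Real.exp (-(ω * ε)) *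
      (1 - Real.exp (-(2 * ω * ε)) ^ 2) ^ (-(1 / 2) : ℝ)) ^ n * Real.exp (-(ω / 4 *
        ((1 - Real.exp (-(2 * ω * ε))) / (1 + Real.exp (-(2 * ω * ε))) * ‖x + y‖ ^ 2 +
         ((1 - Real.exp (-(2 * ω * ε))) / (1 + Real.exp (-(2 * ω * ε))))⁻¹ * ‖x - y‖ ^ 2))) : ℝ) : ℂ) := by
  have h0 : nome ω ε = (Real.exp (-(2 * ω * ε)) : ℝ) := by
    rw [nome]; push_cast; rfl
  have he : Real.exp (-(2 * ω * ε)) < 1 := by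
    rw [Real.exp_lt_one_iff]; nlinarith [mul_pos hω hε]
  have he0 := Real.exp_pos (-(2 * ω * ε))
  have h1 : 0 ≤ 1 - Real.exp (-(2 * ω * ε)) ^ 2 := by nlinarith
  have h2 : ((1 : ℂ) - (Real.exp (-(2 * ω * ε)) : ℝ) ^ 2) ^ (-(1 / 2) : ℂ) =
      ((1 - Real.exp (-(2 * ω * ε)) ^ 2) ^ (-(1 / 2) : ℝ) : ℝ) := by
    rw [Complex.ofReal_cpow h1]
    push_cast; rfl
  rw [mehler, mehlerRoot, mehlerExp, mehlerTanh, h0, h2]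
  push_cast
  ring_nf

/-- Substitute `y = x + ρ v` with `ρ² = 4 tanh (ω ε) / ω`, the scale at which the `‖x - y‖²` part of
the exponent becomes `-‖v‖²`. All dependence on `ε` is then continuous up to `ε = 0` and dominated
by a fixed Gaussian. -/
lemma mehlerOp_ofReal {ω ε : ℝ} (hω : 0 < ω) (hε : 0 < ε) (a : EuclideanSpace ℝ (Fin n) → ℂ)
    (x : EuclideanSpace ℝ (Fin n)) :
    mehlerOp ω ε a x = ∫ v,
      ((√(4 * Real.exp (-(2 * ω * ε)) / (Real.pi * (1 + Real.exp (-(2 * ω * ε))) ^ 2)) ^ n *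
        Real.exp (-(ω / 4 * ((1 - Real.exp (-(2 * ω * ε))) / (1 + Real.exp (-(2 * ω * ε)))) *
          ‖x + (x + √(4 / ω * ((1 - Real.exp (-(2 * ω * ε))) / (1 + Real.exp (-(2 * ω * ε))))) • v)‖ ^ 2)
          - ‖v‖ ^ 2) : ℝ) : ℂ) *
        a (x + √(4 / ω * ((1 - Real.exp (-(2 * ω * ε))) / (1 + Real.exp (-(2 * ω * ε))))) • v) := by
  have he : Real.exp (-(2 * ω * ε)) < 1 := by
    rw [Real.exp_lt_one_iff]; nlinarith [mul_pos hω hε]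
  have he0 := Real.exp_pos (-(2 * ω * ε))
  have heq : Real.exp (-(2 * ω * ε)) = Real.exp (-(ω * ε)) ^ 2 := by
    rw [← Real.exp_nat_mul]; congr 1; push_cast; ring
  have hk := fun y => mehler_ofReal hω hε y x
  set e := Real.exp (-(2 * ω * ε)) with hedef
  set τ := (1 - e) / (1 + e) with hτ
  have hτ0 : 0 < τ := div_pos (by linarith) (by linarith)
  set r := √(4 / ω * τ) with hr
  have hr0 : 0 < r := Real.sqrt_pos.2 (by positivity)
  have hr2 : r ^ 2 = 4 / ω * τ := Real.sq_sqrt (by positivity)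
  set ρ := √(ω / Real.pi) * Real.exp (-(ω * ε)) * (1 - e ^ 2) ^ (-(1 / 2) : ℝ) with hρ
  have h1 : 0 < 1 - e ^ 2 := by nlinarith
  have hρ0 : 0 ≤ ρ := by positivity
  have hc : √(4 * e / (Real.pi * (1 + e) ^ 2)) = r * ρ := by
    rw [Real.sqrt_eq_iff_eq_sq (by positivity) (by positivity), mul_pow, hr2, hρ, mul_pow, mul_pow,
      Real.sq_sqrt (by positivity), ← heq, ← Real.rpow_natCast ((1 - e ^ 2) ^ _),
      ← Real.rpow_mul h1.le, hτ]
    norm_num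
    rw [Real.rpow_neg_one]
    have h2 : 1 - e ^ 2 = (1 - e) * (1 + e) := by ring
    have h3 : 1 - e ≠ 0 := by linarith
    rw [h2]
    have := Real.pi_pos
    field_simp
  have hsub := Measure.integral_comp_smul (volume : Measure (EuclideanSpace ℝ (Fin n)))
    (fun v => mehler ω ε (x + v) x * a (x + v)) r
  rw [finrank_euclideanSpace, Fintype.card_fin, integral_add_left_eq_self
    (fun y => mehler ω ε y x * a y) x, abs_of_pos (by positivity), eq_inv_smul_iff₀ (by positivity)]
    at hsub
  rw [mehlerOp, ← hsub, ← integral_smul]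
  refine integral_congr_ae (.of_forall fun v => ?_)
  simp only [hk]
  rw [Complex.real_smul, ← mul_assoc, ← Complex.ofReal_mul, hc]
  have h3 : ‖x - (x + r • v)‖ ^ 2 = r ^ 2 * ‖v‖ ^ 2 := by
    rw [sub_add_cancel_left, norm_neg, norm_smul, mul_pow, Real.norm_eq_abs, sq_abs]
  have h4 : -(ω / 4 * (τ * ‖x + (x + r • v)‖ ^ 2 + τ⁻¹ * ‖x - (x + r • v)‖ ^ 2)) =
      -(ω / 4 * τ * ‖x + (x + r • v)‖ ^ 2) - ‖v‖ ^ 2 := by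
    rw [h3, hr2]
    field_simp
    ring
  rw [h4, mul_pow r ρ, mul_assoc (r ^ n)]

variable {a : EuclideanSpace ℝ (Fin n) → ℂ}

lemma integrable_exp_neg_norm_sq : Integrable (fun v : EuclideanSpace ℝ (Fin n) =>
    Real.exp (-‖v‖ ^ 2)) := by
  have := integrable_exp_neg_mul_norm_sub_sq one_pos (0 : EuclideanSpace ℝ (Fin n))
  simpa using this

lemma integral_exp_neg_norm_sq : ∫ v : EuclideanSpace ℝ (Fin n), Real.exp (-‖v‖ ^ 2) =
    √Real.pi ^ n := by
  have := integral_exp_neg_mul_norm_sub_sq one_pos (0 : EuclideanSpace ℝ (Fin n))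
  simp only [sub_zero, div_one, neg_mul, one_mul] at this
  rw [this, Real.sqrt_eq_rpow, ← Real.rpow_natCast, ← Real.rpow_mul Real.pi_pos.le]
  congr 1; ring

lemma mehler_factor_le {e : ℝ} (he : 0 ≤ e) :
    √(4 * e / (Real.pi * (1 + e) ^ 2)) ≤ (√Real.pi)⁻¹ := by
  rw [← Real.sqrt_inv]
  apply Real.sqrt_le_sqrt
  rw [div_le_iff₀ (by positivity), ← mul_assoc, inv_mul_cancel₀ Real.pi_pos.ne']
  nlinarith [sq_nonneg (1 - e)]

lemma norm_mehlerOp_integrand_le {ω ε M : ℝ} (hω : 0 < ω) (hε : 0 < ε)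
    (hM : ∀ x, ‖a x‖ ≤ M) (x v : EuclideanSpace ℝ (Fin n)) :
    ‖((√(4 * Real.exp (-(2 * ω * ε)) / (Real.pi * (1 + Real.exp (-(2 * ω * ε))) ^ 2)) ^ n *
        Real.exp (-(ω / 4 * ((1 - Real.exp (-(2 * ω * ε))) / (1 + Real.exp (-(2 * ω * ε)))) *
          ‖x + (x + √(4 / ω * ((1 - Real.exp (-(2 * ω * ε))) / (1 + Real.exp (-(2 * ω * ε))))) • v)‖ ^ 2)
          - ‖v‖ ^ 2) : ℝ) : ℂ) *
        a (x + √(4 / ω * ((1 - Real.exp (-(2 * ω * ε))) / (1 + Real.exp (-(2 * ω * ε))))) • v)‖ ≤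
      (√Real.pi)⁻¹ ^ n * Real.exp (-‖v‖ ^ 2) * M := by
  have he : Real.exp (-(2 * ω * ε)) < 1 := by
    rw [Real.exp_lt_one_iff]; nlinarith [mul_pos hω hε]
  have he0 := Real.exp_pos (-(2 * ω * ε))
  have hτ0 : 0 ≤ (1 - Real.exp (-(2 * ω * ε))) / (1 + Real.exp (-(2 * ω * ε))) :=
    div_nonneg (by linarith) (by linarith)
  rw [norm_mul, Complex.norm_real, Real.norm_of_nonneg (by positivity)]
  gcongr
  · exact mehler_factor_le he0.le
  · have : 0 ≤ ω / 4 * ((1 - Real.exp (-(2 * ω * ε))) / (1 + Real.exp (-(2 * ω * ε)))) *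
      ‖x + (x + √(4 / ω * ((1 - Real.exp (-(2 * ω * ε))) / (1 + Real.exp (-(2 * ω * ε))))) • v)‖ ^ 2 := by
      positivity
    linarith
  · exact hM _

lemma norm_mehlerOp_ofReal_le {ω ε M : ℝ} (hω : 0 < ω) (hε : 0 < ε) (hM : ∀ x, ‖a x‖ ≤ M)
    (x : EuclideanSpace ℝ (Fin n)) : ‖mehlerOp ω ε a x‖ ≤ M := by
  rw [mehlerOp_ofReal hω hε]
  refine (norm_integral_le_of_norm_le ((integrable_exp_neg_norm_sq.const_mul _).mul_const M)
    (.of_forall fun v => norm_mehlerOp_integrand_le hω hε hM x v)).trans_eq ?_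
  rw [integral_mul_const, integral_const_mul, integral_exp_neg_norm_sq, ← mul_pow,
    inv_mul_cancel₀ (by positivity), one_pow, one_mul]

lemma tendsto_mehlerOp {ω M : ℝ} (hω : 0 < ω) (ha : Continuous a) (hM : ∀ x, ‖a x‖ ≤ M)
    (x : EuclideanSpace ℝ (Fin n)) :
    Tendsto (fun ε : ℝ => mehlerOp ω ε a x) (𝓝[>] 0) (𝓝 (a x)) := by
  have hT : Tendsto (fun ε : ℝ => ∫ v,
      ((√(4 * Real.exp (-(2 * ω * ε)) / (Real.pi * (1 + Real.exp (-(2 * ω * ε))) ^ 2)) ^ n *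
        Real.exp (-(ω / 4 * ((1 - Real.exp (-(2 * ω * ε))) / (1 + Real.exp (-(2 * ω * ε)))) *
          ‖x + (x + √(4 / ω * ((1 - Real.exp (-(2 * ω * ε))) / (1 + Real.exp (-(2 * ω * ε))))) • v)‖ ^ 2)
          - ‖v‖ ^ 2) : ℝ) : ℂ) *
        a (x + √(4 / ω * ((1 - Real.exp (-(2 * ω * ε))) / (1 + Real.exp (-(2 * ω * ε))))) • v))
      (𝓝[>] 0) (𝓝 (∫ v : EuclideanSpace ℝ (Fin n), (((√Real.pi)⁻¹ ^ n * Real.exp (-‖v‖ ^ 2) : ℝ) : ℂ) * a x)) := by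
    refine tendsto_integral_filter_of_dominated_convergence
      (fun v : EuclideanSpace ℝ (Fin n) => (√Real.pi)⁻¹ ^ n * Real.exp (-‖v‖ ^ 2) * M) ?_ ?_
      ((integrable_exp_neg_norm_sq.const_mul _).mul_const M) ?_
    · refine .of_forall fun ε => Continuous.aestronglyMeasurable ?_
      fun_prop
    · filter_upwards [self_mem_nhdsWithin] with ε hε
      exact .of_forall fun v => norm_mehlerOp_integrand_le hω hε hM x v
    · refine .of_forall fun v : EuclideanSpace ℝ (Fin n) => tendsto_nhdsWithin_of_tendsto_nhds ?_
      have hden : ∀ ε : ℝ, Real.pi * (1 + Real.exp (-(2 * ω * ε))) ^ 2 ≠ 0 := fun ε => by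
        have := Real.exp_pos (-(2 * ω * ε)); have := Real.pi_pos; positivity
      have hden' : ∀ ε : ℝ, 1 + Real.exp (-(2 * ω * ε)) ≠ 0 := fun ε => by
        have := Real.exp_pos (-(2 * ω * ε)); positivity
      have hcont : Continuous (fun ε : ℝ =>
        ((√(4 * Real.exp (-(2 * ω * ε)) / (Real.pi * (1 + Real.exp (-(2 * ω * ε))) ^ 2)) ^ n *
        Real.exp (-(ω / 4 * ((1 - Real.exp (-(2 * ω * ε))) / (1 + Real.exp (-(2 * ω * ε)))) *
          ‖x + (x + √(4 / ω * ((1 - Real.exp (-(2 * ω * ε))) / (1 + Real.exp (-(2 * ω * ε))))) • v)‖ ^ 2)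
          - ‖v‖ ^ 2) : ℝ) : ℂ) *
        a (x + √(4 / ω * ((1 - Real.exp (-(2 * ω * ε))) / (1 + Real.exp (-(2 * ω * ε))))) • v)) := by
        fun_prop (disch := assumption)
      have h0 := hcont.tendsto 0
      convert! h0 using 2
      have : √(4 * 1 / (Real.pi * (1 + 1) ^ 2)) = (√Real.pi)⁻¹ := by
        rw [← Real.sqrt_inv]; congr 1; have := Real.pi_pos; field_simp; norm_num
      simp only [mul_zero, neg_zero, Real.exp_zero, sub_self, zero_div, zero_mul, this,
        Real.sqrt_zero, zero_smul, add_zero, zero_sub]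
  have hI : ∫ v : EuclideanSpace ℝ (Fin n), (((√Real.pi)⁻¹ ^ n * Real.exp (-‖v‖ ^ 2) : ℝ) : ℂ) * a x =
      a x := by
    rw [integral_mul_const, integral_complex_ofReal, integral_const_mul, integral_exp_neg_norm_sq,
      ← mul_pow, inv_mul_cancel₀ (by positivity), one_pow, Complex.ofReal_one, one_mul]
  rw [hI] at hT
  refine hT.congr' ?_
  filter_upwards [self_mem_nhdsWithin] with ε hε
  exact (mehlerOp_ofReal hω hε a x).symm

/-- Expand the square and use the contraction. Strong convergence is thereby reduced to convergence
of the single inner product `⟨a, M a⟩`. -/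
lemma integral_norm_sub_mehlerOp_sq_le (hn : n ≠ 0) {ω ε : ℝ} (hω : 0 ≤ ω) (hε : 0 < ε)
    (ha : Integrable a) (ha2 : MemLp a 2 volume) :
    ∫ x, ‖a x - mehlerOp ω ε a x‖ ^ 2 ≤
      2 * (∫ x, ‖a x‖ ^ 2) - 2 * (∫ x, (starRingEnd ℂ (a x) * mehlerOp ω ε a x).re) := by
  obtain ⟨h1, h2⟩ := memLp_mehlerOp hn hω (z := ε) (by simpa using hε) ha ha2
  have h3 : Integrable (fun x => starRingEnd ℂ (a x) * mehlerOp ω ε a x) :=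
    integrable_mul_of_memLp ha2.star h1
  have h4 := ha2.integrable_norm_pow two_ne_zero
  have h5 := h1.integrable_norm_pow two_ne_zero
  have e : ∀ x, ‖a x - mehlerOp ω ε a x‖ ^ 2 = (‖a x‖ ^ 2 + ‖mehlerOp ω ε a x‖ ^ 2) -
      2 * (starRingEnd ℂ (a x) * mehlerOp ω ε a x).re := by
    intro x
    simp only [Complex.sq_norm, Complex.normSq_apply, Complex.sub_re, Complex.sub_im,
      Complex.mul_re, Complex.conj_re, Complex.conj_im]
    ring
  have h6 : Integrable (fun x => 2 * (starRingEnd ℂ (a x) * mehlerOp ω ε a x).re) :=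
    h3.re.const_mul 2
  simp only [e]
  rw [integral_sub (by exact h4.add h5) h6, integral_add h4 h5, integral_const_mul]
  linarith

lemma tendsto_integral_norm_sub_mehlerOp_sq (hn : n ≠ 0) {ω M : ℝ} (hω : 0 < ω)
    (hac : Continuous a) (hM : ∀ x, ‖a x‖ ≤ M) (ha : Integrable a) (ha2 : MemLp a 2 volume) :
    Tendsto (fun ε : ℝ => ∫ x, ‖a x - mehlerOp ω ε a x‖ ^ 2) (𝓝[>] 0) (𝓝 0) := by
  have h1 : Tendsto (fun ε : ℝ => ∫ x, (starRingEnd ℂ (a x) * mehlerOp ω ε a x).re) (𝓝[>] 0)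
      (𝓝 (∫ x, (starRingEnd ℂ (a x) * a x).re)) := by
    refine tendsto_integral_filter_of_dominated_convergence (fun x => ‖a x‖ * M) ?_ ?_
      (ha.norm.mul_const M) ?_
    · filter_upwards [self_mem_nhdsWithin] with ε hε
      have h2 := (memLp_mehlerOp hn hω.le (z := ε) (by simpa using hε) ha ha2).1
      have h3 : Integrable (fun x => starRingEnd ℂ (a x) * mehlerOp ω ε a x) :=
        integrable_mul_of_memLp ha2.star h2
      exact h3.re.1
    · filter_upwards [self_mem_nhdsWithin] with ε hε
      refine .of_forall fun x => ?_
      rw [Real.norm_eq_abs]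
      refine (Complex.abs_re_le_norm _).trans ?_
      rw [norm_mul, RCLike.norm_conj]
      gcongr
      exact norm_mehlerOp_ofReal_le hω hε hM x
    · refine .of_forall fun x => ?_
      exact (Complex.continuous_re.tendsto _).comp ((tendsto_mehlerOp hω hac hM x).const_mul _)
  have h2 : ∫ x, (starRingEnd ℂ (a x) * a x).re = ∫ x, ‖a x‖ ^ 2 := by
    congr 1; ext x
    rw [mul_comm, Complex.mul_conj, Complex.ofReal_re, Complex.normSq_eq_norm_sq]
  rw [h2] at h1
  have h3 : Tendsto (fun ε : ℝ => 2 * (∫ x, ‖a x‖ ^ 2) -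
      2 * (∫ x, (starRingEnd ℂ (a x) * mehlerOp ω ε a x).re)) (𝓝[>] 0) (𝓝 0) := by
    have := (h1.const_mul 2).const_sub (2 * (∫ x, ‖a x‖ ^ 2))
    rwa [sub_self] at this
  refine tendsto_of_tendsto_of_tendsto_of_le_of_le' tendsto_const_nhds h3
    (.of_forall fun ε => integral_nonneg fun _ => by positivity) ?_
  filter_upwards [self_mem_nhdsWithin] with ε hε
  exact integral_norm_sub_mehlerOp_sq_le hn hω.le hε ha ha2

/-- Uniform in `ω` and `ε`; it serves as the dominating function when the fibrewise limits are
integrated over the frequency. -/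
lemma integral_norm_sub_mehlerOp_sq_le' (hn : n ≠ 0) {ω ε : ℝ} (hω : 0 ≤ ω) (hε : 0 < ε)
    (ha : Integrable a) (ha2 : MemLp a 2 volume) :
    ∫ x, ‖a x - mehlerOp ω ε a x‖ ^ 2 ≤ 4 * ∫ x, ‖a x‖ ^ 2 := by
  obtain ⟨h1, h2⟩ := memLp_mehlerOp hn hω (z := ε) (by simpa using hε) ha ha2
  have h4 := ha2.integrable_norm_pow two_ne_zero
  have h5 := h1.integrable_norm_pow two_ne_zero
  calc _ ≤ ∫ x, (2 * ‖a x‖ ^ 2 + 2 * ‖mehlerOp ω ε a x‖ ^ 2) := by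
        refine integral_mono ((ha2.sub h1).integrable_norm_pow two_ne_zero)
          ((h4.const_mul 2).add (h5.const_mul 2)) fun x => ?_
        have := norm_sub_le (a x) (mehlerOp ω ε a x)
        nlinarith [sq_nonneg (‖a x‖ - ‖mehlerOp ω ε a x‖), norm_nonneg (a x - mehlerOp ω ε a x)]
    _ = 2 * (∫ x, ‖a x‖ ^ 2) + 2 * ∫ x, ‖mehlerOp ω ε a x‖ ^ 2 := by
        rw [integral_add (h4.const_mul 2) (h5.const_mul 2), integral_const_mul, integral_const_mul]
    _ ≤ _ := by linarith

end ApproximateIdentity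

/-! ### Plancherel for the Fourier transform in `t` -/

section Plancherel

open FourierTransform

/-- The Fourier transform of an integrable square integrable function is its `L²` transform. -/
lemma coeFn_fourier_toLp {v : ℝ → ℂ} (hv : Integrable v) (hv2 : MemLp v 2 volume) :
    (𝓕 (hv2.toLp v) : Lp ℂ 2 (volume : Measure ℝ)) =ᵐ[volume] 𝓕 v := by
  have hcont : Continuous (𝓕 v) :=
    VectorFourier.fourierIntegral_continuous Real.continuous_fourierChar
      (by exact continuous_inner) hv
  -- Both functions represent the same tempered distribution: the `L²` transform by definition, the
  -- integral by moving the Fourier transform onto the test function.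
  refine ae_eq_of_integral_contDiff_smul_eq
    ((Lp.memLp _).locallyIntegrable (by norm_num)) hcont.locallyIntegrable fun g hg hgc => ?_
  have hg₁ : HasCompactSupport (Complex.ofRealCLM ∘ g) := hgc.comp_left rfl
  have hg₂ : ContDiff ℝ (⊤ : ℕ∞) (Complex.ofRealCLM ∘ g) := Complex.ofRealCLM.contDiff.comp hg
  set φ := hg₁.toSchwartzMap hg₂ with hφ
  have h1 := congrArg (fun T => T φ) (Lp.fourier_toTemperedDistribution_eq (hv2.toLp v))
  simp only [TemperedDistribution.fourier_apply, Lp.toTemperedDistribution_apply] at h1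
  have h2 : ∀ x, φ x = (g x : ℂ) := fun x => rfl
  have h3 : ∫ x, g x • 𝓕 v x = ∫ x, (𝓕 φ) x • v x := by
    have := VectorFourier.integral_fourierIntegral_smul_eq_flip (μ := volume) (ν := volume)
      (L := innerₗ ℝ) (f := φ) (g := v) Real.continuous_fourierChar
      (by exact continuous_inner) φ.integrable hv
    rw [flip_innerₗ] at this
    exact this.symm
  rw [h3]
  simp only [h2] at h1
  calc _ = ∫ x, (g x : ℂ) • (𝓕 (hv2.toLp v) : Lp ℂ 2 (volume : Measure ℝ)) x := by
        simp only [Complex.real_smul, smul_eq_mul]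
    _ = _ := h1.symm
    _ = _ := by
      refine integral_congr_ae ?_
      filter_upwards [hv2.coeFn_toLp] with x hx
      rw [hx]

lemma eLpNorm_fourier {v : ℝ → ℂ} (hv : Integrable v) (hv2 : MemLp v 2 volume) :
    eLpNorm (𝓕 v) 2 volume = eLpNorm v 2 volume := by
  rw [← eLpNorm_congr_ae (coeFn_fourier_toLp hv hv2), ← eLpNorm_congr_ae hv2.coeFn_toLp]
  have := Lp.norm_fourier_eq (hv2.toLp v)
  rw [Lp.norm_def, Lp.norm_def] at this
  exact (ENNReal.toReal_eq_toReal_iff' (Lp.eLpNorm_ne_top _) (Lp.eLpNorm_ne_top _)).1 this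

lemma integral_conj_fourier_mul_fourier {v w : ℝ → ℂ} (hv : Integrable v) (hv2 : MemLp v 2 volume)
    (hw : Integrable w) (hw2 : MemLp w 2 volume) :
    ∫ x, starRingEnd ℂ (𝓕 w x) * 𝓕 v x = ∫ x, starRingEnd ℂ (w x) * v x := by
  have := Lp.inner_fourier_eq (hw2.toLp w) (hv2.toLp v)
  rw [L2.inner_def, L2.inner_def] at this
  calc _ = ∫ x, inner ℂ ((𝓕 (hw2.toLp w) : Lp ℂ 2 (volume : Measure ℝ)) x)
        ((𝓕 (hv2.toLp v) : Lp ℂ 2 (volume : Measure ℝ)) x) := by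
        refine integral_congr_ae ?_
        filter_upwards [coeFn_fourier_toLp hv hv2, coeFn_fourier_toLp hw hw2] with x h1 h2
        rw [h1, h2, RCLike.inner_apply, mul_comm]
    _ = _ := this
    _ = _ := by
        refine integral_congr_ae ?_
        filter_upwards [hv2.coeFn_toLp, hw2.coeFn_toLp] with x h1 h2
        rw [h1, h2, RCLike.inner_apply, mul_comm]

variable {X : Type*}

/-- The Fourier transform in the second variable. -/
noncomputable def partialFourier (v : X × ℝ → ℂ) (p : X × ℝ) : ℂ := 𝓕 (fun t => v (p.1, t)) p.2

lemma partialFourier_eq (v : X × ℝ → ℂ) (p : X × ℝ) : partialFourier v p =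
    ∫ t, Complex.exp (↑(-(2 * Real.pi * p.2 * t)) * Complex.I) * v (p.1, t) := by
  rw [partialFourier, Real.fourier_eq']
  simp only [smul_eq_mul]
  congr 1; ext t
  congr 4
  simp; ring

lemma norm_partialFourier_le (v : X × ℝ → ℂ) (p : X × ℝ) :
    ‖partialFourier v p‖ ≤ ∫ t, ‖v (p.1, t)‖ := by
  rw [partialFourier_eq]
  refine (norm_integral_le_integral_norm _).trans_eq ?_
  congr 1; ext t
  rw [norm_mul, Complex.norm_exp_ofReal_mul_I, one_mul]

variable [MeasurableSpace X] {μ : Measure X} [SFinite μ]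

lemma stronglyMeasurable_partialFourier {v : X × ℝ → ℂ} (hv : StronglyMeasurable v) :
    StronglyMeasurable (partialFourier v) := by
  have : partialFourier v = fun p : X × ℝ =>
      ∫ t, Complex.exp (↑(-(2 * Real.pi * p.2 * t)) * Complex.I) * v (p.1, t) :=
    funext (partialFourier_eq v)
  rw [this]
  refine StronglyMeasurable.integral_prod_right' (f := fun q : (X × ℝ) × ℝ =>
    Complex.exp (↑(-(2 * Real.pi * q.1.2 * q.2)) * Complex.I) * v (q.1.1, q.2)) ?_
  refine StronglyMeasurable.mul ?_ (hv.comp_measurable (by fun_prop))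
  exact Measurable.stronglyMeasurable (by fun_prop)

lemma ae_memLp_two_prodMk {v : X × ℝ → ℂ} (hv : MemLp v 2 (μ.prod volume)) :
    ∀ᵐ x ∂μ, MemLp (fun t => v (x, t)) 2 volume := by
  have h1 := hv.integrable_norm_pow two_ne_zero
  have h2 := h1.prod_right_ae
  have h3 := hv.1.prodMk_left
  filter_upwards [h2, h3] with x hx hx'
  exact (memLp_two_iff_integrable_sq_norm hx').2 hx

lemma lintegral_enorm_partialFourier_sq {v : X × ℝ → ℂ} (hvm : StronglyMeasurable v)
    (hv : ∀ᵐ x ∂μ, Integrable (fun t => v (x, t))) (hv2 : MemLp v 2 (μ.prod volume)) :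
    ∫⁻ p, ‖partialFourier v p‖ₑ ^ 2 ∂(μ.prod volume) = ∫⁻ p, ‖v p‖ₑ ^ 2 ∂(μ.prod volume) := by
  rw [lintegral_prod _ (by
      exact ((stronglyMeasurable_partialFourier hvm).enorm.pow_const 2).aemeasurable),
    lintegral_prod _ (by exact (hvm.enorm.pow_const 2).aemeasurable)]
  refine lintegral_congr_ae ?_
  filter_upwards [hv, ae_memLp_two_prodMk hv2] with x h1 h2
  have h3 := eLpNorm_fourier h1 h2
  have h4 : ∀ g : ℝ → ℂ, ∫⁻ t, ‖g t‖ₑ ^ 2 = eLpNorm g 2 volume ^ 2 := by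
    intro g
    rw [eLpNorm_eq_lintegral_rpow_enorm_toReal two_ne_zero ENNReal.ofNat_ne_top,
      ← ENNReal.rpow_natCast, ← ENNReal.rpow_mul]
    simp
  simp only [partialFourier]
  rw [h4, h4, h3]

lemma memLp_partialFourier {v : X × ℝ → ℂ} (hvm : StronglyMeasurable v)
    (hv : ∀ᵐ x ∂μ, Integrable (fun t => v (x, t))) (hv2 : MemLp v 2 (μ.prod volume)) :
    MemLp (partialFourier v) 2 (μ.prod volume) := by
  refine ⟨(stronglyMeasurable_partialFourier hvm).aestronglyMeasurable, ?_⟩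
  have h1 := hv2.2
  rw [eLpNorm_lt_top_iff_lintegral_rpow_enorm_lt_top two_ne_zero ENNReal.ofNat_ne_top] at h1 ⊢
  simpa [lintegral_enorm_partialFourier_sq hvm hv hv2] using h1

lemma integral_norm_partialFourier_sq {v : X × ℝ → ℂ} (hvm : StronglyMeasurable v)
    (hv : ∀ᵐ x ∂μ, Integrable (fun t => v (x, t))) (hv2 : MemLp v 2 (μ.prod volume)) :
    ∫ p, ‖partialFourier v p‖ ^ 2 ∂(μ.prod volume) = ∫ p, ‖v p‖ ^ 2 ∂(μ.prod volume) := by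
  have h := lintegral_enorm_partialFourier_sq hvm hv hv2
  rw [integral_eq_lintegral_of_nonneg_ae (.of_forall fun _ => by positivity)
      (by exact ((stronglyMeasurable_partialFourier hvm).norm.pow 2).aestronglyMeasurable),
    integral_eq_lintegral_of_nonneg_ae (.of_forall fun _ => by positivity)
      (by exact (hvm.norm.pow 2).aestronglyMeasurable)]
  congr 1
  simpa only [ENNReal.ofReal_pow (norm_nonneg _), ofReal_norm] using h

lemma integral_conj_partialFourier_mul {v w : X × ℝ → ℂ} (hvm : StronglyMeasurable v)
    (hv : ∀ᵐ x ∂μ, Integrable (fun t => v (x, t))) (hv2 : MemLp v 2 (μ.prod volume))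
    (hwm : StronglyMeasurable w) (hw : ∀ᵐ x ∂μ, Integrable (fun t => w (x, t)))
    (hw2 : MemLp w 2 (μ.prod volume)) :
    ∫ p, starRingEnd ℂ (partialFourier w p) * partialFourier v p ∂(μ.prod volume) =
      ∫ p, starRingEnd ℂ (w p) * v p ∂(μ.prod volume) := by
  rw [integral_prod _ (by
      exact integrable_mul_of_memLp (memLp_partialFourier hwm hw hw2).star
        (memLp_partialFourier hvm hv hv2)),
    integral_prod _ (by exact integrable_mul_of_memLp hw2.star hv2)]
  refine integral_congr_ae ?_
  filter_upwards [hv, ae_memLp_two_prodMk hv2, hw, ae_memLp_two_prodMk hw2] with x h1 h2 h3 h4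
  exact integral_conj_fourier_mul_fourier h1 h2 h3 h4

end Plancherel

/-! ### Holomorphic parameter integrals -/

section HolomorphicIntegral

open Metric Filter Topology

/-- A locally dominated integral of holomorphic functions is holomorphic. -/
lemma differentiableOn_integral_of_dominated {α : Type*} [MeasurableSpace α] {μ : Measure α}
    {U : Set ℂ} (hU : IsOpen U) {F : ℂ → α → ℂ}
    (hF : ∀ z ∈ U, AEStronglyMeasurable (F z) μ)
    (hd : ∀ᵐ a ∂μ, DifferentiableOn ℂ (fun z => F z a) U)
    (hb : ∀ z ∈ U, ∃ V ∈ 𝓝 z, ∃ b : α → ℝ, Integrable b μ ∧ ∀ᵐ a ∂μ, ∀ w ∈ V, ‖F w a‖ ≤ b a) :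
    DifferentiableOn ℂ (fun z => ∫ a, F z a ∂μ) U := by
  intro z₀ hz₀
  obtain ⟨V, hV, b, hbi, hb⟩ := hb z₀ hz₀
  obtain ⟨r, hr, hrV⟩ := Metric.mem_nhds_iff.1 (inter_mem hV (hU.mem_nhds hz₀))
  -- Cauchy's estimate on circles of radius `r/4` turns the bound on `F` into a bound on its
  -- derivative.
  have hder : ∀ᵐ a ∂μ, ∀ z ∈ Metric.ball z₀ (r / 2), ‖deriv (fun z => F z a) z‖ ≤ b a / (r / 4) := by
    filter_upwards [hb, hd] with a ha hda z hz
    have hsub : closedBall z (r / 4) ⊆ Metric.ball z₀ r := by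
      intro w hw
      rw [mem_closedBall] at hw; rw [mem_ball] at hz ⊢
      linarith [dist_triangle w z z₀]
    refine Complex.norm_deriv_le_of_forall_mem_sphere_norm_le (by positivity) ?_ fun w hw =>
      ha w (hrV (hsub (sphere_subset_closedBall hw))).1
    refine DifferentiableOn.diffContOnCl ?_
    exact hda.mono fun w hw => (hrV (hsub (closure_ball_subset_closedBall hw))).2
  have hdiff : ∀ᵐ a ∂μ, ∀ z ∈ Metric.ball z₀ (r / 2), HasDerivAt (fun z => F z a)
      (deriv (fun z => F z a) z) z := by
    filter_upwards [hd] with a hda z hz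
    exact (hda.differentiableAt (hU.mem_nhds
      (hrV (ball_subset_ball (by linarith) hz)).2)).hasDerivAt
  -- The derivative is the limit of difference quotients along `z₀ + r/(k+2)`; the shift by 2 keeps
  -- the points inside the ball.
  have hmeas : AEStronglyMeasurable (fun a => deriv (fun z => F z a) z₀) μ := by
    have hpos : ∀ k : ℕ, 0 < r / (k + 2) := fun k => by positivity
    have hmem : ∀ k : ℕ, z₀ + ((r / (k + 2) : ℝ) : ℂ) ∈ U := by
      intro k
      refine (hrV ?_).2
      rw [mem_ball, dist_eq_norm, add_sub_cancel_left, Complex.norm_real,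
        Real.norm_of_nonneg (hpos k).le, div_lt_iff₀ (by positivity)]
      nlinarith [(Nat.cast_nonneg k : (0 : ℝ) ≤ k)]
    refine aestronglyMeasurable_of_tendsto_ae atTop (f := fun (k : ℕ) a =>
      (((r / (k + 2) : ℝ) : ℂ))⁻¹ * (F (z₀ + ((r / (k + 2) : ℝ) : ℂ)) a - F z₀ a)) (fun k => ?_) ?_
    · exact ((hF _ (hmem k)).sub (hF _ hz₀)).const_mul _
    · filter_upwards [hdiff] with a ha
      have h1 := hasDerivAt_iff_tendsto_slope_zero.1 (ha z₀ (mem_ball_self (by positivity)))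
      refine h1.comp (tendsto_nhdsWithin_iff.2 ⟨?_, .of_forall fun k => ?_⟩)
      · have h2 : Tendsto (fun k : ℕ => r / ((k : ℝ) + 2)) atTop (𝓝 0) :=
          tendsto_const_nhds.div_atTop (tendsto_atTop_add_const_right _ _
            tendsto_natCast_atTop_atTop)
        exact (Complex.continuous_ofReal.tendsto' 0 0 Complex.ofReal_zero).comp h2
      · exact Complex.ofReal_ne_zero.2 (hpos k).ne'
  have hint : Integrable (F z₀) μ :=
    hbi.mono' (hF z₀ hz₀) (by
      filter_upwards [hb] with a ha
      exact ha z₀ (hrV (mem_ball_self hr)).1)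
  exact (hasDerivAt_integral_of_dominated_loc_of_deriv_le (ball_mem_nhds z₀ (half_pos hr))
    (by filter_upwards [hU.mem_nhds hz₀] with z hz using hF z hz) hint hmeas hder
    (hbi.div_const _) hdiff).2.differentiableAt.differentiableWithinAt

end HolomorphicIntegral

/-! ### Contour rotation and the dispersive kernel bound -/

section Kernel

open Filter Topology

variable {n : ℕ}

lemma integral_exp_neg_mul_abs {c : ℝ} (hc : 0 < c) :
    ∫ μ : ℝ, Real.exp (-(c * |μ|)) = 2 / c := by
  rw [integral_comp_abs (f := fun x => Real.exp (-(c * x)))]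
  have := integral_exp_mul_Ioi (neg_lt_zero.2 hc) 0
  simp only [neg_mul, mul_zero, Real.exp_zero] at this
  rw [this]
  field_simp

lemma integrable_exp_neg_mul_abs {c : ℝ} (hc : 0 < c) :
    Integrable fun μ : ℝ => Real.exp (-(c * |μ|)) := by
  refine Integrable.of_integral_ne_zero ?_
  rw [integral_exp_neg_mul_abs hc]
  positivity

lemma measurable_mehler : Measurable fun p : (ℝ × ℂ) × (EuclideanSpace ℝ (Fin n) ×
    EuclideanSpace ℝ (Fin n)) => mehler p.1.1 p.1.2 p.2.1 p.2.2 := by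
  unfold mehler mehlerExp mehlerTanh mehlerRoot nome
  fun_prop

/-- At real time the exponent is real and nonpositive, so `exp (ζ · mehlerExp)` has modulus at most
1 whenever `Re ζ ≥ 0`. This is why the final bound does not depend on `x` and `y`. -/
lemma exists_mehlerExp_one_eq {ω : ℝ} (hω : 0 ≤ ω) (y x : EuclideanSpace ℝ (Fin n)) :
    ∃ r : ℝ, r ≤ 0 ∧ mehlerExp ω 1 y x = r := by
  rcases hω.eq_or_lt with rfl | hω
  · exact ⟨0, le_rfl, by simp [mehlerExp]⟩
  refine ⟨(mehlerExp ω 1 y x).re, ?_, ?_⟩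
  · have := re_mehlerExp_le hω (z := 1) (by simp) y x
    have h2 : 0 ≤ (1 : ℂ).re / (8 * ‖(1 : ℂ)‖ ^ 2) * ‖x - y‖ ^ 2 := by
      rw [Complex.one_re]; positivity
    linarith
  · have h : mehlerExp ω 1 y x = ((-(ω / 4) * ((1 - Real.exp (-(2 * ω * 1))) /
        (1 + Real.exp (-(2 * ω * 1))) * ‖x + y‖ ^ 2 +
        ((1 - Real.exp (-(2 * ω * 1))) / (1 + Real.exp (-(2 * ω * 1))))⁻¹ * ‖x - y‖ ^ 2) : ℝ) : ℂ) := by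
      rw [mehlerExp, mehlerTanh, nome]; push_cast; rfl
    rw [h, Complex.ofReal_re]

/-- The integrand of the kernel after rotating the contour. -/
noncomputable def rotatedIntegrand (τ : ℝ) (y x : EuclideanSpace ℝ (Fin n)) (ζ : ℂ) (μ : ℝ) : ℂ :=
  Complex.exp (μ * τ * ζ * Complex.I) * mehlerRoot |μ| 1 ^ n *
    Complex.exp (ζ * mehlerExp |μ| 1 y x)

/-- The character grows at most like `exp (3n|μ|/4)` and the normalising factor decays like `exp
(-7n|μ|/8)`; the margin `n/8 ≥ 1/8` makes the integral converge uniformly. -/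
lemma norm_rotatedIntegrand_le (hn : n ≠ 0) {τ : ℝ} {ζ : ℂ} (hζ : 0 < ζ.re)
    (hτ : |τ * ζ.im| ≤ 3 / 4 * n) (y x : EuclideanSpace ℝ (Fin n)) (μ : ℝ) :
    ‖rotatedIntegrand τ y x ζ μ‖ ≤ √(4 / Real.pi) ^ n * Real.exp (-(1 / 8 * |μ|)) := by
  obtain ⟨r, hr, hre⟩ := exists_mehlerExp_one_eq (abs_nonneg μ) y x
  have h1 := norm_mehlerRoot_le one_pos (abs_nonneg μ) (z := 1) (by simp)
  have h2 : ‖Complex.exp (μ * τ * ζ * Complex.I)‖ ≤ Real.exp (3 / 4 * n * |μ|) := by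
    rw [Complex.norm_exp]
    apply Real.exp_le_exp.2
    have : ((μ : ℂ) * τ * ζ * Complex.I).re = -(μ * (τ * ζ.im)) := by
      simp [Complex.mul_re, Complex.mul_im]; ring
    rw [this]
    calc _ ≤ |-(μ * (τ * ζ.im))| := le_abs_self _
      _ = |μ| * |τ * ζ.im| := by rw [abs_neg, abs_mul]
      _ ≤ |μ| * (3 / 4 * n) := by gcongr
      _ = _ := mul_comm _ _
  have h3 : ‖Complex.exp (ζ * mehlerExp |μ| 1 y x)‖ ≤ 1 := by
    rw [hre, Complex.norm_exp, mul_comm, Complex.re_ofReal_mul, Real.exp_le_one_iff]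
    exact mul_nonpos_of_nonpos_of_nonneg hr hζ.le
  rw [rotatedIntegrand, norm_mul, norm_mul, norm_pow]
  calc _ ≤ Real.exp (3 / 4 * n * |μ|) * (√(4 / (Real.pi * 1)) * Real.exp (-(7 / 8 * |μ| * 1))) ^ n
        * 1 := by gcongr
    _ = √(4 / Real.pi) ^ n * Real.exp (-(1 / 8 * n * |μ|)) := by
      rw [mul_one, mul_one, mul_one, mul_pow, ← Real.exp_nat_mul, mul_left_comm, ← Real.exp_add]
      congr 2; ring
    _ ≤ _ := by
      gcongr
      have : (1 : ℝ) ≤ n := by exact_mod_cast Nat.one_le_iff_ne_zero.2 hn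
      nlinarith

lemma measurable_rotatedIntegrand (τ : ℝ) (y x : EuclideanSpace ℝ (Fin n)) (ζ : ℂ) :
    Measurable (rotatedIntegrand τ y x ζ) := by
  unfold rotatedIntegrand mehlerExp mehlerTanh mehlerRoot nome
  fun_prop

lemma differentiable_rotatedIntegrand (τ : ℝ) (y x : EuclideanSpace ℝ (Fin n)) (μ : ℝ) :
    Differentiable ℂ (fun ζ => rotatedIntegrand τ y x ζ μ) := by
  unfold rotatedIntegrand
  fun_prop

/-- The kernel of the Mehler semigroup in the original variables. -/
noncomputable def grushinKernel (z : ℂ) (τ : ℝ) (y x : EuclideanSpace ℝ (Fin n)) : ℂ :=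
  ∫ r : ℝ, Complex.exp (↑(2 * Real.pi * r * τ) * Complex.I) * mehler (2 * Real.pi * |r|) z y x

lemma norm_mehler_freq_le (hn : n ≠ 0) {ε : ℝ} (hε : 0 < ε) {z : ℂ} (hz : ε ≤ z.re) (r : ℝ)
    (y x : EuclideanSpace ℝ (Fin n)) : ‖mehler (2 * Real.pi * |r|) z y x‖ ≤
      √(4 / (Real.pi * ε)) ^ n * Real.exp (-(ε * |r|)) := by
  refine (norm_mehler_le' hn hε (by positivity) hz y x).trans ?_
  rw [mul_pow, ← Real.exp_nat_mul]
  gcongr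
  have : (1 : ℝ) ≤ n := by exact_mod_cast Nat.one_le_iff_ne_zero.2 hn
  have h3 : 3 ≤ Real.pi := Real.pi_gt_three.le
  have h4 : 0 ≤ ε * |r| := by positivity
  have h5 : ε * |r| ≤ 7 / 8 * (2 * Real.pi * |r|) * ε := by nlinarith
  nlinarith [mul_le_mul_of_nonneg_right this (h4.trans h5)]

/-- The hyperbolic functions depend only on `ω z`, and `(a|μ|) · a⁻¹ = |μ|`. Only the prefactors
`√ω` and `ω/4` see `a`. -/
lemma mehler_rescale {a : ℝ} (ha : 0 < a) (μ : ℝ) (y x : EuclideanSpace ℝ (Fin n)) :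
    mehler (a * |μ|) (a : ℂ)⁻¹ y x =
      ((a : ℂ) ^ (1 / 2 : ℂ)) ^ n * (mehlerRoot |μ| 1 ^ n * Complex.exp (a * mehlerExp |μ| 1 y x)) := by
  have ha' : (a : ℂ) ≠ 0 := by exact_mod_cast ha.ne'
  have h0 : nome (a * |μ|) (a : ℂ)⁻¹ = nome |μ| 1 := by
    rw [nome, nome]; congr 2; push_cast; field_simp
  have h1 : mehlerRoot (a * |μ|) (a : ℂ)⁻¹ = (a : ℂ) ^ (1 / 2 : ℂ) * mehlerRoot |μ| 1 := by
    have h2 : (a : ℂ) ^ (1 / 2 : ℂ) = (√a : ℝ) := by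
      rw [Real.sqrt_eq_rpow, Complex.ofReal_cpow ha.le]; push_cast; rfl
    have h3 : (((a * |μ| : ℝ) : ℂ) * (a : ℂ)⁻¹) = |μ| * 1 := by push_cast; field_simp
    rw [mehlerRoot, mehlerRoot, h0, h2, h3, mul_div_assoc, Real.sqrt_mul ha.le]
    push_cast; ring
  have h4 : mehlerExp (a * |μ|) (a : ℂ)⁻¹ y x = a * mehlerExp |μ| 1 y x := by
    rw [mehlerExp, mehlerExp, mehlerTanh, mehlerTanh, h0]; push_cast; ring
  rw [mehler, h1, h4, mul_pow, mul_assoc]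

lemma grushinKernel_ofReal_inv {a : ℝ} (ha : 0 < a) (τ : ℝ) (y x : EuclideanSpace ℝ (Fin n)) :
    grushinKernel (a : ℂ)⁻¹ τ y x = a / (2 * Real.pi) * ((a : ℂ) ^ (1 / 2 : ℂ)) ^ n *
      ∫ μ, rotatedIntegrand τ y x a μ := by
  have hpi := Real.pi_pos
  let g : ℝ → ℂ := fun r =>
    Complex.exp (↑(2 * Real.pi * r * τ) * Complex.I) * mehler (2 * Real.pi * |r|) (a : ℂ)⁻¹ y x
  have h := Measure.integral_comp_mul_left g (a / (2 * Real.pi))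
  rw [abs_inv, abs_of_pos (by positivity), eq_inv_smul_iff₀ (by positivity)] at h
  have hg : ∀ μ, g (a / (2 * Real.pi) * μ) =
      ((a : ℂ) ^ (1 / 2 : ℂ)) ^ n * rotatedIntegrand τ y x a μ := by
    intro μ
    have h1 : 2 * Real.pi * |a / (2 * Real.pi) * μ| = a * |μ| := by
      rw [abs_mul, abs_of_pos (by positivity)]; field_simp
    have h2 : 2 * Real.pi * (a / (2 * Real.pi) * μ) * τ = μ * τ * a := by field_simp
    change Complex.exp (↑(2 * Real.pi * (a / (2 * Real.pi) * μ) * τ) * Complex.I) *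
      mehler (2 * Real.pi * |a / (2 * Real.pi) * μ|) (a : ℂ)⁻¹ y x = _
    rw [h1, h2, mehler_rescale ha, rotatedIntegrand]
    push_cast
    ring
  rw [show grushinKernel (a : ℂ)⁻¹ τ y x = ∫ r, g r from rfl, ← h, Complex.real_smul]
  simp only [hg, integral_const_mul]
  push_cast
  ring

/-- The domain to which the rotated integral extends. -/
def rotationDomain (n : ℕ) (τ : ℝ) : Set ℂ := {ζ | 0 < ζ.re ∧ |τ * ζ.im| < 3 / 4 * n}

lemma isOpen_rotationDomain (n : ℕ) (τ : ℝ) : IsOpen (rotationDomain n τ) := by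
  have h : Continuous fun ζ : ℂ => |τ * ζ.im| := by fun_prop
  exact (isOpen_lt continuous_const Complex.continuous_re).inter (isOpen_lt h continuous_const)

lemma convex_rotationDomain (n : ℕ) (τ : ℝ) : Convex ℝ (rotationDomain n τ) := by
  have h : {ζ : ℂ | |τ * ζ.im| < 3 / 4 * n} = (τ • Complex.imLm) ⁻¹' Metric.ball 0 (3 / 4 * n) := by
    ext ζ; simp [Real.norm_eq_abs]
  have h2 : Convex ℝ {ζ : ℂ | |τ * ζ.im| < 3 / 4 * n} := by
    rw [h]; exact (convex_ball _ _).linear_preimage _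
  exact (convex_halfSpace_re_gt 0).inter h2

/-- Before rotation the integrand decays like `exp (-ε|r|)` whenever `Re z ≥ ε`, and `ζ ↦ 1/ζ`
preserves the right half plane. -/
lemma differentiableOn_grushinKernel_inv (hn : n ≠ 0) (τ : ℝ) (y x : EuclideanSpace ℝ (Fin n)) :
    DifferentiableOn ℂ (fun ζ => grushinKernel ζ⁻¹ τ y x) {ζ | 0 < ζ.re} := by
  have hinv : ∀ ζ : ℂ, 0 < ζ.re → 0 < (ζ⁻¹).re := by
    intro ζ hζ
    rw [Complex.inv_re]
    exact div_pos hζ (Complex.normSq_pos.2 (by rintro rfl; simp at hζ))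
  refine differentiableOn_integral_of_dominated
    (isOpen_lt continuous_const Complex.continuous_re) (fun ζ _ => ?_) (.of_forall fun r => ?_)
    fun ζ hζ => ?_
  · refine Measurable.aestronglyMeasurable ?_
    unfold mehler mehlerExp mehlerTanh mehlerRoot nome
    fun_prop
  · refine DifferentiableOn.const_mul ?_ _
    rcases eq_or_ne r 0 with rfl | hr
    · have : (fun ζ : ℂ => mehler (2 * Real.pi * |(0 : ℝ)|) ζ⁻¹ y x) = fun _ => 0 := by
        ext ζ; simp [mehler, mehlerRoot, hn]
      rw [this]; exact differentiableOn_const 0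
    · intro ζ hζ
      have hζ0 : ζ ≠ 0 := by rintro rfl; simp at hζ
      have h1 := (hasDerivAt_mehler (ω := 2 * Real.pi * |r|) (by positivity) (hinv ζ hζ) y x)
      exact (h1.differentiableAt.comp ζ (differentiableAt_inv hζ0)).differentiableWithinAt
  · set ε := (ζ⁻¹).re / 2 with hε
    have hε0 : 0 < ε := half_pos (hinv ζ hζ)
    have hζ0 : ζ ≠ 0 := by rintro rfl; simp at hζ
    have hc : ContinuousAt (fun w : ℂ => (w⁻¹).re) ζ :=
      Complex.continuous_re.continuousAt.comp (continuousAt_inv₀ hζ0)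
    refine ⟨{w | ε < (w⁻¹).re}, hc.eventually (lt_mem_nhds (by linarith)),
      fun r => √(4 / (Real.pi * ε)) ^ n * Real.exp (-(ε * |r|)),
      (integrable_exp_neg_mul_abs hε0).const_mul _, .of_forall fun r w hw => ?_⟩
    rw [norm_mul, Complex.norm_exp_ofReal_mul_I, one_mul]
    exact norm_mehler_freq_le hn hε0 (le_of_lt hw) r y x

lemma differentiableOn_integral_rotatedIntegrand (hn : n ≠ 0) (τ : ℝ)
    (y x : EuclideanSpace ℝ (Fin n)) :
    DifferentiableOn ℂ (fun ζ => ζ / (2 * Real.pi) * (ζ ^ (1 / 2 : ℂ)) ^ n *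
      ∫ μ, rotatedIntegrand τ y x ζ μ) (rotationDomain n τ) := by
  refine DifferentiableOn.mul ?_ ?_
  · intro ζ hζ
    have h : ζ ∈ Complex.slitPlane := Or.inl hζ.1
    have h1 : DifferentiableAt ℂ (fun ζ : ℂ => ζ ^ (1 / 2 : ℂ)) ζ :=
      differentiableAt_id.cpow_const h
    exact ((differentiableAt_id.div_const _).mul (h1.pow n)).differentiableWithinAt
  · refine differentiableOn_integral_of_dominated (isOpen_rotationDomain n τ)
      (fun ζ _ => (measurable_rotatedIntegrand τ y x ζ).aestronglyMeasurable)
      (.of_forall fun μ => (differentiable_rotatedIntegrand τ y x μ).differentiableOn)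
      fun ζ hζ => ⟨_, (isOpen_rotationDomain n τ).mem_nhds hζ, _,
        (integrable_exp_neg_mul_abs (c := 1 / 8) (by norm_num)).const_mul _,
        .of_forall fun μ w hw => norm_rotatedIntegrand_le hn hw.1 hw.2.le y x μ⟩

/-- Identity theorem: both sides are holomorphic on the convex domain and agree on the positive real
axis, where the formula is a plain change of variables. -/
lemma grushinKernel_inv_eq (hn : n ≠ 0) {τ : ℝ} {ζ : ℂ} (hζ : ζ ∈ rotationDomain n τ)
    (y x : EuclideanSpace ℝ (Fin n)) :
    grushinKernel ζ⁻¹ τ y x = ζ / (2 * Real.pi) * (ζ ^ (1 / 2 : ℂ)) ^ n *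
      ∫ μ, rotatedIntegrand τ y x ζ μ := by
  have hopen := isOpen_rotationDomain n τ
  have h1 := ((differentiableOn_grushinKernel_inv hn τ y x).mono
    (fun ζ (hζ : ζ ∈ rotationDomain n τ) => hζ.1)).analyticOnNhd hopen
  have h2 := (differentiableOn_integral_rotatedIntegrand hn τ y x).analyticOnNhd hopen
  have hmem : (1 : ℂ) ∈ rotationDomain n τ := by
    have : 0 < n := Nat.pos_of_ne_zero hn
    refine ⟨by simp, ?_⟩
    simp only [Complex.one_im, mul_zero, abs_zero]
    positivity
  refine h1.eqOn_of_preconnected_of_frequently_eq h2 (convex_rotationDomain n τ).isPreconnected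
    hmem ?_ hζ
  have ht : Tendsto (fun a : ℝ => (a : ℂ)) (𝓝[≠] 1) (𝓝[≠] (1 : ℂ)) := by
    refine tendsto_nhdsWithin_iff.2 ⟨?_, ?_⟩
    · have := (Complex.continuous_ofReal.tendsto 1).mono_left (nhdsWithin_le_nhds (s := {1}ᶜ))
      simpa using this
    · filter_upwards [self_mem_nhdsWithin] with a ha
      simpa using ha
  refine ht.frequently (Eventually.frequently ?_)
  filter_upwards [nhdsWithin_le_nhds (lt_mem_nhds one_pos)] with a ha
  exact grushinKernel_ofReal_inv ha τ y x

/-- The dispersive estimate for the kernel, uniformly in the regularisation `ε`. -/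
lemma norm_grushinKernel_le (hn : n ≠ 0) {ε s τ : ℝ} (hε : 0 < ε) (hs : s ≠ 0)
    (hτ : |τ| ≤ n * |s| / 2) (y x : EuclideanSpace ℝ (Fin n)) :
    ‖grushinKernel (ε + s * Complex.I) τ y x‖ ≤
      √(4 / Real.pi) ^ n * (8 / Real.pi) * (|s|⁻¹ * √(|s|⁻¹) ^ n) := by
  have hn0 : (0 : ℝ) < n := by exact_mod_cast Nat.pos_of_ne_zero hn
  set z : ℂ := ε + s * Complex.I with hz
  have hre : z.re = ε := by simp [hz]
  have him : z.im = s := by simp [hz]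
  have hs0 : 0 < |s| := abs_pos.2 hs
  have hnsq : Complex.normSq z = ε ^ 2 + s ^ 2 := by
    rw [Complex.normSq_apply, hre, him]; ring
  have hpos : 0 < ε ^ 2 + s ^ 2 := by positivity
  -- Here `|Im z⁻¹| = |s|/(ε² + s²) ≤ 1/|s|`, hence `|τ Im z⁻¹| ≤ n/2`, strictly inside the
  -- admissible `3n/4`.
  have hζ : z⁻¹ ∈ rotationDomain n τ := by
    refine ⟨?_, ?_⟩
    · rw [Complex.inv_re, hnsq, hre]; positivity
    · rw [Complex.inv_im, hnsq, him, abs_mul, abs_div, abs_neg, abs_of_pos hpos,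
        mul_div_assoc', div_lt_iff₀ hpos]
      nlinarith [sq_abs s, mul_le_mul_of_nonneg_right hτ hs0.le, mul_pos hn0 (sq_pos_of_pos hε),
        mul_pos hn0 (sq_pos_of_pos hs0)]
  have h1 := grushinKernel_inv_eq hn hζ y x
  rw [inv_inv] at h1
  have hnorm : ‖z⁻¹‖ ≤ |s|⁻¹ := by
    rw [norm_inv]
    gcongr
    rw [← him]; exact Complex.abs_im_le_norm z
  have hroot : ‖z⁻¹ ^ (1 / 2 : ℂ)‖ ≤ √(|s|⁻¹) := by
    have : (1 / 2 : ℂ) = ((1 / 2 : ℝ) : ℂ) := by push_cast; rfl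
    rw [this, Complex.norm_cpow_real, ← Real.sqrt_eq_rpow]
    exact Real.sqrt_le_sqrt hnorm
  have hint : ‖∫ μ, rotatedIntegrand τ y x z⁻¹ μ‖ ≤ √(4 / Real.pi) ^ n * 16 := by
    refine (norm_integral_le_of_norm_le
      ((integrable_exp_neg_mul_abs (c := 1 / 8) (by norm_num)).const_mul _)
      (.of_forall fun μ => norm_rotatedIntegrand_le hn hζ.1 hζ.2.le y x μ)).trans_eq ?_
    rw [integral_const_mul, integral_exp_neg_mul_abs (by norm_num)]
    norm_num
  have h2pi : ‖(2 * Real.pi : ℂ)‖ = 2 * Real.pi := by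
    rw [norm_mul, Complex.norm_real, Real.norm_of_nonneg Real.pi_pos.le]; simp
  rw [h1, norm_mul, norm_mul, norm_div, norm_pow, h2pi]
  calc _ ≤ |s|⁻¹ / (2 * Real.pi) * √(|s|⁻¹) ^ n * (√(4 / Real.pi) ^ n * 16) := by
        have := Real.pi_pos
        gcongr
    _ = _ := by ring

end Kernel

/-! ### The Mehler flow paired on the frequency side -/

section Pairing

open Filter Topology

variable {n : ℕ}

lemma lintegral_enorm_sq_eq {α : Type*} [MeasurableSpace α] {μ : Measure α} {f : α → ℂ}
    (hf : MemLp f 2 μ) : ∫⁻ x, ‖f x‖ₑ ^ 2 ∂μ = ENNReal.ofReal (∫ x, ‖f x‖ ^ 2 ∂μ) := by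
  rw [ofReal_integral_eq_lintegral_ofReal (hf.integrable_norm_pow two_ne_zero)
    (.of_forall fun _ => by positivity)]
  simp only [ENNReal.ofReal_pow (norm_nonneg _), ofReal_norm]

lemma memLp_two_of_lintegral_le {α : Type*} [MeasurableSpace α] {μ : Measure α} {f g : α → ℂ}
    (hf : AEStronglyMeasurable f μ) (hg : MemLp g 2 μ)
    (h : ∫⁻ x, ‖f x‖ₑ ^ 2 ∂μ ≤ ∫⁻ x, ‖g x‖ₑ ^ 2 ∂μ) :
    MemLp f 2 μ ∧ ∫ x, ‖f x‖ ^ 2 ∂μ ≤ ∫ x, ‖g x‖ ^ 2 ∂μ := by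
  have hf2 : MemLp f 2 μ := by
    refine ⟨hf, ?_⟩
    rw [eLpNorm_lt_top_iff_lintegral_rpow_enorm_lt_top two_ne_zero ENNReal.ofNat_ne_top]
    rw [lintegral_enorm_sq_eq hg] at h
    simpa using h.trans_lt ENNReal.ofReal_lt_top
  refine ⟨hf2, ?_⟩
  rw [lintegral_enorm_sq_eq hg, lintegral_enorm_sq_eq hf2] at h
  exact (ENNReal.ofReal_le_ofReal_iff (integral_nonneg fun _ => by positivity)).1 h

/-- For `y` in a bounded set the Gaussian in `x - y` is comparable to one centred at the origin,
with half the rate. -/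
lemma exists_norm_mehler_freq_le (hn : n ≠ 0) {z : ℂ} (hz : 0 < z.re) (R : ℝ) :
    ∃ K κ : ℝ, 0 ≤ K ∧ 0 < κ ∧ ∀ (r : ℝ) (y x : EuclideanSpace ℝ (Fin n)), ‖y‖ ≤ R →
      ‖mehler (2 * Real.pi * |r|) z y x‖ ≤ K * Real.exp (-(z.re * |r|)) * Real.exp (-κ * ‖x‖ ^ 2) := by
  set c := z.re / (8 * ‖z‖ ^ 2) with hc
  have hz0 : 0 < ‖z‖ := norm_pos_iff.2 (by rintro rfl; simp at hz)
  have hc0 : 0 < c := by positivity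
  refine ⟨√(4 / (Real.pi * z.re)) ^ n * Real.exp (c * R ^ 2), c / 2, by positivity, by positivity,
    fun r y x hy => ?_⟩
  refine (norm_mehler_le hn hz (by positivity) rfl le_rfl y x).trans ?_
  rw [mul_pow, ← Real.exp_nat_mul]
  have h1 : Real.exp (n * -(7 / 8 * (2 * Real.pi * |r|) * z.re)) ≤ Real.exp (-(z.re * |r|)) := by
    have : (1 : ℝ) ≤ n := by exact_mod_cast Nat.one_le_iff_ne_zero.2 hn
    have h3 : 3 ≤ Real.pi := Real.pi_gt_three.le
    have h4 : 0 ≤ z.re * |r| := by positivity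
    have h5 : z.re * |r| ≤ 7 / 8 * (2 * Real.pi * |r|) * z.re := by nlinarith
    apply Real.exp_le_exp.2
    nlinarith [mul_le_mul_of_nonneg_right this (h4.trans h5)]
  have h2 : Real.exp (-(c * ‖x - y‖ ^ 2)) ≤
      Real.exp (c * R ^ 2) * Real.exp (-(c / 2) * ‖x‖ ^ 2) := by
    rw [← Real.exp_add]
    apply Real.exp_le_exp.2
    have h3 : ‖x‖ ^ 2 ≤ 2 * ‖x - y‖ ^ 2 + 2 * R ^ 2 := by
      have h4 := norm_le_norm_sub_add x y
      have h5 : ‖x‖ ≤ ‖x - y‖ + R := by linarith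
      nlinarith [norm_nonneg x, sq_nonneg (‖x - y‖ - R), norm_nonneg (x - y)]
    nlinarith
  calc _ ≤ √(4 / (Real.pi * z.re)) ^ n * Real.exp (-(z.re * |r|)) *
        (Real.exp (c * R ^ 2) * Real.exp (-(c / 2) * ‖x‖ ^ 2)) := by gcongr
    _ = _ := by ring

/-- The Mehler kernel at frequency `r`, times the character `exp (-2 π i r t)`. -/
noncomputable def mehlerWave (z : ℂ) (p w : Space n) : ℂ :=
  mehler (2 * Real.pi * |p.2|) z p.1 w.1 * Complex.exp (↑(-(2 * Real.pi * p.2 * w.2)) * Complex.I)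

lemma norm_mehlerWave (z : ℂ) (p w : Space n) :
    ‖mehlerWave z p w‖ = ‖mehler (2 * Real.pi * |p.2|) z p.1 w.1‖ := by
  rw [mehlerWave, norm_mul, Complex.norm_exp_ofReal_mul_I, mul_one]

lemma measurable_mehlerWave (z : ℂ) :
    Measurable fun q : Space n × Space n => mehlerWave z q.1 q.2 := by
  unfold mehlerWave
  refine Measurable.mul ?_ (by fun_prop)
  exact measurable_mehler.comp (g := fun p : (ℝ × ℂ) × (EuclideanSpace ℝ (Fin n) ×
    EuclideanSpace ℝ (Fin n)) => mehler p.1.1 p.1.2 p.2.1 p.2.2)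
    (f := fun q : Space n × Space n => ((2 * Real.pi * |q.1.2|, z), (q.1.1, q.2.1))) (by fun_prop)

/-- The frequency side pairing of `v` with `a` through the Mehler kernels. -/
noncomputable def mehlerPairing (z : ℂ) (a v : Space n → ℂ) : ℂ :=
  ∫ p, a p * ∫ w, v w * mehlerWave z p w

/-- The Mehler operators applied at each frequency. -/
noncomputable def mehlerFiber (z : ℂ) (a : Space n → ℂ) (q : Space n) : ℂ :=
  mehlerOp (2 * Real.pi * |q.2|) z (fun y => a (y, q.2)) q.1

variable {a v : Space n → ℂ} {b : EuclideanSpace ℝ (Fin n) → ℝ} {R : ℝ} {z : ℂ}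

lemma stronglyMeasurable_mehlerFiber (ham : StronglyMeasurable a) (z : ℂ) :
    StronglyMeasurable (mehlerFiber z a) := by
  unfold mehlerFiber mehlerOp
  refine StronglyMeasurable.integral_prod_right' (f := fun q : Space n × EuclideanSpace ℝ (Fin n) =>
    mehler (2 * Real.pi * |q.1.2|) z q.2 q.1.1 * a (q.2, q.1.2)) ?_
  refine StronglyMeasurable.mul (Measurable.stronglyMeasurable ?_)
    (ham.comp_measurable (by fun_prop))
  exact measurable_mehler.comp (g := fun p : (ℝ × ℂ) × (EuclideanSpace ℝ (Fin n) ×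
    EuclideanSpace ℝ (Fin n)) => mehler p.1.1 p.1.2 p.2.1 p.2.2)
    (f := fun q : Space n × EuclideanSpace ℝ (Fin n) =>
      ((2 * Real.pi * |q.1.2|, z), (q.2, q.1.1))) (by fun_prop)

lemma integrable_section (ham : StronglyMeasurable a) (hb : Integrable b)
    (hab : ∀ p, ‖a p‖ ≤ b p.1) (r : ℝ) : Integrable (fun y => a (y, r)) :=
  hb.mono' (ham.comp_measurable (by fun_prop)).aestronglyMeasurable (.of_forall fun y => hab (y, r))

lemma memLp_section (ham : StronglyMeasurable a) (hb : MemLp b 2 volume)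
    (hab : ∀ p, ‖a p‖ ≤ b p.1) (r : ℝ) : MemLp (fun y => a (y, r)) 2 volume :=
  hb.mono' (ham.comp_measurable (by fun_prop)).aestronglyMeasurable (.of_forall fun y => hab (y, r))

lemma memLp_mehlerFiber (hn : n ≠ 0) (hz : 0 < z.re) (ham : StronglyMeasurable a)
    (ha2 : MemLp a 2 volume) (hb : Integrable b) (hb2 : MemLp b 2 volume)
    (hab : ∀ p, ‖a p‖ ≤ b p.1) :
    MemLp (mehlerFiber z a) 2 volume ∧ ∫ q, ‖mehlerFiber z a q‖ ^ 2 ≤ ∫ q, ‖a q‖ ^ 2 := by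
  have hN := stronglyMeasurable_mehlerFiber ham z
  refine memLp_two_of_lintegral_le hN.aestronglyMeasurable ha2 ?_
  rw [Measure.volume_eq_prod, lintegral_prod_symm _ (by
      exact (hN.enorm.pow_const 2).aemeasurable),
    lintegral_prod_symm _ (by exact (ham.enorm.pow_const 2).aemeasurable)]
  refine lintegral_mono fun r => ?_
  have h1 := memLp_section ham hb2 hab r
  obtain ⟨h2, h3⟩ := memLp_mehlerOp hn (ω := 2 * Real.pi * |r|) (by positivity) hz
    (integrable_section ham hb hab r) h1
  rw [lintegral_enorm_sq_eq h1]
  exact (lintegral_enorm_sq_eq h2).trans_le (ENNReal.ofReal_le_ofReal h3)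

/-- Apply the fixed frequency limit on each fibre `r ≠ 0` and integrate in `r` by dominated
convergence. -/
lemma tendsto_integral_norm_sub_mehlerFiber_sq (hn : n ≠ 0) (ham : StronglyMeasurable a)
    (ha2 : MemLp a 2 volume) (hb : Integrable b) (hb2 : MemLp b 2 volume)
    (hab : ∀ p, ‖a p‖ ≤ b p.1) {M : ℝ} (hM : ∀ p, ‖a p‖ ≤ M)
    (hac : ∀ r, Continuous fun y => a (y, r)) :
    Tendsto (fun ε : ℝ => ∫ q, ‖a q - mehlerFiber ε a q‖ ^ 2) (𝓝[>] 0) (𝓝 0) := by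
  have hi : ∀ ε : ℝ, 0 < ε → Integrable (fun q => ‖a q - mehlerFiber ε a q‖ ^ 2)
      ((volume : Measure (EuclideanSpace ℝ (Fin n))).prod (volume : Measure ℝ)) := fun ε hε =>
    (ha2.sub (memLp_mehlerFiber hn (z := ε) (by simpa using hε) ham ha2 hb hb2
      hab).1).integrable_norm_pow two_ne_zero
  have h1 : Tendsto (fun ε : ℝ => ∫ r : ℝ, ∫ x, ‖a (x, r) - mehlerFiber ε a (x, r)‖ ^ 2)
      (𝓝[>] 0) (𝓝 (∫ _ : ℝ, (0 : ℝ))) := by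
    refine tendsto_integral_filter_of_dominated_convergence
      (fun r => 4 * ∫ x, ‖a (x, r)‖ ^ 2) ?_ ?_ ?_ ?_
    · filter_upwards [self_mem_nhdsWithin] with ε hε
      exact (hi ε hε).integral_prod_right.1
    · filter_upwards [self_mem_nhdsWithin] with ε hε
      refine .of_forall fun r => ?_
      rw [Real.norm_of_nonneg (integral_nonneg fun _ => by positivity)]
      exact integral_norm_sub_mehlerOp_sq_le' hn (ω := 2 * Real.pi * |r|) (by positivity) hε
        (integrable_section ham hb hab r) (memLp_section ham hb2 hab r)
    · have : Integrable (fun q => ‖a q‖ ^ 2)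
        ((volume : Measure (EuclideanSpace ℝ (Fin n))).prod (volume : Measure ℝ)) :=
        ha2.integrable_norm_pow two_ne_zero
      exact this.integral_prod_right.const_mul 4
    · have h0 : ∀ᵐ r : ℝ, r ≠ 0 := Measure.ae_ne volume 0
      filter_upwards [h0] with r hr
      exact tendsto_integral_norm_sub_mehlerOp_sq hn (ω := 2 * Real.pi * |r|) (by positivity)
        (hac r) (fun y => hM (y, r)) (integrable_section ham hb hab r)
        (memLp_section ham hb2 hab r)
  rw [integral_zero] at h1
  refine h1.congr' ?_
  filter_upwards [self_mem_nhdsWithin] with ε hε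
  rw [Measure.volume_eq_prod, integral_prod_symm _ (hi ε hε)]

/-- The weighted integrability of `v` is the right hypothesis here: a cut off `L²` function need not
be integrable in `x`, and the Gaussian decay of the Mehler kernel compensates. -/
lemma integrable_mul_mehlerWave {K κ : ℝ} (hvm : StronglyMeasurable v)
    (hv : ∀ κ : ℝ, 0 < κ → Integrable fun w : Space n => v w * Real.exp (-κ * ‖w.1‖ ^ 2))
    (hκ : 0 < κ) {p : Space n} (h : ∀ x, ‖mehler (2 * Real.pi * |p.2|) z p.1 x‖ ≤
      K * Real.exp (-(z.re * |p.2|)) * Real.exp (-κ * ‖x‖ ^ 2)) :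
    Integrable (fun w => v w * mehlerWave z p w) ∧ ‖∫ w, v w * mehlerWave z p w‖ ≤
      K * Real.exp (-(z.re * |p.2|)) * ∫ w : Space n, ‖v w * Real.exp (-κ * ‖w.1‖ ^ 2)‖ := by
  have hbd : ∀ w : Space n, ‖v w * mehlerWave z p w‖ ≤
      K * Real.exp (-(z.re * |p.2|)) * ‖v w * Real.exp (-κ * ‖w.1‖ ^ 2)‖ := by
    intro w
    rw [norm_mul, norm_mehlerWave, norm_mul, Complex.norm_real,
      Real.norm_of_nonneg (Real.exp_pos _).le]
    calc _ ≤ ‖v w‖ * (K * Real.exp (-(z.re * |p.2|)) * Real.exp (-κ * ‖w.1‖ ^ 2)) := by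
          gcongr; exact h w.1
      _ = _ := by ring
  have hint := (hv κ hκ).norm.const_mul (K * Real.exp (-(z.re * |p.2|)))
  refine ⟨hint.mono' (hvm.mul (((measurable_mehlerWave z).comp
    (by fun_prop : Measurable fun w : Space n => (p, w))).stronglyMeasurable)).aestronglyMeasurable
      (.of_forall hbd), ?_⟩
  rw [← integral_const_mul]
  exact norm_integral_le_of_norm_le hint (.of_forall hbd)

lemma ae_integrable_prodMk
    (hv : ∀ κ : ℝ, 0 < κ → Integrable fun w : Space n => v w * Real.exp (-κ * ‖w.1‖ ^ 2)) :
    ∀ᵐ x : EuclideanSpace ℝ (Fin n), Integrable (fun t => v (x, t)) := by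
  have h := hv 1 one_pos
  rw [Measure.volume_eq_prod] at h
  filter_upwards [h.prod_right_ae] with x hx
  have h0 : (Real.exp (-1 * ‖x‖ ^ 2) : ℂ) ≠ 0 := by exact_mod_cast (Real.exp_pos _).ne'
  have := hx.mul_const (Real.exp (-1 * ‖x‖ ^ 2) : ℂ)⁻¹
  simpa [mul_assoc, h0] using this

lemma integrable_mul_integral_mehlerWave (hn : n ≠ 0) (hz : 0 < z.re) (ham : StronglyMeasurable a)
    (hb : Integrable b) (hab : ∀ p, ‖a p‖ ≤ b p.1) (haR : ∀ p : Space n, R < ‖p.1‖ → a p = 0)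
    (hvm : StronglyMeasurable v)
    (hv : ∀ κ : ℝ, 0 < κ → Integrable fun w : Space n => v w * Real.exp (-κ * ‖w.1‖ ^ 2)) :
    Integrable (fun p : Space n => a p * ∫ w, v w * mehlerWave z p w)
      ((volume : Measure (EuclideanSpace ℝ (Fin n))).prod (volume : Measure ℝ)) := by
  obtain ⟨K, κ, hK, hκ, hbd⟩ := exists_norm_mehler_freq_le hn hz R
  have hb0 : ∀ y, 0 ≤ b y := fun y => (norm_nonneg _).trans (hab (y, 0))
  set D := ∫ w : Space n, ‖v w * Real.exp (-κ * ‖w.1‖ ^ 2)‖ with hD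
  have hD0 : 0 ≤ D := integral_nonneg fun _ => norm_nonneg _
  have hQ : StronglyMeasurable (fun p : Space n => ∫ w, v w * mehlerWave z p w) := by
    refine StronglyMeasurable.integral_prod_right' (f := fun q : Space n × Space n =>
      v q.2 * mehlerWave z q.1 q.2) ?_
    exact (hvm.comp_measurable measurable_snd).mul (measurable_mehlerWave z).stronglyMeasurable
  have hmaj := (hb.mul_prod (integrable_exp_neg_mul_abs hz)).mul_const (K * D)
  refine hmaj.mono' (ham.mul hQ).aestronglyMeasurable (.of_forall fun p => ?_)
  rcases le_or_gt ‖p.1‖ R with hp | hp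
  · rw [norm_mul]
    calc _ ≤ b p.1 * (K * Real.exp (-(z.re * |p.2|)) * D) := by
          gcongr
          · exact hb0 _
          · exact hab p
          · exact (integrable_mul_mehlerWave hvm hv hκ fun x => hbd p.2 p.1 x hp).2
      _ = _ := by ring
  · rw [haR p hp, zero_mul, norm_zero]
    have := hb0 p.1
    positivity

/-- Fubini: the Mehler operators may be moved from `v` to `a`. -/
lemma mehlerPairing_eq (hn : n ≠ 0) (hz : 0 < z.re) (ham : StronglyMeasurable a)
    (ha2 : MemLp a 2 volume) (hb : Integrable b) (hb2 : MemLp b 2 volume)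
    (hab : ∀ p, ‖a p‖ ≤ b p.1) (haR : ∀ p : Space n, R < ‖p.1‖ → a p = 0)
    (hvm : StronglyMeasurable v) (hv2 : MemLp v 2 volume)
    (hv : ∀ κ : ℝ, 0 < κ → Integrable fun w : Space n => v w * Real.exp (-κ * ‖w.1‖ ^ 2)) :
    mehlerPairing z a v = ∫ q, mehlerFiber z a q * partialFourier v q := by
  obtain ⟨K, κ, hK, hκ, hbd⟩ := exists_norm_mehler_freq_le hn hz R
  have hb0 : ∀ y, 0 ≤ b y := fun y => (norm_nonneg _).trans (hab (y, 0))
  have hI1 := integrable_mul_integral_mehlerWave hn hz ham hb hab haR hvm hv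
  have hvprod := hv κ hκ
  rw [Measure.volume_eq_prod] at hvprod
  have hV : Integrable (fun x : EuclideanSpace ℝ (Fin n) =>
      (∫ t, ‖v (x, t)‖) * Real.exp (-κ * ‖x‖ ^ 2)) := by
    have h1 := hvprod.norm.integral_prod_left
    refine h1.congr (.of_forall fun x => ?_)
    change ∫ t, ‖v (x, t) * Real.exp (-κ * ‖x‖ ^ 2)‖ =
      (∫ t, ‖v (x, t)‖) * Real.exp (-κ * ‖x‖ ^ 2)
    rw [← integral_mul_const]
    congr 1; ext t
    rw [norm_mul, Complex.norm_real, Real.norm_of_nonneg (Real.exp_pos _).le]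
  have hvhat := stronglyMeasurable_partialFourier hvm
  have hmm : ∀ r : ℝ, Measurable fun q : EuclideanSpace ℝ (Fin n) × EuclideanSpace ℝ (Fin n) =>
      mehler (2 * Real.pi * |r|) z q.1 q.2 := fun r =>
    (continuous_mehler _ z).measurable
  have hfib : ∀ r : ℝ, ∫ y, a (y, r) * ∫ w, v w * mehlerWave z (y, r) w =
      ∫ x, mehlerFiber z a (x, r) * partialFourier v (x, r) := by
    intro r
    have hI2 : Integrable (fun q : EuclideanSpace ℝ (Fin n) × EuclideanSpace ℝ (Fin n) =>
        a (q.1, r) * (mehler (2 * Real.pi * |r|) z q.1 q.2 * partialFourier v (q.2, r)))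
        (volume.prod volume) := by
      have hmaj := (hb.mul_prod hV).mul_const (K * Real.exp (-(z.re * |r|)))
      refine hmaj.mono' ((ham.comp_measurable (by fun_prop)).mul
        ((hmm r).stronglyMeasurable.mul (hvhat.comp_measurable (by fun_prop)))).aestronglyMeasurable
        (.of_forall fun q => ?_)
      rcases le_or_gt ‖q.1‖ R with hp | hp
      · rw [norm_mul, norm_mul]
        calc _ ≤ b q.1 * (K * Real.exp (-(z.re * |r|)) * Real.exp (-κ * ‖q.2‖ ^ 2) *
              ∫ t, ‖v (q.2, t)‖) := by
              gcongr
              · exact hb0 _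
              · exact hab (q.1, r)
              · exact hbd r q.1 q.2 hp
              · exact norm_partialFourier_le v (q.2, r)
          _ = _ := by ring
      · rw [haR (q.1, r) hp, zero_mul, norm_zero]
        have := hb0 q.1
        have h2 : 0 ≤ ∫ t, ‖v (q.2, t)‖ := integral_nonneg fun _ => norm_nonneg _
        positivity
    have hinner : ∀ y, a (y, r) * ∫ w, v w * mehlerWave z (y, r) w =
        ∫ x, a (y, r) * (mehler (2 * Real.pi * |r|) z y x * partialFourier v (x, r)) := by
      intro y
      rcases le_or_gt ‖y‖ R with hy | hy
      · rw [integral_const_mul]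
        congr 1
        have h3 := (integrable_mul_mehlerWave hvm hv hκ (p := (y, r))
          fun x => hbd r y x hy).1
        rw [Measure.volume_eq_prod] at h3 ⊢
        rw [integral_prod _ h3]
        congr 1; ext x
        rw [partialFourier_eq, ← integral_const_mul]
        congr 1; ext t
        rw [mehlerWave]; ring
      · rw [haR (y, r) hy]; simp
    simp only [hinner]
    rw [integral_integral_swap hI2]
    congr 1; ext x
    rw [mehlerFiber, mehlerOp, ← integral_mul_const]
    congr 1; ext y
    ring
  have hN := (memLp_mehlerFiber hn hz ham ha2 hb hb2 hab).1
  have hvs := ae_integrable_prodMk hv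
  have hvh : MemLp (partialFourier v) 2 volume := memLp_partialFourier hvm hvs hv2
  refine (integral_prod_symm _ hI1).trans (Eq.trans ?_
    (integral_prod_symm _ (by exact integrable_mul_of_memLp hN hvh)).symm)
  exact congrArg (fun g : ℝ → ℂ => ∫ r, g r) (funext hfib)

lemma norm_mehlerPairing_le (hn : n ≠ 0) (hz : 0 < z.re) (ham : StronglyMeasurable a)
    (ha2 : MemLp a 2 volume) (hb : Integrable b) (hb2 : MemLp b 2 volume)
    (hab : ∀ p, ‖a p‖ ≤ b p.1) (haR : ∀ p : Space n, R < ‖p.1‖ → a p = 0)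
    (hvm : StronglyMeasurable v) (hv2 : MemLp v 2 volume)
    (hv : ∀ κ : ℝ, 0 < κ → Integrable fun w : Space n => v w * Real.exp (-κ * ‖w.1‖ ^ 2)) :
    ‖mehlerPairing z a v‖ ≤ √(∫ w, ‖a w‖ ^ 2) * √(∫ w, ‖v w‖ ^ 2) := by
  obtain ⟨h1, h2⟩ := memLp_mehlerFiber hn hz ham ha2 hb hb2 hab
  have hvs := ae_integrable_prodMk hv
  have hvh : MemLp (partialFourier v) 2 volume := memLp_partialFourier hvm hvs hv2
  have h3 : ∫ w, ‖partialFourier v w‖ ^ 2 = ∫ w, ‖v w‖ ^ 2 :=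
    integral_norm_partialFourier_sq hvm hvs hv2
  rw [mehlerPairing_eq hn hz ham ha2 hb hb2 hab haR hvm hv2 hv]
  refine (norm_integral_mul_le h1 hvh).trans ?_
  rw [h3]
  gcongr

/-- By `mehlerPairing_eq` the regularisation acts on `a` alone, so its error is measured on the nice
test function and not on the solution. -/
lemma norm_integral_sub_mehlerPairing_le (hn : n ≠ 0) (hz : 0 < z.re) (ham : StronglyMeasurable a)
    (ha2 : MemLp a 2 volume) (hb : Integrable b) (hb2 : MemLp b 2 volume)
    (hab : ∀ p, ‖a p‖ ≤ b p.1) (haR : ∀ p : Space n, R < ‖p.1‖ → a p = 0)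
    (hvm : StronglyMeasurable v) (hv2 : MemLp v 2 volume)
    (hv : ∀ κ : ℝ, 0 < κ → Integrable fun w : Space n => v w * Real.exp (-κ * ‖w.1‖ ^ 2)) :
    ‖(∫ p, a p * partialFourier v p) - mehlerPairing z a v‖ ≤
      √(∫ w, ‖a w - mehlerFiber z a w‖ ^ 2) * √(∫ w, ‖v w‖ ^ 2) := by
  obtain ⟨h1, h2⟩ := memLp_mehlerFiber hn hz ham ha2 hb hb2 hab
  have hvs := ae_integrable_prodMk hv
  have hvh : MemLp (partialFourier v) 2 volume := memLp_partialFourier hvm hvs hv2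
  have h3 : ∫ w, ‖partialFourier v w‖ ^ 2 = ∫ w, ‖v w‖ ^ 2 :=
    integral_norm_partialFourier_sq hvm hvs hv2
  rw [mehlerPairing_eq hn hz ham ha2 hb hb2 hab haR hvm hv2 hv,
    ← integral_sub (by exact integrable_mul_of_memLp ha2 hvh)
      (by exact integrable_mul_of_memLp h1 hvh)]
  simp only [← sub_mul]
  refine (norm_integral_mul_le (by exact ha2.sub h1) hvh).trans ?_
  rw [h3]

end Pairing

/-! ### Test functions and the kernel bound for the pairing -/

section Dual

open Filter Topology

variable {n : ℕ}

lemma conj_partialFourier_eq (w : Space n → ℂ) (p : Space n) :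
    starRingEnd ℂ (partialFourier w p) =
      ∫ t, starRingEnd ℂ (w (p.1, t)) * Complex.exp (↑(2 * Real.pi * p.2 * t) * Complex.I) := by
  rw [partialFourier_eq, ← integral_conj]
  congr 1; ext t
  rw [map_mul, ← Complex.exp_conj, map_mul, Complex.conj_I, Complex.conj_ofReal, mul_comm]
  congr 2
  push_cast; ring

/-- Bounds for the partial Fourier transform of a compactly supported continuous function. -/
lemma exists_bounds_partialFourier {w : Space n → ℂ} (hw : Continuous w)
    (hwc : HasCompactSupport w) : ∃ (R M : ℝ) (b : EuclideanSpace ℝ (Fin n) → ℝ),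
      Integrable b ∧ MemLp b 2 volume ∧ Integrable (fun y => b y * (1 + ‖y‖ ^ 2)) ∧
      (∀ p, ‖starRingEnd ℂ (partialFourier w p)‖ ≤ b p.1) ∧
      (∀ p : Space n, R < ‖p.1‖ → starRingEnd ℂ (partialFourier w p) = 0) ∧
      (∀ p, ‖starRingEnd ℂ (partialFourier w p)‖ ≤ M) ∧
      ∀ r, Continuous fun y => starRingEnd ℂ (partialFourier w (y, r)) := by
  obtain ⟨R, hR⟩ := hwc.isCompact.isBounded.subset_closedBall (0 : Space n)
  obtain ⟨M₀, hM₀⟩ := hw.bounded_above_of_compact_support hwc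
  have hzero : ∀ p : Space n, R < ‖p.1‖ ∨ R < |p.2| → w p = 0 := by
    intro p hp
    by_contra h
    have := hR (subset_tsupport w (Function.mem_support.2 h))
    rw [mem_closedBall_zero_iff, Prod.norm_def] at this
    rcases hp with hp | hp
    · exact absurd ((le_max_left _ _).trans this) (not_le.2 hp)
    · exact absurd ((le_max_right _ _).trans this) (not_le.2 hp)
  have hM0 : 0 ≤ M₀ := (norm_nonneg _).trans (hM₀ 0)
  set g : ℝ → ℝ := (Metric.closedBall (0 : ℝ) R).indicator fun _ => M₀ with hg
  have hgi : Integrable g :=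
    (integrable_indicator_iff measurableSet_closedBall).2
      (integrableOn_const (measure_closedBall_lt_top.ne))
  have hg0 : ∀ t, 0 ≤ g t := fun t => Set.indicator_nonneg (fun _ _ => hM0) t
  have hwg : ∀ p : Space n, ‖w p‖ ≤ g p.2 := by
    intro p
    by_cases hp : p.2 ∈ Metric.closedBall (0 : ℝ) R
    · rw [hg, Set.indicator_of_mem hp]; exact hM₀ p
    · rw [hzero p (Or.inr (by simpa using hp)), norm_zero]; exact hg0 _
  set M := ∫ t, g t with hM
  have hMnn : 0 ≤ M := integral_nonneg hg0
  have hle : ∀ p, ‖starRingEnd ℂ (partialFourier w p)‖ ≤ M := by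
    intro p
    rw [RCLike.norm_conj]
    refine (norm_partialFourier_le w p).trans (integral_mono_of_nonneg
      (.of_forall fun _ => norm_nonneg _) hgi (.of_forall fun t => hwg (p.1, t)))
  have hz : ∀ p : Space n, R < ‖p.1‖ → starRingEnd ℂ (partialFourier w p) = 0 := by
    intro p hp
    have h0 : ∀ t, w (p.1, t) = 0 := fun t => hzero _ (Or.inl hp)
    simp [partialFourier_eq, h0]
  have hBm : MeasurableSet (Metric.closedBall (0 : EuclideanSpace ℝ (Fin n)) R) :=
    measurableSet_closedBall
  have hBf : volume (Metric.closedBall (0 : EuclideanSpace ℝ (Fin n)) R) ≠ ⊤ :=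
    measure_closedBall_lt_top.ne
  refine ⟨R, M, (Metric.closedBall 0 R).indicator fun _ => M,
    (integrable_indicator_iff hBm).2 (integrableOn_const hBf), ?_, ?_, ?_, hz, hle, ?_⟩
  · exact memLp_indicator_const 2 hBm M (Or.inr hBf)
  · have : (fun y : EuclideanSpace ℝ (Fin n) => (Metric.closedBall 0 R).indicator (fun _ => M) y *
        (1 + ‖y‖ ^ 2)) = (Metric.closedBall 0 R).indicator fun y => M * (1 + ‖y‖ ^ 2) := by
      ext y
      by_cases hy : y ∈ Metric.closedBall (0 : EuclideanSpace ℝ (Fin n)) R <;> simp [hy]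
    rw [this, integrable_indicator_iff hBm]
    exact ContinuousOn.integrableOn_compact (isCompact_closedBall _ _) (by fun_prop)
  · intro p
    by_cases hp : p.1 ∈ Metric.closedBall (0 : EuclideanSpace ℝ (Fin n)) R
    · rw [Set.indicator_of_mem hp]; exact hle p
    · rw [Set.indicator_of_notMem hp, hz p (by simpa using hp), norm_zero]
  · intro r
    simp only [conj_partialFourier_eq]
    refine continuous_of_dominated (bound := g) (fun y => ?_) (fun y => ?_) hgi ?_
    · exact Continuous.aestronglyMeasurable (by
        have := Complex.continuous_conj; fun_prop)
    · refine .of_forall fun t => ?_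
      rw [norm_mul, Complex.norm_exp_ofReal_mul_I, mul_one, RCLike.norm_conj]
      exact hwg (y, t)
    · exact .of_forall fun t => by have := Complex.continuous_conj; fun_prop

lemma integrable_mul_exp_of_integrable {v : Space n → ℂ} (hv : Integrable v) (κ : ℝ) (hκ : 0 < κ) :
    Integrable fun w : Space n => v w * Real.exp (-κ * ‖w.1‖ ^ 2) := by
  refine hv.mono (hv.1.mul (Continuous.aestronglyMeasurable (by fun_prop))) (.of_forall fun w => ?_)
  rw [norm_mul, Complex.norm_real, Real.norm_of_nonneg (Real.exp_pos _).le]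
  refine mul_le_of_le_one_right (norm_nonneg _) (Real.exp_le_one_iff.2 ?_)
  nlinarith [sq_nonneg ‖w.1‖]

section Kernel

variable {v w : Space n → ℂ} {z : ℂ}

/-- Fourier inversion of the frequency side: the characters in `t` and `q.2` combine to one in `t -
q.2`, which is where `grushinKernel` appears. -/
lemma integral_exp_mul_integral_mehlerWave (hn : n ≠ 0) (hz : 0 < z.re)
    (hvm : StronglyMeasurable v) (hv : Integrable v) (y : EuclideanSpace ℝ (Fin n)) (t : ℝ) :
    ∫ r : ℝ, Complex.exp (↑(2 * Real.pi * r * t) * Complex.I) * ∫ q, v q * mehlerWave z (y, r) q =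
      ∫ q : Space n, v q * grushinKernel z (t - q.2) y q.1 := by
  have hi : Integrable (fun p : ℝ × Space n => Complex.exp (↑(2 * Real.pi * p.1 * t) * Complex.I) *
      (v p.2 * mehlerWave z (y, p.1) p.2)) (volume.prod volume) := by
    refine (((integrable_exp_neg_mul_abs hz).mul_prod hv.norm).const_mul
      (√(4 / (Real.pi * z.re)) ^ n)).mono' ?_ (.of_forall fun p => ?_)
    · refine (Measurable.stronglyMeasurable (by fun_prop)).mul ((hvm.comp_measurable
        measurable_snd).mul ?_) |>.aestronglyMeasurable
      exact ((measurable_mehlerWave z).comp (by fun_prop :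
        Measurable fun p : ℝ × Space n => ((y, p.1), p.2))).stronglyMeasurable
    · rw [norm_mul, Complex.norm_exp_ofReal_mul_I, one_mul, norm_mul, norm_mehlerWave]
      calc _ ≤ ‖v p.2‖ * (√(4 / (Real.pi * z.re)) ^ n * Real.exp (-(z.re * |p.1|))) := by
            gcongr
            exact norm_mehler_freq_le hn hz le_rfl p.1 y p.2.1
        _ = _ := by ring
  simp only [← integral_const_mul]
  rw [integral_integral_swap hi]
  congr 1; ext q
  rw [grushinKernel, ← integral_const_mul]
  congr 1; ext r
  rw [mehlerWave, mul_left_comm]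
  congr 1
  rw [mul_left_comm, ← Complex.exp_add, mul_comm]
  congr 2
  push_cast; ring

lemma norm_integral_mehlerWave_le (hn : n ≠ 0) (hz : 0 < z.re) (hv : Integrable v)
    (p : Space n) : ‖∫ q, v q * mehlerWave z p q‖ ≤
      √(4 / (Real.pi * z.re)) ^ n * (∫ q, ‖v q‖) * Real.exp (-(z.re * |p.2|)) := by
  refine (norm_integral_le_of_norm_le (hv.norm.const_mul
    (√(4 / (Real.pi * z.re)) ^ n * Real.exp (-(z.re * |p.2|)))) (.of_forall fun q => ?_)).trans_eq ?_
  · rw [norm_mul, norm_mehlerWave, mul_comm]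
    gcongr
    exact norm_mehler_freq_le hn hz le_rfl p.2 p.1 q.1
  · rw [integral_const_mul]; ring

/-- The kernel bound for the pairing. -/
lemma norm_mehlerPairing_le_of_kernel (hn : n ≠ 0) (hz : 0 < z.re) (hw : Continuous w)
    (hwc : HasCompactSupport w) (hvm : StronglyMeasurable v) (hv : Integrable v) {B : ℝ}
    (hB : ∀ p, w p ≠ 0 → ∀ᵐ q : Space n, v q ≠ 0 → ‖grushinKernel z (p.2 - q.2) p.1 q.1‖ ≤ B) :
    ‖mehlerPairing z (fun p => starRingEnd ℂ (partialFourier w p)) v‖ ≤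
      B * (∫ q, ‖v q‖) * ∫ p, ‖w p‖ := by
  obtain ⟨R, M, b, hb, -, -, hab, haR, -, -⟩ := exists_bounds_partialFourier hw hwc
  have hpm : StronglyMeasurable (fun p : Space n => starRingEnd ℂ (partialFourier w p)) :=
    Complex.continuous_conj.comp_stronglyMeasurable
      (stronglyMeasurable_partialFourier hw.stronglyMeasurable)
  have hI := integrable_mul_integral_mehlerWave hn hz hpm hb hab haR hvm
    (integrable_mul_exp_of_integrable hv)
  have hwi : Integrable w := hw.integrable_of_hasCompactSupport hwc
  have hQ : StronglyMeasurable (fun p : Space n => ∫ q, v q * mehlerWave z p q) := by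
    refine StronglyMeasurable.integral_prod_right' (f := fun q : Space n × Space n =>
      v q.2 * mehlerWave z q.1 q.2) ?_
    exact (hvm.comp_measurable measurable_snd).mul (measurable_mehlerWave z).stronglyMeasurable
  have hsec : ∀ y, Integrable (fun t => w (y, t)) := by
    intro y
    refine Continuous.integrable_of_hasCompactSupport (by fun_prop) ?_
    refine HasCompactSupport.intro (hwc.isCompact.image continuous_snd) fun t ht => ?_
    by_contra h
    exact ht ⟨(y, t), subset_tsupport w h, rfl⟩
  have hfib : ∀ y, ‖∫ r, starRingEnd ℂ (partialFourier w (y, r)) *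
      ∫ q, v q * mehlerWave z (y, r) q‖ ≤ B * (∫ q, ‖v q‖) * ∫ t, ‖w (y, t)‖ := by
    intro y
    have hi : Integrable (fun p : ℝ × ℝ => starRingEnd ℂ (w (y, p.2)) *
        (Complex.exp (↑(2 * Real.pi * p.1 * p.2) * Complex.I) *
          ∫ q, v q * mehlerWave z (y, p.1) q)) (volume.prod volume) := by
      refine (((integrable_exp_neg_mul_abs hz).mul_prod (hsec y).norm).const_mul
        (√(4 / (Real.pi * z.re)) ^ n * (∫ q, ‖v q‖))).mono' ?_ (.of_forall fun p => ?_)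
      · refine StronglyMeasurable.aestronglyMeasurable (StronglyMeasurable.mul
          (Continuous.stronglyMeasurable (by have := Complex.continuous_conj; fun_prop))
          (StronglyMeasurable.mul (Measurable.stronglyMeasurable (by fun_prop))
          (hQ.comp_measurable (by fun_prop))))
      · rw [norm_mul, norm_mul, Complex.norm_exp_ofReal_mul_I, one_mul, RCLike.norm_conj]
        calc _ ≤ ‖w (y, p.2)‖ * (√(4 / (Real.pi * z.re)) ^ n * (∫ q, ‖v q‖) *
              Real.exp (-(z.re * |p.1|))) := by
              gcongr
              exact norm_integral_mehlerWave_le hn hz hv (y, p.1)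
          _ = _ := by ring
    -- Undo the Fourier transform of `w` by Fubini, legitimate because the inner integral decays
    -- exponentially in `r`. The kernel bound then applies pointwise on the supports of `w` and `v`.
    have h1 : ∫ r, starRingEnd ℂ (partialFourier w (y, r)) * ∫ q, v q * mehlerWave z (y, r) q =
        ∫ t, starRingEnd ℂ (w (y, t)) * ∫ q : Space n, v q * grushinKernel z (t - q.2) y q.1 := by
      simp only [conj_partialFourier_eq, ← integral_mul_const,
        mul_assoc (starRingEnd ℂ (w (y, _)))]
      rw [integral_integral_swap hi]
      congr 1; ext t
      rw [integral_const_mul, integral_exp_mul_integral_mehlerWave hn hz hvm hv]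
    rw [h1, ← integral_const_mul]
    refine norm_integral_le_of_norm_le ((hsec y).norm.const_mul _) (.of_forall fun t => ?_)
    rw [norm_mul, RCLike.norm_conj, mul_comm]
    rcases eq_or_ne (w (y, t)) 0 with h0 | h0
    · simp [h0]
    gcongr
    rw [← integral_const_mul]
    refine norm_integral_le_of_norm_le (hv.norm.const_mul _) ?_
    filter_upwards [hB (y, t) h0] with q hq
    rcases eq_or_ne (v q) 0 with h2 | h2
    · simp [h2]
    rw [norm_mul, mul_comm]
    gcongr
    exact hq h2
  have hprod : ∫ p, ‖w p‖ = ∫ y, ∫ t, ‖w (y, t)‖ := by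
    rw [Measure.volume_eq_prod]; exact integral_prod _ hwi.norm
  have hwn : Integrable (fun y => ∫ t, ‖w (y, t)‖) := by
    have := hwi.norm
    rw [Measure.volume_eq_prod] at this
    exact this.integral_prod_left
  rw [hprod, ← integral_const_mul]
  refine (congrArg norm (integral_prod _ hI)).trans_le ?_
  exact norm_integral_le_of_norm_le (hwn.const_mul _) (.of_forall hfib)

end Kernel

end Dual

/-! ### Passage from the regularised pairing to the solution -/

section Duality

open Filter Topology

variable {n : ℕ}

/-- Gaussian cut off in the `t` variable. -/
noncomputable def cutoff (h : ℝ) (v : Space n → ℂ) (w : Space n) : ℂ :=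
  v w * Real.exp (-(h * w.2 ^ 2))

variable {v : Space n → ℂ} {h : ℝ}

lemma stronglyMeasurable_cutoff (hv : StronglyMeasurable v) (h : ℝ) :
    StronglyMeasurable (cutoff h v) :=
  hv.mul (Continuous.stronglyMeasurable (by fun_prop))

lemma norm_cutoff_le (hh : 0 ≤ h) (v : Space n → ℂ) (w : Space n) : ‖cutoff h v w‖ ≤ ‖v w‖ := by
  rw [cutoff, norm_mul, Complex.norm_real, Real.norm_of_nonneg (Real.exp_pos _).le]
  refine mul_le_of_le_one_right (norm_nonneg _) (Real.exp_le_one_iff.2 ?_)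
  nlinarith [mul_nonneg hh (sq_nonneg w.2)]

lemma memLp_cutoff (hh : 0 ≤ h) (hvm : StronglyMeasurable v) (hv : MemLp v 2 volume) :
    MemLp (cutoff h v) 2 volume ∧ ∫ w, ‖cutoff h v w‖ ^ 2 ≤ ∫ w, ‖v w‖ ^ 2 := by
  have h1 : MemLp (cutoff h v) 2 volume :=
    hv.mono (stronglyMeasurable_cutoff hvm h).aestronglyMeasurable
      (.of_forall (norm_cutoff_le hh v))
  refine ⟨h1, integral_mono (h1.integrable_norm_pow two_ne_zero)
    (hv.integrable_norm_pow two_ne_zero) fun w => ?_⟩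
  exact pow_le_pow_left₀ (norm_nonneg _) (norm_cutoff_le hh v w) 2

/-- Product of an `L²` function with an anisotropic Gaussian in `L²`. -/
lemma integrable_cutoff_mul_exp (hh : 0 < h) (hv : MemLp v 2 volume) (κ : ℝ) (hκ : 0 < κ) :
    Integrable fun w : Space n => cutoff h v w * Real.exp (-κ * ‖w.1‖ ^ 2) := by
  have h1 : MemLp (fun w => (gaussMaj κ h 0 w : ℂ)) 2 (volume : Measure (Space n)) :=
    (memLp_gaussMaj hκ hh 0).ofReal
  refine (integrable_mul_of_memLp hv h1).congr (.of_forall fun w => ?_)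
  simp only [cutoff, gaussMaj, sub_zero, Complex.ofReal_mul, neg_mul]
  ring

/-- The cutoff may be read as acting on `v` or on the test function. The sign in `κ = -2π r` matches
the Fourier convention. -/
lemma integral_cutoff_mul_mehlerWave (h : ℝ) (v : Space n → ℂ) (z : ℂ) (p : Space n) :
    ∫ w, cutoff h v w * mehlerWave z p w =
      ∫ w, v w * mehlerTest (-(2 * Real.pi * p.2)) h z p.1 w := by
  congr 1; ext w
  have h1 : |-(2 * Real.pi * p.2)| = 2 * Real.pi * |p.2| := by
    rw [abs_neg, abs_mul, abs_of_pos (by positivity)]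
  have h2 : Complex.exp (((-(2 * Real.pi * p.2) : ℝ) : ℂ) * Complex.I * w.2 - h * w.2 ^ 2) =
      (Real.exp (-(h * w.2 ^ 2)) : ℂ) *
        Complex.exp (↑(-(2 * Real.pi * p.2 * w.2)) * Complex.I) := by
    rw [Complex.ofReal_exp, ← Complex.exp_add]
    congr 1; push_cast; ring
  rw [cutoff, mehlerWave, mehlerTest, h1, h2]
  ring

lemma one_add_mul_exp_le {c x : ℝ} (hc : 0 < c) (hx : 0 ≤ x) :
    (1 + x) * Real.exp (-(c * x)) ≤ (1 + 2 / c) * Real.exp (-(c / 2 * x)) := by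
  have h1 := Real.add_one_le_exp (c / 2 * x)
  have h2 : Real.exp (-(c / 2 * x)) * Real.exp (c / 2 * x) = 1 := by
    rw [← Real.exp_add]; simp
  have h3 : Real.exp (-(c * x)) = Real.exp (-(c / 2 * x)) * Real.exp (-(c / 2 * x)) := by
    rw [← Real.exp_add]; congr 1; ring
  set e := Real.exp (-(c / 2 * x)) with he
  have he0 : 0 < e := Real.exp_pos _
  have he1 : e ≤ 1 := Real.exp_le_one_iff.2 (by nlinarith [mul_nonneg hc.le hx])
  have h4 : (c / 2 * x + 1) * e ≤ 1 := by nlinarith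
  have h5 : x * e ≤ 2 / c := by
    rw [le_div_iff₀ hc]; nlinarith
  rw [h3]
  nlinarith [mul_le_mul_of_nonneg_right h5 he0.le, mul_le_mul_of_nonneg_right he1 he0.le]

variable {f : Lp ℂ 2 (volume : Measure (Space n))}
  {u : ℝ → Lp ℂ 2 (volume : Measure (Space n))}

/-- Integrates `exists_norm_pairing_sub_le` against `a` over all frequencies and base points; the
weights `(1 + |κ|) exp (-7ε|κ|/8)` and `1 + ‖y‖²` are integrable against the majorant of `a`. -/
lemma IsSolution.exists_norm_mehlerPairing_sub_le (hu : IsSolution f u) (hn : n ≠ 0) {ε : ℝ}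
    (hε : 0 < ε) (s : ℝ) {a : Space n → ℂ} {b : EuclideanSpace ℝ (Fin n) → ℝ} {R : ℝ}
    (ham : StronglyMeasurable a) (hb : Integrable b)
    (hb' : Integrable fun y => b y * (1 + ‖y‖ ^ 2))
    (hab : ∀ p, ‖a p‖ ≤ b p.1) (haR : ∀ p : Space n, R < ‖p.1‖ → a p = 0) :
    ∃ C, 0 ≤ C ∧ ∀ h : ℝ, 0 < h → h ≤ 1 →
      ‖mehlerPairing ε a (cutoff h (u s)) - mehlerPairing (ε + s * Complex.I) a (cutoff h f)‖ ≤
        C * √(√h) := by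
  obtain ⟨C, hC, hbd⟩ := hu.exists_norm_pairing_sub_le hn hε s
  have hb0 : ∀ y, 0 ≤ b y := fun y => (norm_nonneg _).trans (hab (y, 0))
  set c : ℝ := 7 / 8 * ε with hc
  have hc0 : 0 < c := by positivity
  set m : Space n → ℝ := fun p => b p.1 * (1 + ‖p.1‖ ^ 2) *
    ((1 + 2 / c) * Real.exp (-(c / 2 * (2 * Real.pi) * |p.2|))) with hm
  have hmi : Integrable m := by
    rw [Measure.volume_eq_prod]
    exact hb'.mul_prod ((integrable_exp_neg_mul_abs
      (c := c / 2 * (2 * Real.pi)) (by positivity)).const_mul _)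
  have hm0 : ∀ p, 0 ≤ m p := fun p => by have := hb0 p.1; positivity
  refine ⟨C * ∫ p, m p, mul_nonneg hC (integral_nonneg hm0), fun h hh hh1 => ?_⟩
  have hi1 := integrable_mul_integral_mehlerWave hn (z := ε) (by simpa using hε) ham hb hab haR
    (stronglyMeasurable_cutoff (Lp.stronglyMeasurable (u s)) h)
    (integrable_cutoff_mul_exp hh (Lp.memLp (u s)))
  have hi2 := integrable_mul_integral_mehlerWave hn (z := ε + s * Complex.I)
    (by simpa using hε) ham hb hab haR
    (stronglyMeasurable_cutoff (Lp.stronglyMeasurable f) h)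
    (integrable_cutoff_mul_exp hh (Lp.memLp f))
  rw [mehlerPairing, mehlerPairing, ← integral_sub (by exact hi1) (by exact hi2)]
  have hmaj : ∀ p : Space n, ‖a p * (∫ w, cutoff h (u s) w * mehlerWave ε p w) -
      a p * ∫ w, cutoff h f w * mehlerWave (ε + s * Complex.I) p w‖ ≤ C * √(√h) * m p := by
    intro p
    rw [← mul_sub, norm_mul, integral_cutoff_mul_mehlerWave, integral_cutoff_mul_mehlerWave]
    have h1 : |-(2 * Real.pi * p.2)| = 2 * Real.pi * |p.2| := by
      rw [abs_neg, abs_mul, abs_of_pos (by positivity)]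
    have h2 := hbd h hh hh1 (-(2 * Real.pi * p.2)) p.1
    rw [h1] at h2
    have h3 := one_add_mul_exp_le hc0 (x := 2 * Real.pi * |p.2|) (by positivity)
    calc _ ≤ b p.1 * (C * √(√h) * ((1 + 2 * Real.pi * |p.2|) *
          Real.exp (-(c * (2 * Real.pi * |p.2|))) * (1 + ‖p.1‖ ^ 2))) :=
          mul_le_mul (hab p) h2 (norm_nonneg _) (hb0 _)
      _ ≤ b p.1 * (C * √(√h) * ((1 + 2 / c) *
          Real.exp (-(c / 2 * (2 * Real.pi * |p.2|))) * (1 + ‖p.1‖ ^ 2))) := by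
          have := hb0 p.1
          gcongr
      _ = _ := by rw [hm]; ring_nf
  refine (norm_integral_le_of_norm_le (hmi.const_mul _) (.of_forall hmaj)).trans_eq ?_
  rw [integral_const_mul]; ring

/-- Duality principle: bounds on the regularised pairings pass to the solution. -/
theorem IsSolution.norm_integral_conj_mul_le (hu : IsSolution f u) (hn : n ≠ 0) (s : ℝ)
    {w : Space n → ℂ} (hw : Continuous w) (hwc : HasCompactSupport w) {B : ℝ}
    (hB : ∀ ε h : ℝ, 0 < ε → 0 < h → ‖mehlerPairing (ε + s * Complex.I)
      (fun p => starRingEnd ℂ (partialFourier w p)) (cutoff h f)‖ ≤ B) :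
    ‖∫ p, starRingEnd ℂ (w p) * u s p‖ ≤ B := by
  obtain ⟨R, M, b, hb, hb2, hb', hab, haR, hM, hac⟩ := exists_bounds_partialFourier hw hwc
  set a : Space n → ℂ := fun p => starRingEnd ℂ (partialFourier w p) with ha
  have ham : StronglyMeasurable a :=
    Complex.continuous_conj.comp_stronglyMeasurable
      (stronglyMeasurable_partialFourier hw.stronglyMeasurable)
  have hwi : Integrable w ((volume : Measure (EuclideanSpace ℝ (Fin n))).prod volume) :=
    hw.integrable_of_hasCompactSupport hwc
  have hws : ∀ᵐ x : EuclideanSpace ℝ (Fin n), Integrable (fun t => w (x, t)) := hwi.prod_right_ae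
  have hw2 : MemLp w 2 volume := hw.memLp_of_hasCompactSupport hwc
  have ha2 : MemLp a 2 volume :=
    (memLp_partialFourier hw.stronglyMeasurable hws hw2).star
  have hum := Lp.stronglyMeasurable (u s)
  have hu2 := Lp.memLp (u s)
  have hlim1 : Tendsto (fun h : ℝ => ‖∫ p, starRingEnd ℂ (w p) * cutoff h (u s) p‖) (𝓝[>] 0)
      (𝓝 ‖∫ p, starRingEnd ℂ (w p) * u s p‖) := by
    refine (tendsto_integral_filter_of_dominated_convergence (fun p => ‖w p‖ * ‖u s p‖)
      (.of_forall fun h => ?_) ?_ (hw2.norm.integrable_mul hu2.norm)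
      (.of_forall fun p => ?_)).norm
    · exact ((Complex.continuous_conj.comp hw).stronglyMeasurable.mul
        (stronglyMeasurable_cutoff hum h)).aestronglyMeasurable
    · filter_upwards [self_mem_nhdsWithin] with h hh
      refine .of_forall fun p => ?_
      rw [norm_mul, RCLike.norm_conj]
      gcongr
      exact norm_cutoff_le (le_of_lt hh) _ _
    · refine Tendsto.const_mul _ (tendsto_nhdsWithin_of_tendsto_nhds ?_)
      have : Continuous fun h : ℝ => cutoff h (u s) p := by unfold cutoff; fun_prop
      have h0 := this.tendsto 0
      simpa [cutoff] using h0
  -- The constant `C` of the evolution error depends on `ε`, so `h → 0` is taken first with `ε`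
  -- fixed.
  have key : ∀ ε : ℝ, 0 < ε → ‖∫ p, starRingEnd ℂ (w p) * u s p‖ ≤
      √(∫ q, ‖a q - mehlerFiber ε a q‖ ^ 2) * √(∫ q, ‖u s q‖ ^ 2) + B := by
    intro ε hε
    obtain ⟨C, hC, hbd⟩ := hu.exists_norm_mehlerPairing_sub_le hn hε s ham hb hb' hab haR
    have hlim2 : Tendsto (fun h : ℝ => √(∫ q, ‖a q - mehlerFiber ε a q‖ ^ 2) *
        √(∫ q, ‖u s q‖ ^ 2) + B + C * √(√h)) (𝓝[>] 0)
        (𝓝 (√(∫ q, ‖a q - mehlerFiber ε a q‖ ^ 2) * √(∫ q, ‖u s q‖ ^ 2) + B)) := by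
      refine tendsto_nhdsWithin_of_tendsto_nhds ?_
      have : Continuous fun h : ℝ => √(∫ q, ‖a q - mehlerFiber ε a q‖ ^ 2) *
        √(∫ q, ‖u s q‖ ^ 2) + B + C * √(√h) := by fun_prop
      simpa using this.tendsto 0
    refine le_of_tendsto_of_tendsto hlim1 hlim2 ?_
    filter_upwards [Ioc_mem_nhdsGT (zero_lt_one' ℝ)] with h hh
    obtain ⟨hv2, hvle⟩ := memLp_cutoff hh.1.le hum hu2
    have hvm := stronglyMeasurable_cutoff hum h
    have hvk := integrable_cutoff_mul_exp hh.1 hu2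
    have hP : ∫ p, starRingEnd ℂ (w p) * cutoff h (u s) p =
        ∫ p, a p * partialFourier (cutoff h (u s)) p :=
      (integral_conj_partialFourier_mul hvm (ae_integrable_prodMk hvk) hv2
        hw.stronglyMeasurable hws hw2).symm
    have h1 := norm_integral_sub_mehlerPairing_le hn (z := ε) (by simpa using hε) ham ha2 hb hb2
      hab haR hvm hv2 hvk
    have h2 := hbd h hh.1 hh.2
    have h3 := hB ε h hε hh.1
    have h4 : √(∫ q, ‖a q - mehlerFiber ε a q‖ ^ 2) * √(∫ w, ‖cutoff h (u s) w‖ ^ 2) ≤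
        √(∫ q, ‖a q - mehlerFiber ε a q‖ ^ 2) * √(∫ q, ‖u s q‖ ^ 2) := by gcongr
    rw [hP]
    set X := ∫ p, a p * partialFourier (cutoff h (u s)) p
    set Y := mehlerPairing ε a (cutoff h (u s))
    set Z := mehlerPairing (ε + s * Complex.I) a (cutoff h f)
    -- The three errors: regularisation by `ε`, evolution from time `0` to `s` with cutoff `h`, and
    -- the assumed bound on the data.
    have h5 : ‖X‖ ≤ ‖X - Y‖ + ‖Y - Z‖ + ‖Z‖ := by
      calc ‖X‖ = ‖(X - Y) + (Y - Z) + Z‖ := by congr 1; ring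
        _ ≤ _ := norm_add₃_le
    linarith
  have hlim3 : Tendsto (fun ε : ℝ => √(∫ q, ‖a q - mehlerFiber ε a q‖ ^ 2) *
      √(∫ q, ‖u s q‖ ^ 2) + B) (𝓝[>] 0) (𝓝 B) := by
    have h1 := tendsto_integral_norm_sub_mehlerFiber_sq hn ham ha2 hb hb2 hab hM hac
    have h2 := ((Real.continuous_sqrt.tendsto 0).comp h1).mul_const (√(∫ q, ‖u s q‖ ^ 2))
    simpa using h2.add_const B
  refine ge_of_tendsto hlim3 ?_
  filter_upwards [self_mem_nhdsWithin] with ε hε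
  exact key ε hε

end Duality

/-! ### `L²` and dispersive bounds for solutions -/

section Consequences

open Filter Topology

variable {n : ℕ}

/-- A function whose pairings with test functions supported in an open set are controlled by
their `L¹` norm is bounded there. -/
lemma ae_norm_le_of_forall_integral_le {g : Space n → ℂ} (hg : LocallyIntegrable g)
    {Ω : Set (Space n)} (hΩ : IsOpen Ω) {B : ℝ}
    (h : ∀ w : Space n → ℂ, Continuous w → HasCompactSupport w → (∀ p, w p ≠ 0 → p ∈ Ω) →
      ‖∫ p, starRingEnd ℂ (w p) * g p‖ ≤ B * ∫ p, ‖w p‖) :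
    ∀ᵐ p, p ∈ Ω → ‖g p‖ ≤ B := by
  -- Mollifiers with shrinking support and fixed ratio of radii, so that convolutions converge
  -- almost everywhere. Each has `L¹` norm 1 and, once small, is an admissible test function.
  let φ : ℕ → ContDiffBump (0 : Space n) := fun i =>
    ⟨1 / (i + 1), 2 / (i + 1), by positivity, by gcongr; norm_num⟩
  have hφ : Tendsto (fun i => (φ i).rOut) atTop (𝓝 0) :=
    tendsto_const_nhds.div_atTop (tendsto_atTop_add_const_right _ _ tendsto_natCast_atTop_atTop)
  have hK : ∀ᶠ i in atTop, (φ i).rOut ≤ 2 * (φ i).rIn := .of_forall fun i => by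
    change (2 : ℝ) / (i + 1) ≤ 2 * (1 / (i + 1))
    rw [mul_one_div]
  filter_upwards [ContDiffBump.ae_convolution_tendsto_right_of_locallyIntegrable
    (μ := (volume : Measure (Space n))) hφ hK hg] with x hx hxΩ
  refine le_of_tendsto hx.norm ?_
  obtain ⟨δ, hδ, hball⟩ := Metric.isOpen_iff.1 hΩ x hxΩ
  filter_upwards [hφ (gt_mem_nhds hδ)] with i hi
  set ψ := (φ i).normed (volume : Measure (Space n)) with hψ
  set w : Space n → ℂ := fun p => (ψ (x - p) : ℂ) with hw
  have hψ0 : ∀ p, 0 ≤ ψ p := (φ i).nonneg_normed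
  have hψc : Continuous ψ := (φ i).continuous_normed
  have hsupp : ∀ p, w p ≠ 0 → p ∈ Metric.closedBall x (φ i).rOut ∧ p ∈ Ω := by
    intro p hp
    have h1 : x - p ∈ Function.support ψ := by
      intro h0; exact hp (by rw [hw]; simp [h0])
    rw [hψ, ContDiffBump.support_normed_eq, mem_ball_zero_iff, ← dist_eq_norm, dist_comm] at h1
    exact ⟨Metric.mem_closedBall.2 h1.le, hball (Metric.mem_ball.2 (h1.trans hi))⟩
  have hconv := h w (by fun_prop) (HasCompactSupport.intro (isCompact_closedBall x (φ i).rOut)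
    fun p hp => by_contra fun h0 => hp (hsupp p h0).1) fun p hp => (hsupp p hp).2
  have h1 : ∫ p, ‖w p‖ = 1 := by
    have : ∀ p, ‖w p‖ = ψ (x - p) := fun p => by
      rw [hw, Complex.norm_real, Real.norm_of_nonneg (hψ0 _)]
    simp only [this]
    rw [integral_sub_left_eq_self ψ volume x]
    exact (φ i).integral_normed
  rw [h1, mul_one] at hconv
  refine le_trans (le_of_eq ?_) hconv
  rw [convolution_eq_swap]
  congr 2; ext p
  rw [hw]
  simp only [ContinuousLinearMap.lsmul_apply, Complex.conj_ofReal, Complex.real_smul]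

/-- An element of `L²` is bounded by its pairings with compactly supported continuous functions. -/
lemma norm_le_of_forall_integral_le {g : Lp ℂ 2 (volume : Measure (Space n))} {B : ℝ}
    (hB : 0 ≤ B) (h : ∀ w : Space n → ℂ, Continuous w → HasCompactSupport w →
      ‖∫ p, starRingEnd ℂ (w p) * g p‖ ≤ √(∫ p, ‖w p‖ ^ 2) * B) : ‖g‖ ≤ B := by
  have key : ∀ w : Lp ℂ 2 (volume : Measure (Space n)), ‖(inner ℂ w g : ℂ)‖ ≤ ‖w‖ * B := by
    intro w
    have hcl : IsClosed {w : Lp ℂ 2 (volume : Measure (Space n)) |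
        ‖(inner ℂ w g : ℂ)‖ ≤ ‖w‖ * B} :=
      isClosed_le (by fun_prop) (by fun_prop)
    refine hcl.closure_subset (Metric.mem_closure_iff.2 fun ε hε => ?_)
    obtain ⟨w', hc, hle, hcont, hmem⟩ := (Lp.memLp w).exists_hasCompactSupport_eLpNorm_sub_le
      (by norm_num) (ε := ENNReal.ofReal (ε / 2)) (by simpa using hε)
    refine ⟨hmem.toLp w', ?_, ?_⟩
    · have h1 := h w' hcont hc
      have h2 : ‖hmem.toLp w'‖ = √(∫ p, ‖w' p‖ ^ 2) := by
        rw [norm_Lp_eq_sqrt]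
        congr 1
        refine integral_congr_ae ?_
        filter_upwards [hmem.coeFn_toLp] with p hp
        rw [hp]
      rw [Set.mem_ofPred_eq, h2]
      refine le_of_eq_of_le ?_ h1
      rw [L2.inner_def]
      congr 1
      refine integral_congr_ae ?_
      filter_upwards [hmem.coeFn_toLp] with p hp
      rw [hp, RCLike.inner_apply, mul_comm]
    · rw [dist_eq_norm, Lp.norm_def]
      have h3 : eLpNorm (w - hmem.toLp w' : Lp ℂ 2 (volume : Measure (Space n))) 2 volume =
          eLpNorm (⇑w - w') 2 volume := by
        refine eLpNorm_congr_ae ?_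
        filter_upwards [Lp.coeFn_sub w (hmem.toLp w'), hmem.coeFn_toLp] with p h4 h5
        rw [h4, Pi.sub_apply, Pi.sub_apply, h5]
      rw [h3]
      refine lt_of_le_of_lt (ENNReal.toReal_le_of_le_ofReal (by positivity) hle) (by linarith)
  -- By density the bound holds against every `L²` function; testing against `g` itself gives `‖g‖²
  -- ≤ ‖g‖ B`.
  have h1 := key g
  rw [inner_self_eq_norm_sq_to_K] at h1
  have h2 : ‖(((‖g‖ : ℝ) : ℂ) ^ 2)‖ = ‖g‖ ^ 2 := by simp
  have h3 : ‖g‖ ^ 2 ≤ ‖g‖ * B := h2 ▸ h1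
  rcases (norm_nonneg g).eq_or_lt with h0 | h0
  · rwa [← h0]
  · nlinarith

variable {f : Lp ℂ 2 (volume : Measure (Space n))}
  {u : ℝ → Lp ℂ 2 (volume : Measure (Space n))}

/-- The `L²` bound for solutions. -/
theorem IsSolution.norm_le (hu : IsSolution f u) (hn : n ≠ 0) (s : ℝ) : ‖u s‖ ≤ ‖f‖ := by
  refine norm_le_of_forall_integral_le (norm_nonneg f) fun w hw hwc => ?_
  refine hu.norm_integral_conj_mul_le hn s hw hwc fun ε h hε hh => ?_
  obtain ⟨R, M, b, hb, hb2, -, hab, haR, -, -⟩ := exists_bounds_partialFourier hw hwc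
  have hwi : Integrable w ((volume : Measure (EuclideanSpace ℝ (Fin n))).prod volume) :=
    hw.integrable_of_hasCompactSupport hwc
  have hws : ∀ᵐ x : EuclideanSpace ℝ (Fin n), Integrable (fun t => w (x, t)) := hwi.prod_right_ae
  have hw2 : MemLp w 2 volume := hw.memLp_of_hasCompactSupport hwc
  have ha2 : MemLp (fun p => starRingEnd ℂ (partialFourier w p)) 2 volume :=
    (memLp_partialFourier hw.stronglyMeasurable hws hw2).star
  have hfm := Lp.stronglyMeasurable f
  obtain ⟨hv2, hvle⟩ := memLp_cutoff hh.le hfm (Lp.memLp f)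
  have h1 := norm_mehlerPairing_le hn (z := ε + s * Complex.I) (by simpa using hε)
    (Complex.continuous_conj.comp_stronglyMeasurable
      (stronglyMeasurable_partialFourier hw.stronglyMeasurable)) ha2 hb hb2 hab haR
    (stronglyMeasurable_cutoff hfm h) hv2 (integrable_cutoff_mul_exp hh (Lp.memLp f))
  have h2 : ∫ p, ‖starRingEnd ℂ (partialFourier w p)‖ ^ 2 = ∫ p, ‖w p‖ ^ 2 := by
    simp only [RCLike.norm_conj]
    exact integral_norm_partialFourier_sq hw.stronglyMeasurable hws hw2
  rw [h2] at h1
  refine h1.trans ?_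
  rw [norm_Lp_eq_sqrt f]
  gcongr

lemma isOpen_ball (w₀ : Space n) (r : ℝ) : IsOpen (ball w₀ r) :=
  isOpen_lt (by fun_prop) continuous_const

lemma norm_fst_sub_le_of_mem_ball {w₀ w : Space n} {r : ℝ} (h : w ∈ ball w₀ r) :
    ‖w.1 - w₀.1‖ < r :=
  lt_of_le_of_lt (Real.le_sqrt_of_sq_le (le_add_of_nonneg_right (sq_nonneg _))) h

lemma abs_snd_sub_lt_of_mem_ball {w₀ w : Space n} {r : ℝ} (h : w ∈ ball w₀ r) :
    |w.2 - w₀.2| < r :=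
  lt_of_le_of_lt (Real.le_sqrt_of_sq_le (by
    rw [sq_abs]; exact le_add_of_nonneg_left (sq_nonneg _))) h

lemma ball_subset_metricBall (w₀ : Space n) (r : ℝ) : ball w₀ r ⊆ Metric.ball w₀ r := by
  intro w hw
  rw [Metric.mem_ball, Prod.dist_eq, max_lt_iff, dist_eq_norm, Real.dist_eq]
  exact ⟨norm_fst_sub_le_of_mem_ball hw, abs_snd_sub_lt_of_mem_ball hw⟩

lemma ball_eq_empty (w₀ : Space n) {r : ℝ} (hr : r ≤ 0) : ball w₀ r = ∅ :=
  Set.eq_empty_of_forall_notMem fun _ hw =>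
    absurd hw (not_lt.2 (hr.trans (Real.sqrt_nonneg _)))

lemma measureReal_ball_le (w₀ : Space n) {r : ℝ} (hr : 0 ≤ r) :
    volume.real (ball w₀ r) ≤ r ^ (n + 1) * volume.real (Metric.ball (0 : Space n) 1) := by
  have h1 : Module.finrank ℝ (Space n) = n + 1 := by simp
  have h2 := Measure.addHaar_ball (volume : Measure (Space n)) w₀ hr
  rw [h1] at h2
  refine (measureReal_mono (ball_subset_metricBall w₀ r) measure_ball_lt_top.ne).trans_eq ?_
  rw [Measure.real, h2, ENNReal.toReal_mul, ENNReal.toReal_ofReal (by positivity), Measure.real]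

/-- A square integrable function supported in a ball is integrable. -/
lemma integrable_of_ae_eq_zero_off_ball {w₀ : Space n} {r : ℝ} (hr : 0 ≤ r)
    (hf : ∀ᵐ w : Space n, w ∉ ball w₀ r → f w = 0) :
    Integrable f ∧ ∫ w, ‖f w‖ ≤
      √(r ^ (n + 1) * volume.real (Metric.ball (0 : Space n) 1)) * ‖f‖ := by
  have hm : MeasurableSet (ball w₀ r) := (isOpen_ball w₀ r).measurableSet
  have hfin : volume (ball w₀ r) ≠ ⊤ :=
    ((measure_mono (ball_subset_metricBall w₀ r)).trans_lt measure_ball_lt_top).ne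
  set χ : Space n → ℝ := (ball w₀ r).indicator fun _ => 1 with hχ
  have hχ2 : MemLp χ 2 volume := memLp_indicator_const 2 hm 1 (Or.inr hfin)
  have hχi : ∫ w, χ w ^ 2 = volume.real (ball w₀ r) := by
    have : ∀ w, χ w ^ 2 = χ w := fun w => by
      by_cases hw : w ∈ ball w₀ r <;> simp [hχ, hw]
    simp only [this]
    rw [hχ, integral_indicator_const _ hm]; simp
  have he : ∀ᵐ w : Space n, ‖f w‖ = ‖f w‖ * χ w := by
    filter_upwards [hf] with w hw
    by_cases h : w ∈ ball w₀ r
    · simp [hχ, h]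
    · simp [hw h]
  have hint : Integrable (fun w => ‖f w‖ * χ w) := (Lp.memLp f).norm.integrable_mul hχ2
  have hfi : Integrable (fun w => ‖f w‖) := hint.congr (he.mono fun w hw => hw.symm)
  refine ⟨(integrable_norm_iff (Lp.aestronglyMeasurable f)).1 hfi, ?_⟩
  rw [integral_congr_ae he]
  -- Cauchy–Schwarz against the indicator of the ball, which costs the square root of the volume.
  have h1 := norm_integral_mul_le (μ := (volume : Measure (Space n))) (f := fun w => (‖f w‖ : ℂ))
    (g := fun w => (χ w : ℂ)) (Lp.memLp f).norm.ofReal hχ2.ofReal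
  simp only [← Complex.ofReal_mul, integral_complex_ofReal, Complex.norm_real,
    Real.norm_eq_abs, sq_abs, hχi] at h1
  rw [norm_Lp_eq_sqrt, mul_comm]
  refine (le_abs_self _).trans (h1.trans ?_)
  gcongr
  exact measureReal_ball_le w₀ hr

/-- The dispersive estimate for solutions. -/
theorem IsSolution.ae_norm_le (hu : IsSolution f u) (hn : n ≠ 0) {k s r : ℝ} (hs : s ≠ 0)
    (hr : 0 ≤ r) (hrs : k * |s| / 2 + r ≤ n * |s| / 2) {w₀ : Space n}
    (hf : ∀ᵐ w : Space n, w ∉ ball w₀ r → f w = 0) :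
    ∀ᵐ w : Space n, w ∈ ball w₀ (k * |s| / 2) → ‖u s w‖ ≤
      √(4 / Real.pi) ^ n * (8 / Real.pi) * (|s|⁻¹ * √(|s|⁻¹) ^ n) *
        (√(r ^ (n + 1) * volume.real (Metric.ball (0 : Space n) 1)) * ‖f‖) := by
  obtain ⟨hfi, hfle⟩ := integrable_of_ae_eq_zero_off_ball hr hf
  refine ae_norm_le_of_forall_integral_le ((Lp.memLp (u s)).locallyIntegrable (by norm_num))
    (isOpen_ball _ _) fun w hw hwc hsupp => ?_
  refine hu.norm_integral_conj_mul_le hn s hw hwc fun ε h hε hh => ?_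
  have hfm := Lp.stronglyMeasurable f
  have hci : Integrable (cutoff h f) := hfi.mono
    (stronglyMeasurable_cutoff hfm h).aestronglyMeasurable (.of_forall (norm_cutoff_le hh.le f))
  refine (norm_mehlerPairing_le_of_kernel hn (z := ε + s * Complex.I) (by simpa using hε) hw hwc
    (stronglyMeasurable_cutoff hfm h) hci
    (B := √(4 / Real.pi) ^ n * (8 / Real.pi) * (|s|⁻¹ * √(|s|⁻¹) ^ n)) fun p hp => ?_).trans ?_
  · filter_upwards [hf] with q hq hcq
    have hqb : q ∈ ball w₀ r := by
      by_contra h0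
      exact hcq (by rw [cutoff, hq h0, zero_mul])
    have h1 := abs_snd_sub_lt_of_mem_ball hqb
    have h2 := abs_snd_sub_lt_of_mem_ball (hsupp p hp)
    refine norm_grushinKernel_le hn hε hs ?_ p.1 q.1
    -- Only the `t`-coordinates matter: they differ by less than `k|s|/2 + r ≤ n|s|/2`, the range of
    -- the kernel bound.
    have h3 : |p.2 - q.2| ≤ |p.2 - w₀.2| + |q.2 - w₀.2| := by
      rw [abs_sub_comm q.2]; exact abs_sub_le _ _ _
    linarith
  · have h1 : ∫ q, ‖cutoff h f q‖ ≤ ∫ q, ‖f q‖ :=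
      integral_mono hci.norm hfi.norm fun q => norm_cutoff_le hh.le f q
    have h2 : 0 ≤ ∫ p, ‖w p‖ := integral_nonneg fun _ => norm_nonneg _
    have := h1.trans hfle
    gcongr

end Consequences

/-! ### Interpolation and the time integral -/

section Interpolation

/-- Interpolation between `L²` and `L^∞`. -/
lemma eLpNorm_le_rpow_mul_rpow {α : Type*} [MeasurableSpace α] {μ : Measure α} {g : α → ℂ}
    {p A b : ℝ≥0∞} (hp : 2 ≤ p) (hA : eLpNorm g 2 μ ≤ A) (hb : eLpNorm g ∞ μ ≤ b) (hb' : b ≠ ∞) :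
    eLpNorm g p μ ≤ A ^ (2 / p.toReal) * b ^ (1 - 2 / p.toReal) := by
  rcases eq_or_ne p ∞ with rfl | hptop
  -- At `p = ∞` the convention `2 / 0 = 0` yields the exponents `0` and `1`, as it should.
  · simpa using hb
  have hp0 : p ≠ 0 := (lt_of_lt_of_le two_pos hp).ne'
  set ρ := p.toReal with hρ
  have hρ2 : 2 ≤ ρ := by
    have := ENNReal.toReal_mono hptop hp
    simpa using this
  have hρ0 : 0 < ρ := by linarith
  have h2 : ∫⁻ x, ‖g x‖ₑ ^ (2 : ℝ) ∂μ ≤ A ^ (2 : ℝ) := by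
    rw [eLpNorm_eq_lintegral_rpow_enorm_toReal two_ne_zero ENNReal.ofNat_ne_top] at hA
    have := ENNReal.rpow_le_rpow hA (zero_le_two (α := ℝ))
    rw [← ENNReal.rpow_mul] at this
    simpa using this
  have hae : ∀ᵐ x ∂μ, ‖g x‖ₑ ^ ρ ≤ ‖g x‖ₑ ^ (2 : ℝ) * b ^ (ρ - 2) := by
    rw [eLpNorm_exponent_top] at hb
    filter_upwards [ae_le_eLpNormEssSup (f := g) (μ := μ)] with x hx
    have : ρ = 2 + (ρ - 2) := by ring
    conv_lhs => rw [this]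
    rw [ENNReal.rpow_add_of_nonneg _ _ (by norm_num) (by linarith)]
    have := hx.trans hb
    have h3 : 0 ≤ ρ - 2 := by linarith
    gcongr
  rw [eLpNorm_eq_lintegral_rpow_enorm_toReal hp0 hptop]
  calc _ ≤ (A ^ (2 : ℝ) * b ^ (ρ - 2)) ^ (1 / ρ) := by
        gcongr
        refine (lintegral_mono_ae hae).trans ?_
        rw [lintegral_mul_const' _ _ (ENNReal.rpow_ne_top_of_nonneg (by linarith) hb')]
        gcongr
    _ = _ := by
        rw [ENNReal.mul_rpow_of_nonneg _ _ (by positivity), ← ENNReal.rpow_mul, ← ENNReal.rpow_mul]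
        congr 2 <;> field_simp

/-- By evenness the integral is twice `∫ t^(-(n+2))` over `t > a`, an elementary power integral. -/
lemma lintegral_abs_inv_pow_le (n : ℕ) {a : ℝ} (ha : 0 < a) :
    ∫⁻ s in Set.Iic (-a) ∪ Set.Ici a, ENNReal.ofReal (|s|⁻¹ ^ (n + 2)) ≤
      ENNReal.ofReal (2 / (n + 1) * a⁻¹ ^ (n + 1)) := by
  set ψ : ℝ → ℝ := (Set.Ici a).indicator fun t => t⁻¹ ^ (n + 2) with hψ
  have hψ0 : ∀ t, 0 ≤ ψ t := fun t => Set.indicator_nonneg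
    (fun t ht => pow_nonneg (inv_nonneg.2 (ha.le.trans ht)) _) t
  have h1 : ∫ s, ψ |s| = 2 / (n + 1) * a⁻¹ ^ (n + 1) := by
    rw [integral_comp_abs (f := ψ), hψ, setIntegral_indicator measurableSet_Ici]
    have h2 : Set.Ioi (0 : ℝ) ∩ Set.Ici a = Set.Ici a :=
      Set.inter_eq_right.2 fun t ht => lt_of_lt_of_le ha ht
    rw [h2, integral_Ici_eq_integral_Ioi]
    have h3 := integral_Ioi_rpow_of_lt (a := -((n : ℝ) + 2)) (by
      have : (0 : ℝ) ≤ n := Nat.cast_nonneg n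
      linarith) ha
    have h4 : ∫ t in Set.Ioi a, t⁻¹ ^ (n + 2) = ∫ t in Set.Ioi a, t ^ (-((n : ℝ) + 2)) := by
      refine setIntegral_congr_fun measurableSet_Ioi fun t ht => ?_
      have ht0 : 0 ≤ t := ha.le.trans (le_of_lt ht)
      rw [Real.rpow_neg ht0, inv_pow]
      congr 1
      exact_mod_cast (Real.rpow_natCast t (n + 2)).symm
    have h5 : a ^ (-((n : ℝ) + 2) + 1) = a⁻¹ ^ (n + 1) := by
      rw [inv_pow, ← Real.rpow_natCast, ← Real.rpow_neg ha.le]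
      congr 1; push_cast; ring
    rw [h4, h3, h5]
    have : (n : ℝ) + 1 ≠ 0 := by positivity
    have h6 : -((n : ℝ) + 2) + 1 = -(n + 1) := by ring
    rw [h6]
    field_simp
  have hi : Integrable fun s : ℝ => ψ |s| := by
    refine Integrable.of_integral_ne_zero ?_
    rw [h1]; positivity
  calc _ ≤ ∫⁻ s in Set.Iic (-a) ∪ Set.Ici a, ENNReal.ofReal (ψ |s|) := by
        refine setLIntegral_mono' (measurableSet_Iic.union measurableSet_Ici) fun s hs => ?_
        have : |s| ∈ Set.Ici a := by
          rw [Set.mem_Ici, le_abs']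
          exact hs
        rw [hψ, Set.indicator_of_mem this]
    _ ≤ ∫⁻ s, ENNReal.ofReal (ψ |s|) := setLIntegral_le_lintegral _ _
    _ = _ := by
        rw [← ofReal_integral_eq_lintegral_ofReal hi (.of_forall fun s => hψ0 _), h1]

end Interpolation

/-! ### From dispersion to the local Strichartz estimate -/

section Strichartz

variable {n : ℕ} {f : Lp ℂ 2 (volume : Measure (Space n))}
  {u : ℝ → Lp ℂ 2 (volume : Measure (Space n))}

/-- The time profile in the dispersive estimate for data in a ball of radius `r`. -/
noncomputable def dispersiveProfile (n : ℕ) (r s : ℝ) : ℝ :=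
  √(4 / Real.pi) ^ n * (8 / Real.pi) * (|s|⁻¹ * √(|s|⁻¹) ^ n) *
    √(r ^ (n + 1) * volume.real (Metric.ball (0 : Space n) 1))

lemma dispersiveProfile_nonneg (n : ℕ) (r s : ℝ) : 0 ≤ dispersiveProfile n r s := by
  unfold dispersiveProfile
  have := Real.pi_pos
  positivity

/-- Squaring turns all half-integer powers into integer ones. Only the square is needed, because the
`q`-th power of the interpolated factor `profile^(2/q)` is `profile²`. -/
lemma dispersiveProfile_sq (n : ℕ) {r : ℝ} (hr : 0 ≤ r) (s : ℝ) :
    dispersiveProfile n r s ^ 2 = (√(4 / Real.pi) ^ n * (8 / Real.pi)) ^ 2 *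
      volume.real (Metric.ball (0 : Space n) 1) * r ^ (n + 1) * |s|⁻¹ ^ (n + 2) := by
  rw [dispersiveProfile, mul_pow, mul_pow _ (|s|⁻¹ * _), Real.sq_sqrt (by positivity),
    mul_pow |s|⁻¹, pow_right_comm √(|s|⁻¹), Real.sq_sqrt (by positivity)]
  ring

/-- Interpolated decay of a solution in the region `B(w₀, k |s| / 2)`. -/
lemma IsSolution.eLpNorm_restrict_ball_le (hu : IsSolution f u) (hn : n ≠ 0) {p : ℝ≥0∞}
    (hp : 2 ≤ p) (hp' : 0 ≤ 1 - 2 / p.toReal) {k s r : ℝ} (hs : s ≠ 0) (hr : 0 ≤ r)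
    (hrs : k * |s| / 2 + r ≤ n * |s| / 2) {w₀ : Space n}
    (hf : ∀ᵐ w : Space n, w ∉ ball w₀ r → f w = 0) :
    eLpNorm (u s) p (volume.restrict (ball w₀ (k * |s| / 2))) ≤ eLpNorm f 2 volume *
      ENNReal.ofReal (dispersiveProfile n r s) ^ (1 - 2 / p.toReal) := by
  have hA : eLpNorm (u s) 2 (volume.restrict (ball w₀ (k * |s| / 2))) ≤ eLpNorm f 2 volume := by
    refine (eLpNorm_restrict_le _ _ _ _).trans ?_
    have := hu.norm_le hn s
    rw [Lp.norm_def, Lp.norm_def] at this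
    exact (ENNReal.toReal_le_toReal (Lp.eLpNorm_ne_top _) (Lp.eLpNorm_ne_top _)).1 this
  have hB : eLpNorm (u s) ∞ (volume.restrict (ball w₀ (k * |s| / 2))) ≤
      ENNReal.ofReal (dispersiveProfile n r s) * eLpNorm f 2 volume := by
    have h1 : eLpNorm f 2 volume = ENNReal.ofReal ‖f‖ := by
      rw [Lp.norm_def, ENNReal.ofReal_toReal (Lp.eLpNorm_ne_top _)]
    rw [h1, ← ENNReal.ofReal_mul (dispersiveProfile_nonneg n r s), eLpNorm_exponent_top]
    refine eLpNormEssSup_le_of_ae_bound ?_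
    rw [ae_restrict_iff' (isOpen_ball _ _).measurableSet]
    filter_upwards [hu.ae_norm_le hn hs hr hrs hf] with w hw hwb
    rw [dispersiveProfile, mul_assoc]
    exact hw hwb
  refine (eLpNorm_le_rpow_mul_rpow hp hA hB
    (ENNReal.mul_ne_top ENNReal.ofReal_ne_top (Lp.eLpNorm_ne_top f))).trans_eq ?_
  rw [ENNReal.mul_rpow_of_nonneg _ _ hp', mul_left_comm, ← ENNReal.rpow_add_of_nonneg _ _
    (by positivity) hp', add_sub_cancel, ENNReal.rpow_one, mul_comm]

end Strichartz

end Grushin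

theorem theorem1p3 (n : ℕ) (k : ℝ) (hk : k < n) (p q : ℝ≥0∞) (hp : 2 ≤ p)
    (hpq : 1 / p + 1 / q = 1 / 2) :
    ∃ C : ℝ≥0, ∀ (w₀ : Grushin.Space n) (R₀ : ℝ), 0 < R₀ →
      ∀ f : Lp ℂ 2 (volume : Measure (Grushin.Space n)),
        (∀ᵐ w : Grushin.Space n, w ∉ Grushin.ball w₀ R₀ → f w = 0) →
        ∀ u : ℝ → Lp ℂ 2 (volume : Measure (Grushin.Space n)), Grushin.IsSolution f u →
          eLpNorm
            (fun s : ℝ => eLpNorm (u s) p (volume.restrict (Grushin.ball w₀ (k * |s| / 2))))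
            q (volume.restrict
              (Set.Iic (-(2 / (n - k) * R₀)) ∪ Set.Ici (2 / (n - k) * R₀)))
          ≤ C * eLpNorm f 2 volume := by
  -- For `k ≤ 0` all the balls are empty and the left side is zero.
  rcases le_or_gt k 0 with hk0 | hk0
  · refine ⟨0, fun w₀ R₀ _ f _ u _ => ?_⟩
    have h1 : ∀ s : ℝ, Grushin.ball w₀ (k * |s| / 2) = ∅ := fun s =>
      Grushin.ball_eq_empty w₀ (by nlinarith [abs_nonneg s])
    simp only [h1, Measure.restrict_empty, eLpNorm_measure_zero]
    simp
  have hn : n ≠ 0 := by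
    rintro rfl
    exact absurd (hk0.trans hk) (by simp)
  have hnk : 0 < n - k := sub_pos.2 hk
  have htop : (1 / 2 : ℝ≥0∞) ≠ ∞ := by simp
  have hq0 : q ≠ 0 := by
    rintro rfl
    exact htop (by rw [← hpq]; simp)
  have hrel : 1 / p.toReal + 1 / q.toReal = 1 / 2 := by
    have h1 : 1 / p ≠ ∞ := fun h => htop (by rw [← hpq, h, top_add])
    have h2 : 1 / q ≠ ∞ := fun h => htop (by rw [← hpq, h, add_top])
    have := congrArg ENNReal.toReal hpq
    rw [ENNReal.toReal_add h1 h2] at this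
    simpa using this
  -- Valid at both endpoints too, since `∞.toReal = 0` and division by zero is zero.
  have hθ : 1 - 2 / p.toReal = 2 / q.toReal := by
    have h1 : 2 / p.toReal = 2 * (1 / p.toReal) := by ring
    have h2 : 2 / q.toReal = 2 * (1 / q.toReal) := by ring
    rw [h1, h2]; linarith
  have hθ0 : 0 ≤ 1 - 2 / p.toReal := hθ ▸ by positivity
  -- The integral bound for `profile²` over `|s| ≥ 2R₀/(n-k)`: the factor `R₀^(n+1)` from the
  -- support cancels `R₀^(-(n+1))` from the time integral, leaving `((n-k)/2)^(n+1)`.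
  set D : ℝ := (√(4 / Real.pi) ^ n * (8 / Real.pi)) ^ 2 *
    volume.real (Metric.ball (0 : Grushin.Space n) 1) *
      (2 / (n + 1) * ((n - k) / 2) ^ (n + 1)) with hD
  have hDtop : ENNReal.ofReal D ^ (1 / q.toReal) ≠ ∞ :=
    ENNReal.rpow_ne_top_of_nonneg (by positivity) ENNReal.ofReal_ne_top
  refine ⟨(ENNReal.ofReal D ^ (1 / q.toReal)).toNNReal, fun w₀ R₀ hR f hf u hu => ?_⟩
  rw [ENNReal.coe_toNNReal hDtop]
  set a : ℝ := 2 / (n - k) * R₀ with ha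
  have ha0 : 0 < a := by positivity
  set S : Set ℝ := Set.Iic (-a) ∪ Set.Ici a with hS
  have hSm : MeasurableSet S := measurableSet_Iic.union measurableSet_Ici
  have hF : ∀ s ∈ S, eLpNorm (u s) p (volume.restrict (Grushin.ball w₀ (k * |s| / 2))) ≤
      eLpNorm f 2 volume *
        ENNReal.ofReal (Grushin.dispersiveProfile n R₀ s) ^ (2 / q.toReal) := by
    intro s hs
    have has : a ≤ |s| := by
      rw [le_abs']
      exact hs
    rw [← hθ]
    refine hu.eLpNorm_restrict_ball_le hn hp hθ0 (abs_pos.1 (ha0.trans_le has)) hR.le ?_ hf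
    -- The threshold says `2R₀ ≤ (n - k)|s|`, that is `k|s|/2 + R₀ ≤ n|s|/2`.
    rw [ha, div_mul_eq_mul_div, div_le_iff₀ hnk] at has
    linarith
  -- For `q = ∞`, which forces `p = 2`, all exponents are zero, the constant is 1 and the estimate
  -- is the `L²` bound.
  rcases eq_or_ne q ∞ with rfl | hqtop
  · simp only [ENNReal.toReal_top, div_zero, ENNReal.rpow_zero, mul_one, one_mul] at hF ⊢
    rw [eLpNorm_exponent_top]
    refine eLpNormEssSup_le_of_ae_enorm_bound ?_
    rw [ae_restrict_iff' hSm]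
    exact .of_forall fun s hs => by simpa using hF s hs
  have hq' : 0 < q.toReal := ENNReal.toReal_pos hq0 hqtop
  rw [eLpNorm_eq_lintegral_rpow_enorm_toReal hq0 hqtop]
  simp only [enorm_eq_self]
  have hint : ∫⁻ s in S, ENNReal.ofReal (Grushin.dispersiveProfile n R₀ s ^ 2) ≤
      ENNReal.ofReal D := by
    simp only [Grushin.dispersiveProfile_sq n hR.le]
    have h0 : 0 ≤ (√(4 / Real.pi) ^ n * (8 / Real.pi)) ^ 2 *
      volume.real (Metric.ball (0 : Grushin.Space n) 1) * R₀ ^ (n + 1) := by positivity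
    simp only [ENNReal.ofReal_mul h0]
    rw [lintegral_const_mul' _ _ ENNReal.ofReal_ne_top]
    refine (mul_le_mul_right (Grushin.lintegral_abs_inv_pow_le n ha0) _).trans_eq ?_
    rw [← ENNReal.ofReal_mul h0, hD, ha]
    congr 1
    have h1 : (2 / (n - k) * R₀)⁻¹ ^ (n + 1) = ((n - k) / 2) ^ (n + 1) * (R₀ ^ (n + 1))⁻¹ := by
      rw [mul_inv, inv_div, mul_pow, inv_pow]
    rw [h1]
    field_simp
  calc _ ≤ (∫⁻ s in S, eLpNorm f 2 volume ^ q.toReal *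
          ENNReal.ofReal (Grushin.dispersiveProfile n R₀ s ^ 2)) ^ (1 / q.toReal) := by
        gcongr ?_ ^ _
        refine setLIntegral_mono' hSm fun s hs => ?_
        refine (ENNReal.rpow_le_rpow (hF s hs) hq'.le).trans_eq ?_
        rw [ENNReal.mul_rpow_of_nonneg _ _ hq'.le, ← ENNReal.rpow_mul,
          div_mul_cancel₀ _ hq'.ne', ENNReal.ofReal_pow (Grushin.dispersiveProfile_nonneg n R₀ s)]
        norm_cast
    _ ≤ (eLpNorm f 2 volume ^ q.toReal * ENNReal.ofReal D) ^ (1 / q.toReal) := by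
        rw [lintegral_const_mul' _ _ (ENNReal.rpow_ne_top_of_nonneg hq'.le (Lp.eLpNorm_ne_top f))]
        gcongr
    _ = _ := by
        rw [ENNReal.mul_rpow_of_nonneg _ _ (by positivity), ← ENNReal.rpow_mul,
          mul_one_div_cancel hq'.ne', ENNReal.rpow_one, mul_comm]
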